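/- Definitions. A *ramification* is a holomorphic map germ $\rho:(\mathbb C^2,0)\to(\mathbb C^2,0)$ which, in suitable holomorphic coordinates at the source and at the target, is $(t,y)\mapsto(t^n,y)$ for some integer $n\ge 1$. A finite sequence of blowing-ups of $(\mathbb C^2,0)$ is a composition $\pi:X\to(\mathbb C^2,0)$ of finitely many (possibly zero) point blowing-ups whose centers lie over the origin. The *elimination of indeterminations* of $\pi^{-1}\circ\rho$ is the minimal finite sequence of blowing-ups $\tilde\pi:\tilde X\to(\mathbb C^2,0)$ such that $\pi^{-1}\circ\rho\circ\tilde\pi:\tilde X\to X$ is holomorphic. A singularity of a holomorphic foliation on a surface is *simple* if the eigenvalues $\lambda,\mu$ of the linear part of a vector field generating the foliation there satisfy (up to order) $\mu\neq0$ and $\lambda/\mu\notin\mathbb Q_{>0}$. All pulled-back foliations are saturated (common factors of the defining $1$-form are removed). The sequence $\pi$, with exceptional divisor $E=\pi^{-1}(0)$ ($E=\emptyset$ if there are no blowing-ups), is a *reduction of singularities* of a foliation $\mathcal F$ on $(\mathbb C^2,0)$ if at each point $P\in\pi^{-1}(0)$ one of the following holds: (a) $\pi^\star\mathcal F$ is regular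 at $P$ and has normal crossings with $E$ there, i.e. in suitable coordinates $(u,v)$ at $P$ it is given by $du=0$ and $E\subset\{uv=0\}$; (b) $\pi^\star\mathcal F$ has a simple singularity at $P$ and every component of $E$ through $P$ is invariant. Theorem. Let $\mathcal F$ be a (possibly singular) holomorphic foliation on $(\mathbb C^2,0)$, given by a holomorphic $1$-form with isolated zeros, and let $\pi$ be a finite sequence of blowing-ups which is a reduction of singularities of $\mathcal F$. Then there is a ramification $\rho:(\mathbb C^2,0)\to(\mathbb C^2,0)$ such that the elimination of indeterminations $\tilde\pi$ of $\pi^{-1}\circ\rho$ is a finite sequence of blowing-ups each of whose centers, except the initial center $0$, is a regular point of the exceptional divisor obtained so far, and such that every point of $\tilde\pi^{-1}(0)$ is either a regular point or a simple singularity of $\tilde\pi^\star\rho^\star\mathcal F$. -/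

import Mathlib

open Filter Topology

/-! ### Germs of holomorphic maps of `(ℂ², 0)` -/

/-- A holomorphic map germ `(ℂ², 0) → (ℂ², 0)`. -/
def IsHolMapGerm (f : ℂ × ℂ → ℂ × ℂ) : Prop :=
  AnalyticAt ℂ f 0 ∧ f 0 = 0

/-- A germ of biholomorphism of `(ℂ², 0)`, that is, a change of coordinates at the origin. -/
def IsBiholGerm (f : ℂ × ℂ → ℂ × ℂ) : Prop :=
  IsHolMapGerm f ∧ ∃ g : ℂ × ℂ → ℂ × ℂ,
    IsHolMapGerm g ∧ g ∘ f =ᶠ[𝓝 0] id ∧ f ∘ g =ᶠ[𝓝 0] id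

/-- A ramification morphism of `(ℂ², 0)`: in suitable holomorphic coordinates at the source and at
the target it is `(t, y) ↦ (t ^ n, y)` for some `n ≥ 1`. -/
def IsRamification (ρ : ℂ × ℂ → ℂ × ℂ) : Prop :=
  ∃ n : ℕ, 1 ≤ n ∧ ∃ f g : ℂ × ℂ → ℂ × ℂ, IsBiholGerm f ∧ IsBiholGerm g ∧
    ρ =ᶠ[𝓝 0] fun q => f ((g q).1 ^ n, (g q).2)

/-! ### Point blowing-ups over `(ℂ², 0)`

The points of the exceptional divisor of the blowing-up of a point with local coordinates `(x, y)`
are the directions at that point, i.e. the elements of `ℙ¹ = ℂ ∪ {∞}`: the direction `c` is the line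
`y = c x` and `∞` is the line `x = 0`. Each such point carries the usual coordinates `(u, v)` of
the affine charts of the blowing-up, centred at that point. -/

/-- The blowing-up of `(ℂ², 0)` in the standard coordinates centred at the point `d` of its
exceptional divisor. -/
def blowUpChart : OnePoint ℂ → ℂ × ℂ → ℂ × ℂ
  | none, q => (q.1 * q.2, q.2)
  | some c, q => (q.1, q.1 * (q.2 + c))

/-- The points infinitely near to the origin of `ℂ²`: the origin itself, and, for each infinitely
near point `p`, the points `above p d` (`d ∈ ℙ¹`) of the exceptional divisor of the blowing-up
of `p`. -/
inductive InfNearPoint : Type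
  | origin : InfNearPoint
  | above : InfNearPoint → OnePoint ℂ → InfNearPoint

/-- The composition of blowing-ups, down to `(ℂ², 0)`, in the standard coordinates `(u, v)`
centred at the infinitely near point. -/
def InfNearPoint.proj : InfNearPoint → ℂ × ℂ → ℂ × ℂ
  | .origin => id
  | .above p d => p.proj ∘ blowUpChart d

/-- Let `L` be the list of the centres of a sequence of blowing-ups `X → (ℂ², 0)`. This is the set
of points of `X` that lie over the origin: those that have appeared (the origin, and the points of
the exceptional divisors of the blown-up points) and have not been blown up. The germ of `X` at
such a point `p` is `(ℂ², 0)` with the standard coordinates at `p`, and `X → (ℂ², 0)` is `p.proj`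
near `p`. -/
def pointsOverOrigin (L : List InfNearPoint) : Set InfNearPoint :=
  {p | p ∉ L ∧ match p with
    | .origin => True
    | .above q _ => q ∈ L}

/-- `L` lists the centres (the latest one first) of a finite sequence of point blowing-ups of
`(ℂ², 0)`: each centre is a point over the origin of the surface obtained so far. -/
def IsBlowUpSequence : List InfNearPoint → Prop
  | [] => True
  | p :: L => IsBlowUpSequence L ∧ p ∈ pointsOverOrigin L

/-- The axis `u = 0` at `p` is a component of the exceptional divisor (the preimage of the
origin). -/
def InfNearPoint.ExcFst (p : InfNearPoint) : Prop := ∀ v : ℂ, p.proj (0, v) = 0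

/-- The axis `v = 0` at `p` is a component of the exceptional divisor. -/
def InfNearPoint.ExcSnd (p : InfNearPoint) : Prop := ∀ u : ℂ, p.proj (u, 0) = 0

/-- `p` is a singular point (a corner) of the exceptional divisor. In the standard coordinates,
near any infinitely near point the divisor consists of none, one or two of the coordinate axes. -/
def InfNearPoint.IsCorner (p : InfNearPoint) : Prop := p.ExcFst ∧ p.ExcSnd

/-- A finite sequence of blowing-ups whose centres are (after the initial one, where there is no
divisor yet) regular points of the exceptional divisors. -/
def IsRegularBlowUpSequence (L : List InfNearPoint) : Prop :=
  IsBlowUpSequence L ∧ ∀ p ∈ L, ¬ p.IsCorner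

/-- The map germ `φ : (ℂ², 0) → (ℂ², 0)` lifts to a map germ from `(ℂ², 0)` to the surface obtained
by the sequence of blowing-ups `L`. -/
def LiftsTo (φ : ℂ × ℂ → ℂ × ℂ) (L : List InfNearPoint) : Prop :=
  ∃ p ∈ pointsOverOrigin L, ∃ g : ℂ × ℂ → ℂ × ℂ, IsHolMapGerm g ∧ φ =ᶠ[𝓝 0] p.proj ∘ g

/-- With `π : X → (ℂ², 0)` and `σ : Y → (ℂ², 0)` the sequences of blowing-ups `L` and `M`:
the meromorphic map `π⁻¹ ∘ ρ ∘ σ : Y → X` is a holomorphic map. (It is unique where it exists, so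
this can be tested at each point of `Y` over the origin.) -/
def Resolves (L : List InfNearPoint) (ρ : ℂ × ℂ → ℂ × ℂ) (M : List InfNearPoint) : Prop :=
  ∀ p ∈ pointsOverOrigin M, LiftsTo (ρ ∘ p.proj) L

/-- `M` is the elimination of indeterminations of `π⁻¹ ∘ ρ`, with `π` the sequence of
blowing-ups `L`: the minimal sequence of blowing-ups that makes it holomorphic, i.e. every other
such sequence factors through `M`. -/
def IsEliminationOfIndet (L : List InfNearPoint) (ρ : ℂ × ℂ → ℂ × ℂ) (M : List InfNearPoint) :
    Prop :=
  IsBlowUpSequence M ∧ Resolves L ρ M ∧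
    ∀ M' : List InfNearPoint, IsBlowUpSequence M' → Resolves L ρ M' → Resolves M id M'

/-! ### Germs of foliations -/

/-- A (possibly singular) holomorphic foliation on `(ℂ², 0)`, given by the germ of a holomorphic
1-form `ω` whose zeros are isolated, i.e. whose coefficients have no common factor. -/
structure FoliationGerm where
  /-- the defining 1-form -/
  ω : ℂ × ℂ → (ℂ × ℂ →L[ℂ] ℂ)
  analytic : AnalyticAt ℂ ω 0
  isolated : ∀ᶠ q in 𝓝[≠] 0, ω q ≠ 0

namespace FoliationGerm

/-- `G` is the pullback of the foliation `F` by the map germ `φ`: the 1-form `φ^* ω_F` is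
`h · ω_G` with `h` holomorphic and not identically zero. -/
def IsPullback (φ : ℂ × ℂ → ℂ × ℂ) (F G : FoliationGerm) : Prop :=
  ∃ h : ℂ × ℂ → ℂ, AnalyticAt ℂ h 0 ∧ (∃ᶠ q in 𝓝 0, h q ≠ 0) ∧
    ∀ᶠ q in 𝓝 0, (F.ω (φ q)).comp (fderiv ℂ φ q) = h q • G.ω q

/-- The origin is a regular point of the foliation. -/
def IsRegular (F : FoliationGerm) : Prop := F.ω 0 ≠ 0

/-- The vector field `b ∂/∂u - a ∂/∂v` dual to `ω = a du + b dv`, which generates the foliation. -/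
noncomputable def dualField (F : FoliationGerm) (q : ℂ × ℂ) : ℂ × ℂ := (F.ω q (0, 1), - F.ω q (1, 0))

/-- The origin is a simple singularity: the eigenvalues `l, m` of the linear part of a generating
vector field are such that `m ≠ 0` and `l / m` is not a positive rational number. -/
def IsSimpleSingularity (F : FoliationGerm) : Prop :=
  F.ω 0 = 0 ∧ ∃ l m : ℂ,
    (LinearMap.charpoly (fderiv ℂ F.dualField 0 : ℂ × ℂ →ₗ[ℂ] ℂ × ℂ)).roots = {l, m} ∧
    m ≠ 0 ∧ ∀ r : ℚ, 0 < r → l / m ≠ (r : ℂ)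

/-- The axis `u = 0` is invariant. -/
def InvariantFst (F : FoliationGerm) : Prop := ∀ᶠ v : ℂ in 𝓝 0, F.ω (0, v) (0, 1) = 0

/-- The axis `v = 0` is invariant. -/
def InvariantSnd (F : FoliationGerm) : Prop := ∀ᶠ u : ℂ in 𝓝 0, F.ω (u, 0) (1, 0) = 0

/-- The axis `u = 0` is transversal to the foliation at the origin. -/
def TransversalFst (F : FoliationGerm) : Prop := F.ω 0 (0, 1) ≠ 0

/-- The axis `v = 0` is transversal to the foliation at the origin. -/
def TransversalSnd (F : FoliationGerm) : Prop := F.ω 0 (1, 0) ≠ 0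

/-- `F`, a foliation on the germ at `p` of a blown-up surface, is regular at `p` and has normal
crossings there with the exceptional divisor: each component of the divisor through `p` is
invariant or transversal to `F`, and at a corner the two are not both transversal. -/
def IsRegularNC (F : FoliationGerm) (p : InfNearPoint) : Prop :=
  F.IsRegular ∧ (p.ExcFst → F.InvariantFst ∨ F.TransversalFst) ∧
    (p.ExcSnd → F.InvariantSnd ∨ F.TransversalSnd) ∧
    (p.IsCorner → F.InvariantFst ∨ F.InvariantSnd)

/-- `F`, a foliation on the germ at `p` of a blown-up surface, has a simple singularity at `p` and
the components of the exceptional divisor through `p` are invariant. -/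
def IsSimpleAdapted (F : FoliationGerm) (p : InfNearPoint) : Prop :=
  F.IsSimpleSingularity ∧ (p.ExcFst → F.InvariantFst) ∧ (p.ExcSnd → F.InvariantSnd)

/-- The sequence of blowing-ups `L` is a reduction of singularities of `F`: at each point over the
origin, the pulled-back foliation is regular and has normal crossings with the exceptional divisor,
or has a simple singularity and leaves the exceptional divisor invariant. -/
def IsReductionOfSingularities (F : FoliationGerm) (L : List InfNearPoint) : Prop :=
  IsBlowUpSequence L ∧ ∀ p ∈ pointsOverOrigin L,
    ∃ G : FoliationGerm, IsPullback p.proj F G ∧ (G.IsRegularNC p ∨ G.IsSimpleAdapted p)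

/-- The pullback of `F` by the sequence of blowing-ups `L` has only simple singularities. -/
def HasOnlySimpleSingularitiesAfter (F : FoliationGerm) (L : List InfNearPoint) : Prop :=
  ∀ p ∈ pointsOverOrigin L,
    ∃ G : FoliationGerm, IsPullback p.proj F G ∧ (G.IsRegular ∨ G.IsSimpleSingularity)

end FoliationGerm

/-! If `π` is not trivial, the ramification is taken along a generic smooth curve. On the first
exceptional divisor `E₁` there is a direction `d` with no centre over it, at which the foliation is
regular and leaves `E₁` invariant or crosses it transversally, and a curve `y = d x + e x²` whose
strict transform crosses both `E₁` and the foliation transversally there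
(`IsAdaptedTree.exists_generic_direction`). Put `ρ(t, y) = (y, d y + e y² + tⁿ)` with `n` highly
divisible. Blowing up `n` times along the curve `y = 0` of the source gives a last divisor whose
finite points `c` go to the directions `d + 1/c` of `E₁` (`0` going to `∞`), and the lift is
ramified to order `n` along it. At the remaining points over the origin the germ lifts to the well
placed direction `d` (`good_curveMap`).

What remains is local at a point of `E₁`: a germ `(tⁿ U, V)` with `U` a unit and `V` transversal to
`t = 0`, over a tree of centres of smaller height. If the point is a centre, the source is blown up
along `V = 0`, which gives germs `(tⁿ U, tᵏ V)` for `k = 1, …, n` (`good_of_blowUp_powMap`). Three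
kinds of points appear. - Where `V` vanishes, the process goes on with `k + 1`, and at `k = n` the
germ lifts by one level. - Where `V` is a unit, `(tⁿ U, tᵏ V)` climbs the target tree by Euclid's
algorithm on the exponents. If these become equal, to `a` say, the next lift is a ramification of
order `a` over a lower tree (`powersGood_succ`). - At a corner of the source the germ is monomial
with exponent vectors `(n, k)` and `(n, k + 1)`. It must lift without blowing up, since corners may
not be centres. It does, because no ray `(p, q)` with `p ∣ n` passes strictly between these vectors
(`unseparated_of_dvd`, `IsAdaptedTree.good_monMap`). Both of the last two points need divisibility:
an order divisible by `B! ^ m` suffices for trees of height `m`, each level using up one factor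
`B!`. The induction is `ramificationsGood_succ` together with `powersGood_succ`. Only finitely many
source points need further blowing-up, because `V ^ a / U ^ b` is preserved by Euclid's algorithm
and at its end is a power of a direction that carries a centre (`exists_finite_of_nonLift`).

Once a germ reaches a point that is not a centre, the pullback is computed explicitly
(`Adapted.simpleAfter_powMap_of_zero`, `Adapted.simpleAfter_powMap`, `Adapted.simpleAfter_monMap`).
At a singular pullback the eigenvalues are either in negative rational ratio or positive integer
combinations of data of the original simple singularity, so no positive rational ratio arises.

The centres of the elimination of indeterminations are exactly the infinitely near points at which
`ρ` does not lift (`isEliminationOfIndet_of_nonLift`), so minimality is automatic. In the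
construction they are reached through finite directions only, and such points are never corners
(`FiniteDirections.not_isCorner`). -/

/-! ### Division of analytic germs by a coordinate -/

/-- The `i`-th summand of the divided difference of a multilinear map `p` in the direction of the
first coordinate. -/
noncomputable def dividedTerm {n : ℕ}
    (p : ContinuousMultilinearMap ℂ (fun _ : Fin (n + 1) => ℂ × ℂ) ℂ) (i : Fin (n + 1)) :
    ContinuousMultilinearMap ℂ (fun _ : Fin n => ℂ × ℂ) ℂ :=
  (p.curryMid i (1, 0)).compContinuousLinearMap fun k =>
    if k.castSucc < i then (ContinuousLinearMap.inr ℂ ℂ ℂ).comp (ContinuousLinearMap.snd ℂ ℂ ℂ)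
    else ContinuousLinearMap.id ℂ (ℂ × ℂ)

lemma norm_dividedTerm_le {n : ℕ}
    (p : ContinuousMultilinearMap ℂ (fun _ : Fin (n + 1) => ℂ × ℂ) ℂ) (i : Fin (n + 1)) :
    ‖dividedTerm p i‖ ≤ ‖p‖ := by
  refine ContinuousMultilinearMap.opNorm_le_bound (norm_nonneg _) fun m => ?_
  have h1 : ∀ k : Fin n, ‖(if k.castSucc < i then
      (ContinuousLinearMap.inr ℂ ℂ ℂ).comp (ContinuousLinearMap.snd ℂ ℂ ℂ)
      else ContinuousLinearMap.id ℂ (ℂ × ℂ)) (m k)‖ ≤ ‖m k‖ := by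
    intro k
    split_ifs
    · simp [Prod.norm_def]
    · simp
  have h2 : ‖p.curryMid i (1, 0)‖ ≤ ‖p‖ := by
    refine ((p.curryMid i).le_opNorm _).trans ?_
    rw [ContinuousMultilinearMap.norm_curryMid]
    simp [Prod.norm_def]
  refine ((p.curryMid i (1, 0)).le_opNorm _).trans ?_
  refine mul_le_mul h2 ?_ (Finset.prod_nonneg fun _ _ => norm_nonneg _) (norm_nonneg _)
  exact Finset.prod_le_prod (fun _ _ => norm_nonneg _) fun k _ => h1 k

/-- Telescoping: the copies of `z` are replaced by `(0, z.2)` one slot at a time, and each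
replacement changes the value by `p` with `z.1 • (1, 0)` in that slot. -/
lemma sum_dividedTerm {n : ℕ}
    (p : ContinuousMultilinearMap ℂ (fun _ : Fin (n + 1) => ℂ × ℂ) ℂ) (z : ℂ × ℂ) :
    z.1 * ∑ i, dividedTerm p i (fun _ => z) = p (fun _ => z) - p (fun _ => (0, z.2)) := by
  let a : ℕ → ℂ := fun i => p fun j : Fin (n + 1) => if (j : ℕ) < i then (0, z.2) else z
  have key : ∀ i : Fin (n + 1), z.1 * dividedTerm p i (fun _ => z) = a i - a (i + 1) := by
    intro i
    let m : Fin (n + 1) → ℂ × ℂ := fun j => if (j : ℕ) < i then (0, z.2) else z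
    have e1 : a i = p (Function.update m i z) := by
      simp only [a]; congr 1; ext1 j
      rcases eq_or_ne j i with rfl | h
      · simp
      · simp [h, m]
    have e2 : a (i + 1) = p (Function.update m i (0, z.2)) := by
      simp only [a]; congr 1; ext1 j
      rcases eq_or_ne j i with rfl | h
      · simp
      · have : (j : ℕ) ≠ i := fun h' => h (Fin.ext h')
        have h3 : ((j : ℕ) < i + 1) ↔ (j : ℕ) < i := by omega
        simp [h, m, h3]
    have e3 : dividedTerm p i (fun _ => z) = p (Function.update m i (1, 0)) := by
      simp only [dividedTerm, ContinuousMultilinearMap.compContinuousLinearMap_apply,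
        ContinuousMultilinearMap.curryMid_apply]
      congr 1
      rw [Fin.insertNth_eq_iff]
      refine ⟨by simp, ?_⟩
      ext1 k
      simp only [Fin.removeNth, Function.update_of_ne (Fin.succAbove_ne i k), m]
      by_cases hk : k.castSucc < i
      · have : (k : ℕ) < i := hk
        simp [hk, Fin.succAbove_of_castSucc_lt i k hk, this]
      · have : ¬ ((k : ℕ) + 1 < i) := by
          have : ¬ ((k : ℕ) < i) := hk
          omega
        simp [hk, Fin.succAbove_of_le_castSucc i k (not_lt.mp hk), this]
    rw [e1, e2, e3, ← ContinuousMultilinearMap.map_update_sub, ← smul_eq_mul,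
      ← ContinuousMultilinearMap.map_update_smul]
    congr 2
    ext <;> simp
  rw [Finset.mul_sum, Finset.sum_congr rfl fun i _ => key i,
    Fin.sum_univ_eq_sum_range (fun i => a i - a (i + 1)), Finset.sum_range_sub']
  congr 1
  simp only [a]; congr 1; ext1 j; simp [j.2]

/-- An analytic germ is, up to a multiple of the first coordinate, its restriction to the second
axis. -/
lemma exists_eq_add_fst_mul {f : ℂ × ℂ → ℂ} (hf : AnalyticAt ℂ f 0) :
    ∃ g, AnalyticAt ℂ g 0 ∧ ∀ᶠ q in 𝓝 0, f q = f (0, q.2) + q.1 * g q := by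
  obtain ⟨p, r, hp⟩ := hf
  let s : FormalMultilinearSeries ℂ (ℂ × ℂ) ℂ := fun n => ∑ i, dividedTerm (p (n + 1)) i
  have hs : 0 < s.radius := by
    obtain ⟨C, R, hC, hR, h⟩ := p.le_mul_pow_of_radius_pos (hp.r_pos.trans_le hp.r_le)
    -- The radius is halved to absorb the `n + 1` summands of the divided difference, through `n + 1
    -- ≤ 2 ^ n`.
    have hR' : (0 : ℝ) < 2 * R := by positivity
    have : ((Real.toNNReal (2 * R)⁻¹ : NNReal) : ENNReal) ≤ s.radius := by
      refine s.le_radius_of_bound (C * R) fun n => ?_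
      rw [Real.coe_toNNReal _ (by positivity)]
      have h1 : ‖s n‖ ≤ (n + 1) * (C * R ^ (n + 1)) := by
        refine (norm_sum_le _ _).trans ?_
        refine (Finset.sum_le_sum fun i _ => (norm_dividedTerm_le (p (n + 1)) i).trans
          (h (n + 1))).trans ?_
        simp
      have h2 : ((n : ℝ) + 1) ≤ 2 ^ n := by exact_mod_cast Nat.lt_two_pow_self
      calc ‖s n‖ * ((2 * R)⁻¹) ^ n ≤ 2 ^ n * (C * R ^ (n + 1)) * ((2 * R)⁻¹) ^ n := by
            gcongr
            exact h1.trans (by gcongr)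
        _ = C * R := by
            rw [inv_pow, mul_pow, pow_succ]; field_simp
    refine lt_of_lt_of_le ?_ this
    simpa using hR
  have hg := s.hasFPowerSeriesOnBall hs
  refine ⟨s.sum, hg.analyticAt, ?_⟩
  have hc : Tendsto (fun q : ℂ × ℂ => ((0 : ℂ), q.2)) (𝓝 0) (𝓝 0) := by
    have : Continuous fun q : ℂ × ℂ => ((0 : ℂ), q.2) := by fun_prop
    exact this.tendsto' 0 0 rfl
  have hb : ∀ᶠ q : ℂ × ℂ in 𝓝 0, q ∈ Metric.eball (0 : ℂ × ℂ) r := Metric.eball_mem_nhds _ hp.r_pos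
  filter_upwards [hb, hc.eventually hb, Metric.eball_mem_nhds (0 : ℂ × ℂ) hs] with q h1 h2 h3
  have e1 := hp.hasSum h1
  have e2 := hp.hasSum h2
  have e3 := (hg.hasSum h3).mul_left q.1
  simp only [zero_add] at e1 e2 e3
  have e4 := ((hasSum_nat_add_iff' 1).mpr e1).sub ((hasSum_nat_add_iff' 1).mpr e2)
  have e5 : ∀ n, q.1 * s n (fun _ => q)
      = p (n + 1) (fun _ => q) - p (n + 1) (fun _ => ((0 : ℂ), q.2)) := by
    intro n
    rw [← sum_dividedTerm]
    simp [s]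
  simp only [e5] at e3
  have e6 := e3.unique e4
  have e7 : p 0 (fun _ => q) = p 0 (fun _ => ((0 : ℂ), q.2)) := by
    congr 1; ext1 i; exact i.elim0
  simp only [Finset.range_one, Finset.sum_singleton, e7] at e6
  rw [e6]; ring

/-! ### Germs of analytic functions -/

/-- Germs of analytic functions form an integral domain: near a point with `f ≠ 0` the factor `g`
vanishes identically, and the identity theorem on a ball does the rest. -/
lemma eventually_eq_zero_of_mul {f g : ℂ × ℂ → ℂ} (hf : AnalyticAt ℂ f 0) (hg : AnalyticAt ℂ g 0)
    (hf0 : ∃ᶠ q in 𝓝 0, f q ≠ 0) (h : ∀ᶠ q in 𝓝 0, f q * g q = 0) : ∀ᶠ q in 𝓝 0, g q = 0 := by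
  obtain ⟨r, hr, hb⟩ := Metric.eventually_nhds_iff_ball.mp
    ((hg.eventually_analyticAt.and hf.eventually_analyticAt).and h)
  obtain ⟨q, hq, hqb⟩ := (hf0.and_eventually (Metric.ball_mem_nhds _ hr)).exists
  have h1 : ∀ᶠ z in 𝓝 q, g z = 0 := by
    filter_upwards [(hb q hqb).1.2.continuousAt.eventually_ne hq,
      Metric.isOpen_ball.mem_nhds hqb] with z hz hzb
    exact (mul_eq_zero.mp (hb z hzb).2).resolve_left hz
  have h2 : AnalyticOnNhd ℂ g (Metric.ball 0 r) := fun z hz => (hb z hz).1.1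
  have h3 := h2.eqOn_zero_of_preconnected_of_eventuallyEq_zero
    (convex_ball (0 : ℂ × ℂ) r).isPreconnected hqb h1
  filter_upwards [Metric.ball_mem_nhds (0 : ℂ × ℂ) hr] with z hz using h3 hz

lemma frequently_mul_ne_zero {f g : ℂ × ℂ → ℂ} (hf : AnalyticAt ℂ f 0) (hg : AnalyticAt ℂ g 0)
    (hf0 : ∃ᶠ q in 𝓝 0, f q ≠ 0) (hg0 : ∃ᶠ q in 𝓝 0, g q ≠ 0) :
    ∃ᶠ q in 𝓝 0, f q * g q ≠ 0 := by
  intro h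
  simp only [ne_eq, not_not] at h
  exact hg0 ((eventually_eq_zero_of_mul hf hg hf0 h).mono fun _ h => not_not.mpr h)

lemma eventually_eq_of_ne {m f g : ℂ × ℂ → ℂ} (hm : AnalyticAt ℂ m 0) (hf : AnalyticAt ℂ f 0)
    (hg : AnalyticAt ℂ g 0) (hm0 : ∃ᶠ q in 𝓝 0, m q ≠ 0)
    (h : ∀ᶠ q in 𝓝 0, m q ≠ 0 → f q = g q) : ∀ᶠ q in 𝓝 0, f q = g q := by
  have := eventually_eq_zero_of_mul hm (hf.sub hg) hm0 (h.mono fun q hq => by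
    by_cases h0 : m q = 0
    · simp [h0]
    · simp [hq h0])
  exact this.mono fun q hq => sub_eq_zero.mp hq

lemma tendsto_inl_zero : Tendsto (fun x : ℂ => (x, (0 : ℂ))) (𝓝 0) (𝓝 0) :=
  Continuous.tendsto' (by fun_prop) 0 0 rfl

lemma tendsto_inr_zero : Tendsto (fun y : ℂ => ((0 : ℂ), y)) (𝓝 0) (𝓝 0) :=
  Continuous.tendsto' (by fun_prop) 0 0 rfl

lemma tendsto_fst_zero : Tendsto (fun q : ℂ × ℂ => q.1) (𝓝 0) (𝓝 0) :=
  continuous_fst.tendsto' 0 0 rfl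

lemma tendsto_snd_zero : Tendsto (fun q : ℂ × ℂ => q.2) (𝓝 0) (𝓝 0) :=
  continuous_snd.tendsto' 0 0 rfl

lemma frequently_fst_ne_zero : ∃ᶠ q : ℂ × ℂ in 𝓝 0, q.1 ≠ 0 := by
  have h : ∃ᶠ t : ℂ in 𝓝[≠] 0, t ≠ 0 := (eventually_mem_nhdsWithin (s := {0}ᶜ)).frequently
  exact (tendsto_inl_zero.mono_left nhdsWithin_le_nhds).frequently h

lemma frequently_snd_ne_zero : ∃ᶠ q : ℂ × ℂ in 𝓝 0, q.2 ≠ 0 := by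
  have h : ∃ᶠ t : ℂ in 𝓝[≠] 0, t ≠ 0 := (eventually_mem_nhdsWithin (s := {0}ᶜ)).frequently
  exact (tendsto_inr_zero.mono_left nhdsWithin_le_nhds).frequently h

lemma frequently_fst_mul_snd_ne_zero : ∃ᶠ q : ℂ × ℂ in 𝓝 0, q.1 * q.2 ≠ 0 :=
  frequently_mul_ne_zero analyticAt_fst analyticAt_snd frequently_fst_ne_zero
    frequently_snd_ne_zero

/-- Identities between analytic germs can be checked outside the first axis. -/
lemma eventually_eq_of_fst_ne {f g : ℂ × ℂ → ℂ} (hf : AnalyticAt ℂ f 0) (hg : AnalyticAt ℂ g 0)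
    (h : ∀ᶠ q in 𝓝 0, q.1 ≠ 0 → f q = g q) : ∀ᶠ q in 𝓝 0, f q = g q :=
  eventually_eq_of_ne analyticAt_fst hf hg frequently_fst_ne_zero h

/-- Identities between analytic germs can be checked outside the axes. -/
lemma eventually_eq_of_axes_ne {f g : ℂ × ℂ → ℂ} (hf : AnalyticAt ℂ f 0) (hg : AnalyticAt ℂ g 0)
    (h : ∀ᶠ q in 𝓝 0, q.1 ≠ 0 → q.2 ≠ 0 → f q = g q) : ∀ᶠ q in 𝓝 0, f q = g q :=
  eventually_eq_of_ne (analyticAt_fst.mul analyticAt_snd) hf hg frequently_fst_mul_snd_ne_zero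
    (h.mono fun _ hq hm => hq (left_ne_zero_of_mul hm) (right_ne_zero_of_mul hm))

lemma analyticAt_swap (z : ℂ × ℂ) : AnalyticAt ℂ (Prod.swap : ℂ × ℂ → ℂ × ℂ) z :=
  analyticAt_snd.prod analyticAt_fst

lemma tendsto_swap_zero : Tendsto (Prod.swap : ℂ × ℂ → ℂ × ℂ) (𝓝 0) (𝓝 0) :=
  continuous_swap.tendsto' 0 0 rfl

lemma exists_eq_add_snd_mul {f : ℂ × ℂ → ℂ} (hf : AnalyticAt ℂ f 0) :
    ∃ g, AnalyticAt ℂ g 0 ∧ ∀ᶠ q in 𝓝 0, f q = f (q.1, 0) + q.2 * g q := by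
  have hf' : AnalyticAt ℂ f (Prod.swap (0 : ℂ × ℂ)) := hf
  obtain ⟨g, hg, h⟩ := exists_eq_add_fst_mul (hf'.comp (analyticAt_swap 0))
  have hg' : AnalyticAt ℂ g (Prod.swap (0 : ℂ × ℂ)) := hg
  refine ⟨g ∘ Prod.swap, hg'.comp (analyticAt_swap 0), ?_⟩
  filter_upwards [tendsto_swap_zero.eventually h] with q hq
  simpa using hq

/-- An analytic germ that vanishes on the axis `x = 0` is divisible by `x`. -/
lemma exists_eq_fst_mul {f : ℂ × ℂ → ℂ} (hf : AnalyticAt ℂ f 0) (h : ∀ᶠ y in 𝓝 (0 : ℂ), f (0, y) = 0) :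
    ∃ g, AnalyticAt ℂ g 0 ∧ ∀ᶠ q in 𝓝 0, f q = q.1 * g q := by
  obtain ⟨g, hg, h1⟩ := exists_eq_add_fst_mul hf
  refine ⟨g, hg, ?_⟩
  have h2 : Tendsto (fun q : ℂ × ℂ => q.2) (𝓝 0) (𝓝 0) := continuous_snd.tendsto' 0 0 rfl
  filter_upwards [h1, h2.eventually h] with q h3 h4
  rw [h3, h4, zero_add]

lemma exists_eq_snd_mul {f : ℂ × ℂ → ℂ} (hf : AnalyticAt ℂ f 0) (h : ∀ᶠ x in 𝓝 (0 : ℂ), f (x, 0) = 0) :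
    ∃ g, AnalyticAt ℂ g 0 ∧ ∀ᶠ q in 𝓝 0, f q = q.2 * g q := by
  obtain ⟨g, hg, h1⟩ := exists_eq_add_snd_mul hf
  refine ⟨g, hg, ?_⟩
  have h2 : Tendsto (fun q : ℂ × ℂ => q.1) (𝓝 0) (𝓝 0) := continuous_fst.tendsto' 0 0 rfl
  filter_upwards [h1, h2.eventually h] with q h3 h4
  rw [h3, h4, zero_add]

/-! ### Partial derivatives -/

/-- The partial derivative with respect to the first coordinate. -/
noncomputable def pd1 (f : ℂ × ℂ → ℂ) (q : ℂ × ℂ) : ℂ := fderiv ℂ f q (1, 0)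

/-- The partial derivative with respect to the second coordinate. -/
noncomputable def pd2 (f : ℂ × ℂ → ℂ) (q : ℂ × ℂ) : ℂ := fderiv ℂ f q (0, 1)

lemma AnalyticAt.pd1 {f : ℂ × ℂ → ℂ} {z : ℂ × ℂ} (hf : AnalyticAt ℂ f z) :
    AnalyticAt ℂ (pd1 f) z :=
  ((ContinuousLinearMap.apply ℂ ℂ ((1, 0) : ℂ × ℂ)).analyticAt _).comp hf.fderiv

lemma AnalyticAt.pd2 {f : ℂ × ℂ → ℂ} {z : ℂ × ℂ} (hf : AnalyticAt ℂ f z) :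
    AnalyticAt ℂ (pd2 f) z :=
  ((ContinuousLinearMap.apply ℂ ℂ ((0, 1) : ℂ × ℂ)).analyticAt _).comp hf.fderiv

lemma Filter.EventuallyEq.pd1 {f g : ℂ × ℂ → ℂ} {z : ℂ × ℂ} (h : f =ᶠ[𝓝 z] g) :
    pd1 f =ᶠ[𝓝 z] pd1 g :=
  (h.fderiv (𝕜 := ℂ)).mono fun q hq => by simp [_root_.pd1, hq]

lemma Filter.EventuallyEq.pd2 {f g : ℂ × ℂ → ℂ} {z : ℂ × ℂ} (h : f =ᶠ[𝓝 z] g) :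
    pd2 f =ᶠ[𝓝 z] pd2 g :=
  (h.fderiv (𝕜 := ℂ)).mono fun q hq => by simp [_root_.pd2, hq]

lemma fderiv_eq_pd (f : ℂ × ℂ → ℂ) (q v : ℂ × ℂ) :
    fderiv ℂ f q v = v.1 * pd1 f q + v.2 * pd2 f q := by
  have : v = v.1 • ((1, 0) : ℂ × ℂ) + v.2 • ((0, 1) : ℂ × ℂ) := by ext <;> simp
  conv_lhs => rw [this, map_add, map_smul, map_smul]
  simp [pd1, pd2]

lemma pd1_eq_deriv {f : ℂ × ℂ → ℂ} {q : ℂ × ℂ} (hf : DifferentiableAt ℂ f q) :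
    HasDerivAt (fun x => f (x, q.2)) (pd1 f q) q.1 := by
  have h1 : HasDerivAt (fun x : ℂ => (x, q.2)) ((1, 0) : ℂ × ℂ) q.1 :=
    (hasDerivAt_id q.1).prodMk (hasDerivAt_const q.1 q.2)
  exact HasFDerivAt.comp_hasDerivAt (f := fun x : ℂ => (x, q.2)) q.1 hf.hasFDerivAt h1

lemma pd2_eq_deriv {f : ℂ × ℂ → ℂ} {q : ℂ × ℂ} (hf : DifferentiableAt ℂ f q) :
    HasDerivAt (fun y => f (q.1, y)) (pd2 f q) q.2 := by
  have h1 : HasDerivAt (fun y : ℂ => (q.1, y)) ((0, 1) : ℂ × ℂ) q.2 :=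
    (hasDerivAt_const q.2 q.1).prodMk (hasDerivAt_id q.2)
  exact HasFDerivAt.comp_hasDerivAt (f := fun y : ℂ => (q.1, y)) q.2 hf.hasFDerivAt h1

section
variable {f g : ℂ × ℂ → ℂ} {q : ℂ × ℂ}

lemma pd1_mul (hf : DifferentiableAt ℂ f q) (hg : DifferentiableAt ℂ g q) :
    pd1 (fun z => f z * g z) q = pd1 f q * g q + f q * pd1 g q := by
  simp [pd1, fderiv_fun_mul hf hg]; ring

lemma pd2_mul (hf : DifferentiableAt ℂ f q) (hg : DifferentiableAt ℂ g q) :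
    pd2 (fun z => f z * g z) q = pd2 f q * g q + f q * pd2 g q := by
  simp [pd2, fderiv_fun_mul hf hg]; ring

lemma pd2_add (hf : DifferentiableAt ℂ f q) (hg : DifferentiableAt ℂ g q) :
    pd2 (fun z => f z + g z) q = pd2 f q + pd2 g q := by
  simp [pd2, fderiv_fun_add hf hg]

lemma pd2_inv (hf : DifferentiableAt ℂ f q) (h0 : f q ≠ 0) :
    pd2 (fun z => (f z)⁻¹) q = - pd2 f q / f q ^ 2 :=
  (pd2_eq_deriv (hf.inv h0)).unique ((pd2_eq_deriv hf).inv h0)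

@[simp] lemma pd2_const (c : ℂ) : pd2 (fun _ => c) q = 0 := by simp [pd2]
@[simp] lemma pd1_fst : pd1 (fun z => z.1) q = 1 := by
  simp [pd1, fderiv_fst]
@[simp] lemma pd1_snd : pd1 (fun z => z.2) q = 0 := by
  simp [pd1, fderiv_snd]
@[simp] lemma pd2_fst : pd2 (fun z => z.1) q = 0 := by
  simp [pd2, fderiv_fst]
@[simp] lemma pd2_snd : pd2 (fun z => z.2) q = 1 := by
  simp [pd2, fderiv_snd]

lemma fst_mul_pd1_fst_pow (a : ℕ) : q.1 * pd1 (fun z => z.1 ^ a) q = a * q.1 ^ a := by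
  have := pd1_eq_deriv (f := fun z => z.1 ^ a) (q := q) (by fun_prop)
  rw [this.unique (hasDerivAt_pow a q.1)]
  rcases a with _ | a
  · simp
  · simp [pow_succ]; ring

@[simp] lemma pd2_fst_pow (a : ℕ) : pd2 (fun z => z.1 ^ a) q = 0 :=
  (pd2_eq_deriv (f := fun z => z.1 ^ a) (q := q) (by fun_prop)).unique
    (hasDerivAt_const q.2 (q.1 ^ a))

lemma snd_mul_pd2_snd_pow (a : ℕ) : q.2 * pd2 (fun z => z.2 ^ a) q = a * q.2 ^ a := by
  have := pd2_eq_deriv (f := fun z => z.2 ^ a) (q := q) (by fun_prop)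
  rw [this.unique (hasDerivAt_pow a q.2)]
  rcases a with _ | a
  · simp
  · simp [pow_succ]; ring

@[simp] lemma pd1_snd_pow (a : ℕ) : pd1 (fun z => z.2 ^ a) q = 0 :=
  (pd1_eq_deriv (f := fun z => z.2 ^ a) (q := q) (by fun_prop)).unique
    (hasDerivAt_const q.1 (q.2 ^ a))

lemma fst_mul_pd1_monomial (a b : ℕ) (hf : DifferentiableAt ℂ f q) :
    q.1 * pd1 (fun z => z.1 ^ a * z.2 ^ b * f z) q
      = q.1 ^ a * q.2 ^ b * (a * f q + q.1 * pd1 f q) := by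
  rw [pd1_mul (by fun_prop) hf, pd1_mul (by fun_prop) (by fun_prop), pd1_snd_pow]
  linear_combination q.2 ^ b * f q * fst_mul_pd1_fst_pow (q := q) a

lemma snd_mul_pd2_monomial (a b : ℕ) (hf : DifferentiableAt ℂ f q) :
    q.2 * pd2 (fun z => z.1 ^ a * z.2 ^ b * f z) q
      = q.1 ^ a * q.2 ^ b * (b * f q + q.2 * pd2 f q) := by
  rw [pd2_mul (by fun_prop) hf, pd2_mul (by fun_prop) (by fun_prop), pd2_fst_pow]
  linear_combination q.1 ^ a * f q * snd_mul_pd2_snd_pow (q := q) b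

lemma fst_mul_pd1_fst_pow_mul (a : ℕ) (hf : DifferentiableAt ℂ f q) :
    q.1 * pd1 (fun z => z.1 ^ a * f z) q = q.1 ^ a * (a * f q + q.1 * pd1 f q) := by
  rw [pd1_mul (by fun_prop) hf]
  linear_combination f q * fst_mul_pd1_fst_pow (q := q) a

lemma pd2_fst_pow_mul (a : ℕ) (hf : DifferentiableAt ℂ f q) :
    pd2 (fun z => z.1 ^ a * f z) q = q.1 ^ a * pd2 f q := by
  rw [pd2_mul (by fun_prop) hf, pd2_fst_pow]; ring

end

/-! ### Dominant map germs -/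

/-- The Jacobian determinant of a map. -/
noncomputable def jac (φ : ℂ × ℂ → ℂ × ℂ) (q : ℂ × ℂ) : ℂ :=
  pd1 (fun z => (φ z).1) q * pd2 (fun z => (φ z).2) q
    - pd2 (fun z => (φ z).1) q * pd1 (fun z => (φ z).2) q

/-- A map germ is dominant if the pullback of germs of functions is injective. -/
def Dominant (φ : ℂ × ℂ → ℂ × ℂ) : Prop :=
  ∀ h : ℂ × ℂ → ℂ, AnalyticAt ℂ h 0 → (∀ᶠ q in 𝓝 0, h (φ q) = 0) → ∀ᶠ q in 𝓝 0, h q = 0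

lemma fderiv_eq_jacobian {φ : ℂ × ℂ → ℂ × ℂ} {q : ℂ × ℂ} (h : DifferentiableAt ℂ φ q) (v : ℂ × ℂ) :
    fderiv ℂ φ q v = (v.1 * pd1 (fun z => (φ z).1) q + v.2 * pd2 (fun z => (φ z).1) q,
      v.1 * pd1 (fun z => (φ z).2) q + v.2 * pd2 (fun z => (φ z).2) q) := by
  rw [← fderiv_eq_pd, ← fderiv_eq_pd]
  have h1 := h.hasFDerivAt.fst.fderiv
  have h2 := h.hasFDerivAt.snd.fderiv
  rw [h1, h2]; rfl

/-- At a point close to `0` with nonzero Jacobian, `φ` is open, so `h` vanishes on an open subset of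
a ball around the origin. -/
lemma Dominant.of_jac {φ : ℂ × ℂ → ℂ × ℂ} (hφ : IsHolMapGerm φ) (hJ : ∃ᶠ q in 𝓝 0, jac φ q ≠ 0) :
    Dominant φ := by
  intro h hh h0
  obtain ⟨r, hr, hb⟩ := Metric.eventually_nhds_iff_ball.mp hh.eventually_analyticAt
  have ht : Tendsto φ (𝓝 0) (𝓝 0) := by
    have := hφ.1.continuousAt.tendsto; rwa [hφ.2] at this
  obtain ⟨q, hq, hq1, hq2, hq3⟩ := (hJ.and_eventually (h0.eventually_nhds.and
    (hφ.1.eventually_analyticAt.and (ht.eventually (Metric.ball_mem_nhds _ hr))))).exists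
  have hsurj : (fderiv ℂ φ q).range = ⊤ := by
    rw [LinearMap.range_eq_top]
    intro w
    refine ⟨((w.1 * pd2 (fun z => (φ z).2) q - w.2 * pd2 (fun z => (φ z).1) q) / jac φ q,
      (w.2 * pd1 (fun z => (φ z).1) q - w.1 * pd1 (fun z => (φ z).2) q) / jac φ q), ?_⟩
    have := fderiv_eq_jacobian hq2.differentiableAt
    simp only [ContinuousLinearMap.coe_coe, this]
    ext
    · simp only; field_simp; simp only [jac]; ring
    · simp only; field_simp; simp only [jac]; ring
  have h1 : ∀ᶠ z in 𝓝 (φ q), h z = 0 := by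
    rw [← hq2.hasStrictFDerivAt.map_nhds_eq_of_surj hsurj]
    exact hq1
  have h2 : AnalyticOnNhd ℂ h (Metric.ball 0 r) := hb
  have h3 := h2.eqOn_zero_of_preconnected_of_eventuallyEq_zero
    (convex_ball (0 : ℂ × ℂ) r).isPreconnected hq3 h1
  filter_upwards [Metric.ball_mem_nhds (0 : ℂ × ℂ) hr] with z hz using h3 hz

lemma Dominant.comp {φ ψ : ℂ × ℂ → ℂ × ℂ} (hφ : Dominant φ) (hφ' : IsHolMapGerm φ) (hψ : Dominant ψ) :
    Dominant (φ ∘ ψ) := by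
  intro h hh h0
  refine hφ h hh (hψ (h ∘ φ) ?_ h0)
  exact AnalyticAt.comp (by rw [hφ'.2]; exact hh) hφ'.1

lemma Dominant.frequently {φ : ℂ × ℂ → ℂ × ℂ} (hφ : Dominant φ) {h : ℂ × ℂ → ℂ}
    (hh : AnalyticAt ℂ h 0) (h0 : ∃ᶠ q in 𝓝 0, h q ≠ 0) : ∃ᶠ q in 𝓝 0, h (φ q) ≠ 0 := by
  intro h1
  simp only [ne_eq, not_not] at h1
  exact h0 ((hφ h hh h1).mono fun _ h => not_not.mpr h)

lemma IsHolMapGerm.tendsto {φ : ℂ × ℂ → ℂ × ℂ} (hφ : IsHolMapGerm φ) : Tendsto φ (𝓝 0) (𝓝 0) := by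
  have := hφ.1.continuousAt.tendsto; rwa [hφ.2] at this

lemma IsHolMapGerm.comp {φ ψ : ℂ × ℂ → ℂ × ℂ} (hφ : IsHolMapGerm φ) (hψ : IsHolMapGerm ψ) :
    IsHolMapGerm (φ ∘ ψ) :=
  ⟨AnalyticAt.comp (by rw [hψ.2]; exact hφ.1) hψ.1, by simp [hφ.2, hψ.2]⟩

lemma IsHolMapGerm.comp_analyticAt {φ : ℂ × ℂ → ℂ × ℂ} {h : ℂ × ℂ → ℂ} (hφ : IsHolMapGerm φ)
    (hh : AnalyticAt ℂ h 0) : AnalyticAt ℂ (fun q => h (φ q)) 0 :=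
  AnalyticAt.comp (g := h) (f := φ) (by rw [hφ.2]; exact hh) hφ.1

lemma isHolMapGerm_id : IsHolMapGerm id := ⟨analyticAt_id, rfl⟩

lemma isHolMapGerm_swap : IsHolMapGerm Prod.swap := ⟨analyticAt_swap 0, rfl⟩

lemma isHolMapGerm_mk {f g : ℂ × ℂ → ℂ} (hf : AnalyticAt ℂ f 0) (hg : AnalyticAt ℂ g 0)
    (hf0 : f 0 = 0) (hg0 : g 0 = 0) : IsHolMapGerm fun q => (f q, g q) :=
  ⟨hf.prod hg, by simp [hf0, hg0]⟩

/-! ### Coefficients of foliations -/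

namespace FoliationGerm

/-- The coefficient `A` of the defining form `A dx + B dy`. -/
noncomputable def coeff1 (F : FoliationGerm) (q : ℂ × ℂ) : ℂ := F.ω q (1, 0)

/-- The coefficient `B` of the defining form `A dx + B dy`. -/
noncomputable def coeff2 (F : FoliationGerm) (q : ℂ × ℂ) : ℂ := F.ω q (0, 1)

lemma analyticAt_coeff1 (F : FoliationGerm) : AnalyticAt ℂ F.coeff1 0 :=
  ((ContinuousLinearMap.apply ℂ ℂ ((1, 0) : ℂ × ℂ)).analyticAt _).comp F.analytic

lemma analyticAt_coeff2 (F : FoliationGerm) : AnalyticAt ℂ F.coeff2 0 :=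
  ((ContinuousLinearMap.apply ℂ ℂ ((0, 1) : ℂ × ℂ)).analyticAt _).comp F.analytic

lemma ω_apply (F : FoliationGerm) (q v : ℂ × ℂ) :
    F.ω q v = v.1 * F.coeff1 q + v.2 * F.coeff2 q := by
  have : v = v.1 • ((1, 0) : ℂ × ℂ) + v.2 • ((0, 1) : ℂ × ℂ) := by ext <;> simp
  conv_lhs => rw [this, map_add, map_smul, map_smul]
  simp [coeff1, coeff2]

lemma ω_eq_zero_iff (F : FoliationGerm) (q : ℂ × ℂ) :
    F.ω q = 0 ↔ F.coeff1 q = 0 ∧ F.coeff2 q = 0 := by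
  constructor
  · intro h; simp [coeff1, coeff2, h]
  · rintro ⟨h1, h2⟩
    ext <;> simp [ω_apply, h1, h2]

lemma isolated_coeff (F : FoliationGerm) :
    ∀ᶠ q in 𝓝 0, q ≠ 0 → F.coeff1 q ≠ 0 ∨ F.coeff2 q ≠ 0 := by
  filter_upwards [eventually_nhdsWithin_iff.mp F.isolated] with q hq h0
  have := hq h0
  rw [ne_eq, ω_eq_zero_iff] at this
  tauto

/-- The foliation defined by `A dx + B dy`. -/
noncomputable def ofCoeff (A B : ℂ × ℂ → ℂ) (hA : AnalyticAt ℂ A 0) (hB : AnalyticAt ℂ B 0)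
    (h : ∀ᶠ q in 𝓝 0, q ≠ 0 → A q ≠ 0 ∨ B q ≠ 0) : FoliationGerm where
  ω q := A q • ContinuousLinearMap.fst ℂ ℂ ℂ + B q • ContinuousLinearMap.snd ℂ ℂ ℂ
  analytic := (hA.smul analyticAt_const).add (hB.smul analyticAt_const)
  isolated := by
    refine eventually_nhdsWithin_iff.mpr (h.mono fun q hq h0 h1 => ?_)
    have h2 := congrArg (fun l : ℂ × ℂ →L[ℂ] ℂ => l (1, 0)) h1
    have h3 := congrArg (fun l : ℂ × ℂ →L[ℂ] ℂ => l (0, 1)) h1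
    simp at h2 h3
    have := hq h0
    tauto

@[simp] lemma coeff1_ofCoeff {A B : ℂ × ℂ → ℂ} {hA : AnalyticAt ℂ A 0} {hB : AnalyticAt ℂ B 0}
    {h} (q : ℂ × ℂ) : (ofCoeff A B hA hB h).coeff1 q = A q := by
  simp [ofCoeff, coeff1]

@[simp] lemma coeff2_ofCoeff {A B : ℂ × ℂ → ℂ} {hA : AnalyticAt ℂ A 0} {hB : AnalyticAt ℂ B 0}
    {h} (q : ℂ × ℂ) : (ofCoeff A B hA hB h).coeff2 q = B q := by
  simp [ofCoeff, coeff2]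

lemma isRegular_iff (F : FoliationGerm) : F.IsRegular ↔ F.coeff1 0 ≠ 0 ∨ F.coeff2 0 ≠ 0 := by
  rw [IsRegular, ne_eq, ω_eq_zero_iff]; tauto

/-- The first coefficient of the pullback of a form by a map. -/
noncomputable def pull1 (F : FoliationGerm) (φ : ℂ × ℂ → ℂ × ℂ) (q : ℂ × ℂ) : ℂ :=
  F.coeff1 (φ q) * pd1 (fun z => (φ z).1) q + F.coeff2 (φ q) * pd1 (fun z => (φ z).2) q

/-- The second coefficient of the pullback of a form by a map. -/
noncomputable def pull2 (F : FoliationGerm) (φ : ℂ × ℂ → ℂ × ℂ) (q : ℂ × ℂ) : ℂ :=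
  F.coeff1 (φ q) * pd2 (fun z => (φ z).1) q + F.coeff2 (φ q) * pd2 (fun z => (φ z).2) q

lemma analyticAt_pull1 (F : FoliationGerm) {φ : ℂ × ℂ → ℂ × ℂ} (hφ : IsHolMapGerm φ) :
    AnalyticAt ℂ (F.pull1 φ) 0 :=
  ((hφ.comp_analyticAt F.analyticAt_coeff1).mul (analyticAt_fst.comp hφ.1).pd1).add
    ((hφ.comp_analyticAt F.analyticAt_coeff2).mul (analyticAt_snd.comp hφ.1).pd1)

lemma analyticAt_pull2 (F : FoliationGerm) {φ : ℂ × ℂ → ℂ × ℂ} (hφ : IsHolMapGerm φ) :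
    AnalyticAt ℂ (F.pull2 φ) 0 :=
  ((hφ.comp_analyticAt F.analyticAt_coeff1).mul (analyticAt_fst.comp hφ.1).pd2).add
    ((hφ.comp_analyticAt F.analyticAt_coeff2).mul (analyticAt_snd.comp hφ.1).pd2)

lemma comp_fderiv_apply (F : FoliationGerm) {φ : ℂ × ℂ → ℂ × ℂ} {q : ℂ × ℂ}
    (h : DifferentiableAt ℂ φ q) (v : ℂ × ℂ) :
    (F.ω (φ q)).comp (fderiv ℂ φ q) v = v.1 * F.pull1 φ q + v.2 * F.pull2 φ q := by
  rw [ContinuousLinearMap.comp_apply, fderiv_eq_jacobian h, ω_apply, pull1, pull2]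
  ring

lemma isPullback_of_coeff {φ : ℂ × ℂ → ℂ × ℂ} {F G : FoliationGerm} {h : ℂ × ℂ → ℂ}
    (hφ : AnalyticAt ℂ φ 0) (hh : AnalyticAt ℂ h 0) (h0 : ∃ᶠ q in 𝓝 0, h q ≠ 0)
    (h1 : ∀ᶠ q in 𝓝 0, F.pull1 φ q = h q * G.coeff1 q)
    (h2 : ∀ᶠ q in 𝓝 0, F.pull2 φ q = h q * G.coeff2 q) : IsPullback φ F G := by
  refine ⟨h, hh, h0, ?_⟩
  filter_upwards [h1, h2, hφ.eventually_analyticAt] with q e1 e2 e3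
  refine ContinuousLinearMap.ext fun v => ?_
  rw [comp_fderiv_apply F e3.differentiableAt, e1, e2, _root_.smul_apply, ω_apply]
  simp; ring

lemma IsPullback.coeff {φ : ℂ × ℂ → ℂ × ℂ} {F G : FoliationGerm}
    (hφ : AnalyticAt ℂ φ 0) (h : IsPullback φ F G) :
    ∃ h : ℂ × ℂ → ℂ, AnalyticAt ℂ h 0 ∧ (∃ᶠ q in 𝓝 0, h q ≠ 0) ∧
      (∀ᶠ q in 𝓝 0, F.pull1 φ q = h q * G.coeff1 q) ∧
      (∀ᶠ q in 𝓝 0, F.pull2 φ q = h q * G.coeff2 q) := by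
  obtain ⟨h, hh, h0, h1⟩ := h
  refine ⟨h, hh, h0, ?_, ?_⟩
  · filter_upwards [h1, hφ.eventually_analyticAt] with q e1 e2
    have := congrArg (fun l : ℂ × ℂ →L[ℂ] ℂ => l (1, 0)) e1
    simp only [comp_fderiv_apply F e2.differentiableAt] at this
    simpa [coeff1] using this
  · filter_upwards [h1, hφ.eventually_analyticAt] with q e1 e2
    have := congrArg (fun l : ℂ × ℂ →L[ℂ] ℂ => l (0, 1)) e1
    simp only [comp_fderiv_apply F e2.differentiableAt] at this
    simpa [coeff2] using this

lemma IsPullback.congr {φ ψ : ℂ × ℂ → ℂ × ℂ} {F G : FoliationGerm} (h : IsPullback φ F G)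
    (e : φ =ᶠ[𝓝 0] ψ) : IsPullback ψ F G := by
  obtain ⟨k, hk, h0, h1⟩ := h
  refine ⟨k, hk, h0, ?_⟩
  filter_upwards [h1, e, e.fderiv (𝕜 := ℂ)] with q e1 e2 e3
  rw [← e2, ← e3, e1]

lemma IsPullback.comp {P φ : ℂ × ℂ → ℂ × ℂ} {F G H : FoliationGerm} (hP : AnalyticAt ℂ P 0)
    (h1 : IsPullback P F G) (hφ : IsHolMapGerm φ) (hφd : Dominant φ) (h2 : IsPullback φ G H) :
    IsPullback (P ∘ φ) F H := by
  obtain ⟨k, hk, k0, hk1⟩ := h1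
  obtain ⟨l, hl, l0, hl1⟩ := h2
  refine ⟨fun q => k (φ q) * l q, (hφ.comp_analyticAt hk).mul hl,
    frequently_mul_ne_zero (hφ.comp_analyticAt hk) hl (hφd.frequently hk k0) l0, ?_⟩
  filter_upwards [hl1, hφ.tendsto.eventually hk1, hφ.1.eventually_analyticAt,
    hφ.tendsto.eventually hP.eventually_analyticAt] with q e1 e2 e3 e4
  rw [fderiv_comp q e4.differentiableAt e3.differentiableAt, mul_smul, ← e1,
    ← ContinuousLinearMap.comp_assoc, Function.comp_apply, e2]
  rfl

end FoliationGerm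

/-! ### Blowing-up charts -/

lemma analyticAt_blowUpChart (d : OnePoint ℂ) (z : ℂ × ℂ) : AnalyticAt ℂ (blowUpChart d) z := by
  rcases d with _ | c
  · exact (analyticAt_fst.mul analyticAt_snd).prod analyticAt_snd
  · exact analyticAt_fst.prod (analyticAt_fst.mul (analyticAt_snd.add analyticAt_const))

lemma isHolMapGerm_blowUpChart (d : OnePoint ℂ) : IsHolMapGerm (blowUpChart d) := by
  refine ⟨analyticAt_blowUpChart d 0, ?_⟩
  rcases d with _ | c <;> simp [blowUpChart]

lemma blowUpChart_some (c : ℂ) (q : ℂ × ℂ) :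
    blowUpChart (OnePoint.some c) q = (q.1, q.1 * (q.2 + c)) := rfl

lemma blowUpChart_infty (q : ℂ × ℂ) : blowUpChart OnePoint.infty q = (q.1 * q.2, q.2) := rfl

lemma dominant_blowUpChart (d : OnePoint ℂ) : Dominant (blowUpChart d) := by
  refine Dominant.of_jac (isHolMapGerm_blowUpChart d) ?_
  rcases d with _ | c
  · refine frequently_snd_ne_zero.mono fun q hq => ?_
    have h1 : pd1 (fun z : ℂ × ℂ => z.1 * z.2) q = q.2 := by
      rw [pd1_mul (by fun_prop) (by fun_prop)]; simp
    simpa [jac, blowUpChart, h1] using hq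
  · refine frequently_fst_ne_zero.mono fun q hq => ?_
    have h1 : pd2 (fun z : ℂ × ℂ => z.1 * (z.2 + c)) q = q.1 := by
      rw [pd2_mul (by fun_prop) (by fun_prop), pd2_add (by fun_prop) (by fun_prop)]; simp
    simpa [jac, blowUpChart, h1] using hq

namespace InfNearPoint

/-- The infinitely near point over the direction `d` of the blowing-up of the origin that
corresponds to the point `p` infinitely near to that direction. -/
def prepend (d : OnePoint ℂ) : InfNearPoint → InfNearPoint
  | .origin => .above .origin d
  | .above p e => .above (p.prepend d) e

lemma proj_prepend (d : OnePoint ℂ) (p : InfNearPoint) :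
    (p.prepend d).proj = blowUpChart d ∘ p.proj := by
  induction p with
  | origin => rfl
  | above p e ih => simp only [prepend, proj, ih]; rfl

lemma eq_origin_or_prepend (p : InfNearPoint) : p = origin ∨ ∃ d q, p = prepend d q := by
  induction p with
  | origin => exact Or.inl rfl
  | above p e ih =>
    right
    rcases ih with rfl | ⟨d, q, rfl⟩
    · exact ⟨e, origin, rfl⟩
    · exact ⟨d, above q e, rfl⟩

lemma prepend_inj {d : OnePoint ℂ} {p q : InfNearPoint} (h : p.prepend d = q.prepend d) : p = q := by
  induction p generalizing q with
  | origin =>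
    cases q with
    | origin => rfl
    | above q e => simp only [prepend, above.injEq] at h; cases q <;> simp [prepend] at h
  | above p e ih =>
    cases q with
    | origin => simp only [prepend, above.injEq] at h; cases p <;> simp [prepend] at h
    | above q f =>
      simp only [prepend, above.injEq] at h
      rw [ih h.1, h.2]

lemma isHolMapGerm_proj (p : InfNearPoint) : IsHolMapGerm p.proj := by
  induction p with
  | origin => exact isHolMapGerm_id
  | above p e ih => exact ih.comp (isHolMapGerm_blowUpChart e)

lemma dominant_proj (p : InfNearPoint) : Dominant p.proj := by
  induction p with
  | origin => exact fun h _ h0 => h0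
  | above p e ih => exact ih.comp p.isHolMapGerm_proj (dominant_blowUpChart e)

/-- All the directions that lead to the point are finite. -/
def FiniteDirections : InfNearPoint → Prop
  | .origin => True
  | .above p d => p.FiniteDirections ∧ ∃ c : ℂ, d = OnePoint.some c

lemma FiniteDirections.prepend {c : ℂ} {p : InfNearPoint} (h : p.FiniteDirections) :
    (p.prepend (OnePoint.some c)).FiniteDirections := by
  induction p with
  | origin => exact ⟨trivial, c, rfl⟩
  | above p e ih => exact ⟨ih h.1, h.2⟩

lemma FiniteDirections.proj_fst {p : InfNearPoint} (h : p.FiniteDirections) (q : ℂ × ℂ) :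
    (p.proj q).1 = q.1 := by
  induction p generalizing q with
  | origin => rfl
  | above p e ih =>
    obtain ⟨h1, c, rfl⟩ := h
    exact ih h1 _

/-- Finite directions preserve the first coordinate, so the projection cannot contract the axis `v =
0`. -/
lemma FiniteDirections.not_isCorner {p : InfNearPoint} (h : p.FiniteDirections) : ¬ p.IsCorner := by
  intro hc
  have := congrArg Prod.fst (hc.2 1)
  rw [h.proj_fst] at this
  simp at this

end InfNearPoint

/-! ### Sets of centres -/

open InfNearPoint in
/-- The points over the origin after blowing up the points of `S`. -/
def ptsS (S : Set InfNearPoint) : Set InfNearPoint :=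
  {p | p ∉ S ∧ match p with
    | origin => True
    | above q _ => q ∈ S}

/-- The part of a set of centres that lies over the direction `d`. -/
def sub (S : Set InfNearPoint) (d : OnePoint ℂ) : Set InfNearPoint := {p | p.prepend d ∈ S}

/-- A set of centres contains the points over which its elements lie. -/
def TreeClosed (S : Set InfNearPoint) : Prop := ∀ p d, InfNearPoint.above p d ∈ S → p ∈ S

lemma TreeClosed.sub {S : Set InfNearPoint} (h : TreeClosed S) (d : OnePoint ℂ) :
    TreeClosed (sub S d) := fun p e hp => h (p.prepend d) e hp

lemma TreeClosed.eq_empty {S : Set InfNearPoint} (h : TreeClosed S) (h0 : .origin ∉ S) : S = ∅ := by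
  ext p
  simp only [Set.mem_empty_iff_false, iff_false]
  induction p with
  | origin => exact h0
  | above p e ih => exact fun hp => ih (h p e hp)

lemma prepend_mem_ptsS {S : Set InfNearPoint} (h0 : .origin ∈ S) {d : OnePoint ℂ} {p : InfNearPoint} :
    p.prepend d ∈ ptsS S ↔ p ∈ ptsS (sub S d) := by
  cases p with
  | origin => simp [InfNearPoint.prepend, ptsS, sub, h0]
  | above p e => simp [InfNearPoint.prepend, ptsS, sub]

lemma finite_sub {S : Set InfNearPoint} (h : S.Finite) (d : OnePoint ℂ) : (sub S d).Finite :=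
  Set.Finite.preimage (fun _ _ _ _ h => InfNearPoint.prepend_inj h) h

/-- A nonempty tree-closed set contains its root, so each such direction contributes an element of
`S` of the form `above origin d`. -/
lemma finite_directions {S : Set InfNearPoint} (h : S.Finite) (hS : TreeClosed S) :
    {d : OnePoint ℂ | (sub S d).Nonempty}.Finite := by
  refine (h.preimage (f := InfNearPoint.above .origin) ?_).subset ?_
  · intro a _ b _ hab
    simpa using hab
  · intro d hd
    by_contra h0
    have h1 : (sub S d).Nonempty := hd
    rw [(hS.sub d).eq_empty h0] at h1
    exact Set.not_nonempty_empty h1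

/-! ### Lifting map germs -/

/-- The map germ `φ` lifts to the surface obtained by blowing up the points of `S`. -/
def LiftsS (φ : ℂ × ℂ → ℂ × ℂ) (S : Set InfNearPoint) : Prop :=
  ∃ p ∈ ptsS S, ∃ g : ℂ × ℂ → ℂ × ℂ, IsHolMapGerm g ∧ φ =ᶠ[𝓝 0] p.proj ∘ g

lemma LiftsS.comp {φ ψ : ℂ × ℂ → ℂ × ℂ} {S : Set InfNearPoint} (h : LiftsS φ S)
    (hψ : IsHolMapGerm ψ) : LiftsS (φ ∘ ψ) S := by
  obtain ⟨p, hp, g, hg, e⟩ := h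
  exact ⟨p, hp, g ∘ ψ, hg.comp hψ, hψ.tendsto.eventually e⟩

lemma LiftsS.congr {φ ψ : ℂ × ℂ → ℂ × ℂ} {S : Set InfNearPoint} (h : LiftsS φ S)
    (e : φ =ᶠ[𝓝 0] ψ) : LiftsS ψ S := by
  obtain ⟨p, hp, g, hg, e'⟩ := h
  exact ⟨p, hp, g, hg, e.symm.trans e'⟩

lemma liftsS_of_origin_notMem {φ : ℂ × ℂ → ℂ × ℂ} {S : Set InfNearPoint} (h : .origin ∉ S)
    (hφ : IsHolMapGerm φ) : LiftsS φ S :=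
  ⟨.origin, ⟨h, trivial⟩, φ, hφ, EventuallyEq.rfl⟩

lemma LiftsS.of_chart {φ ψ : ℂ × ℂ → ℂ × ℂ} {S : Set InfNearPoint} {d : OnePoint ℂ}
    (h0 : .origin ∈ S) (h : LiftsS ψ (sub S d)) (e : φ =ᶠ[𝓝 0] blowUpChart d ∘ ψ) : LiftsS φ S := by
  obtain ⟨p, hp, g, hg, e'⟩ := h
  refine ⟨p.prepend d, (prepend_mem_ptsS h0).mpr hp, g, hg, e.trans ?_⟩
  filter_upwards [e'] with q hq
  simp [InfNearPoint.proj_prepend, hq]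

lemma LiftsS.exists_chart {φ : ℂ × ℂ → ℂ × ℂ} {S : Set InfNearPoint} (h0 : .origin ∈ S)
    (h : LiftsS φ S) : ∃ d ψ, IsHolMapGerm ψ ∧ φ =ᶠ[𝓝 0] blowUpChart d ∘ ψ ∧ LiftsS ψ (sub S d) := by
  obtain ⟨p, hp, g, hg, e⟩ := h
  rcases p.eq_origin_or_prepend with rfl | ⟨d, q, rfl⟩
  · exact absurd h0 hp.1
  · refine ⟨d, q.proj ∘ g, q.isHolMapGerm_proj.comp hg, ?_, q,
      (prepend_mem_ptsS h0).mp hp, g, hg, EventuallyEq.rfl⟩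
    rwa [InfNearPoint.proj_prepend] at e

/-- The lift of a dominant map germ to the blowing-up of the origin is unique. -/
lemma chart_unique {φ ψ χ : ℂ × ℂ → ℂ × ℂ} {d e : OnePoint ℂ} (hφ : Dominant φ)
    (hψ : IsHolMapGerm ψ) (hχ : IsHolMapGerm χ) (h1 : φ =ᶠ[𝓝 0] blowUpChart d ∘ ψ)
    (h2 : φ =ᶠ[𝓝 0] blowUpChart e ∘ χ) : d = e ∧ ψ =ᶠ[𝓝 0] χ := by
  have hfst : ∃ᶠ q in 𝓝 0, (φ q).1 ≠ 0 := hφ.frequently analyticAt_fst frequently_fst_ne_zero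
  have hsnd : ∃ᶠ q in 𝓝 0, (φ q).2 ≠ 0 := hφ.frequently analyticAt_snd frequently_snd_ne_zero
  have a1 := analyticAt_fst.comp hψ.1
  have a2 := analyticAt_snd.comp hψ.1
  have b1 := analyticAt_fst.comp hχ.1
  have b2 := analyticAt_snd.comp hχ.1
  have hφa : AnalyticAt ℂ φ 0 :=
    ((isHolMapGerm_blowUpChart d).comp hψ).1.congr h1.symm
  -- A lift in the chart at infinity makes `x / y` holomorphic with value `0`, a lift in a finite
  -- chart makes `y / x` holomorphic; their product would be `1`.
  have mixed : ∀ (c : ℂ) (ψ χ : ℂ × ℂ → ℂ × ℂ), IsHolMapGerm ψ → IsHolMapGerm χ →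
      φ =ᶠ[𝓝 0] blowUpChart none ∘ ψ → φ =ᶠ[𝓝 0] blowUpChart (some c) ∘ χ → False := by
    intro c ψ χ hψ hχ h1 h2
    have := eventually_eq_of_ne (f := fun q => (ψ q).1 * ((χ q).2 + c)) (g := fun _ => 1)
      (analyticAt_snd.comp hφa)
      ((analyticAt_fst.comp hψ.1).mul ((analyticAt_snd.comp hχ.1).add analyticAt_const))
      analyticAt_const hsnd (by
        filter_upwards [h1, h2] with q e1 e2 h0
        simp only [Function.comp, blowUpChart] at e1 e2
        have e3 : (φ q).1 = (ψ q).1 * (φ q).2 := by rw [e1]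
        have e4 : (φ q).2 = (φ q).1 * ((χ q).2 + c) := by rw [e2]
        simp only [Function.comp] at h0
        rw [e3] at e4
        apply mul_left_cancel₀ h0
        linear_combination -e4)
    have := this.self_of_nhds
    simp [hψ.2] at this
  rcases d with _ | c <;> rcases e with _ | c'
  · refine ⟨rfl, ?_⟩
    have := eventually_eq_of_ne (analyticAt_snd.comp hφa) a1 b1 hsnd (by
      filter_upwards [h1, h2] with q e1 e2 h0
      rw [e1] at e2
      simp only [Function.comp, e1, blowUpChart, Prod.mk.injEq] at h0 e2 ⊢
      exact mul_right_cancel₀ h0 (by rw [e2.1, e2.2]))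
    filter_upwards [this, h1, h2] with q e0 e1 e2
    rw [e1] at e2
    simp only [Function.comp, blowUpChart, Prod.mk.injEq] at e0 e2
    exact Prod.ext e0 e2.2
  · exact (mixed c' ψ χ hψ hχ h1 h2).elim
  · exact (mixed c χ ψ hχ hψ h2 h1).elim
  · have := eventually_eq_of_ne (f := fun q => (ψ q).2 + c) (g := fun q => (χ q).2 + c')
      (analyticAt_fst.comp hφa) (a2.add analyticAt_const) (b2.add analyticAt_const) hfst (by
      filter_upwards [h1, h2] with q e1 e2 h0
      rw [e1] at e2
      simp only [Function.comp, e1, blowUpChart, Prod.mk.injEq] at h0 e2 ⊢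
      exact mul_left_cancel₀ h0 (by rw [e2.2, e2.1]))
    have hc : c = c' := by
      have := this.self_of_nhds
      simpa [hψ.2, hχ.2] using this
    subst hc
    refine ⟨rfl, ?_⟩
    filter_upwards [this, h1, h2] with q e0 e1 e2
    rw [e1] at e2
    simp only [Function.comp, blowUpChart, Prod.mk.injEq, add_left_inj] at e0 e2
    exact Prod.ext e2.1 e0

lemma liftsS_chart_iff {φ ψ : ℂ × ℂ → ℂ × ℂ} {S : Set InfNearPoint} {d : OnePoint ℂ}
    (h0 : .origin ∈ S) (hφ : Dominant φ) (hψ : IsHolMapGerm ψ) (e : φ =ᶠ[𝓝 0] blowUpChart d ∘ ψ) :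
    LiftsS φ S ↔ LiftsS ψ (sub S d) := by
  refine ⟨fun h => ?_, fun h => h.of_chart h0 e⟩
  obtain ⟨d', χ, hχ, e', h'⟩ := h.exists_chart h0
  obtain ⟨rfl, h2⟩ := chart_unique hφ hψ hχ e e'
  exact h'.congr h2.symm

/-- The infinitely near points at which the map germ `φ` does not lift. -/
def NonLift (φ : ℂ × ℂ → ℂ × ℂ) (S : Set InfNearPoint) : Set InfNearPoint :=
  {p | ¬ LiftsS (φ ∘ p.proj) S}

/-- A lift at `p` can be composed with any further blowing-up. -/
lemma treeClosed_nonLift (φ : ℂ × ℂ → ℂ × ℂ) (S : Set InfNearPoint) : TreeClosed (NonLift φ S) :=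
  fun _ d hp h => hp (h.comp (isHolMapGerm_blowUpChart d))

lemma sub_nonLift (φ : ℂ × ℂ → ℂ × ℂ) (S : Set InfNearPoint) (d : OnePoint ℂ) :
    sub (NonLift φ S) d = NonLift (φ ∘ blowUpChart d) S := by
  ext p
  simp only [sub, NonLift, Set.mem_ofPred_eq, InfNearPoint.proj_prepend]
  rfl

lemma nonLift_eq_empty {φ : ℂ × ℂ → ℂ × ℂ} {S : Set InfNearPoint} (h : LiftsS φ S) :
    NonLift φ S = ∅ := (treeClosed_nonLift φ S).eq_empty fun h' => h' h

/-- Lifts of dominant germs are unique, so whether `φ` lifts further can be tested in the one chart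
through which it factors. -/
lemma nonLift_chart {φ ψ : ℂ × ℂ → ℂ × ℂ} {S : Set InfNearPoint} {d : OnePoint ℂ}
    (h0 : .origin ∈ S) (hφ' : IsHolMapGerm φ) (hφ : Dominant φ) (hψ : IsHolMapGerm ψ)
    (e : φ =ᶠ[𝓝 0] blowUpChart d ∘ ψ) : NonLift φ S = NonLift ψ (sub S d) := by
  ext p
  refine not_congr (liftsS_chart_iff h0 (hφ.comp hφ' p.dominant_proj)
    (hψ.comp p.isHolMapGerm_proj) ?_)
  exact p.isHolMapGerm_proj.tendsto.eventually e

/-! ### Ramifications that desingularize -/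

/-- The pullback of `F` by `ψ` is regular or has a simple singularity. -/
def SimpleAfter (F : FoliationGerm) (ψ : ℂ × ℂ → ℂ × ℂ) : Prop :=
  ∃ G : FoliationGerm, FoliationGerm.IsPullback ψ F G ∧ (G.IsRegular ∨ G.IsSimpleSingularity)

lemma SimpleAfter.congr {F : FoliationGerm} {φ ψ : ℂ × ℂ → ℂ × ℂ} (h : SimpleAfter F φ)
    (e : φ =ᶠ[𝓝 0] ψ) : SimpleAfter F ψ := by
  obtain ⟨G, h1, h2⟩ := h
  exact ⟨G, h1.congr e, h2⟩

/-- The map germ `φ` lifts to the blowing-up of `S` after finitely many blowing-ups of points in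
finite directions, and then the pullback of `F` by `P ∘ φ` has only simple singularities. -/
structure Good (F : FoliationGerm) (P φ : ℂ × ℂ → ℂ × ℂ) (S : Set InfNearPoint) : Prop where
  finite : (NonLift φ S).Finite
  finiteDirections : ∀ p ∈ NonLift φ S, p.FiniteDirections
  simple : ∀ p ∈ ptsS (NonLift φ S), SimpleAfter F (P ∘ φ ∘ p.proj)

lemma Good.of_lifts {F : FoliationGerm} {P φ : ℂ × ℂ → ℂ × ℂ} {S : Set InfNearPoint}
    (h : LiftsS φ S) (h1 : SimpleAfter F (P ∘ φ)) : Good F P φ S := by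
  have := nonLift_eq_empty h
  refine ⟨by simp [this], by simp [this], fun p hp => ?_⟩
  rw [this] at hp
  cases p with
  | origin => exact h1
  | above p d => simp [ptsS] at hp

/-- This is the move that climbs one level in the target and leaves the source alone. -/
lemma Good.of_chart {F : FoliationGerm} {P φ ψ : ℂ × ℂ → ℂ × ℂ} {S : Set InfNearPoint}
    {d : OnePoint ℂ} (h0 : .origin ∈ S) (hφ' : IsHolMapGerm φ) (hφ : Dominant φ)
    (hψ : IsHolMapGerm ψ) (e : φ =ᶠ[𝓝 0] blowUpChart d ∘ ψ)
    (h : Good F (P ∘ blowUpChart d) ψ (sub S d)) : Good F P φ S := by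
  have := nonLift_chart h0 hφ' hφ hψ e
  refine ⟨this ▸ h.finite, this ▸ h.finiteDirections, fun p hp => ?_⟩
  rw [this] at hp
  refine (h.simple p hp).congr ?_
  filter_upwards [p.isHolMapGerm_proj.tendsto.eventually e] with q hq
  simp [hq]

/-- This is the complementary move: one blowing-up of the source, with the target unchanged. The
condition at infinity keeps every centre in finite directions. -/
lemma Good.of_blowUp {F : FoliationGerm} {P φ : ℂ × ℂ → ℂ × ℂ} {S : Set InfNearPoint}
    (h0 : ¬ LiftsS φ S) (h : ∀ d, Good F P (φ ∘ blowUpChart d) S)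
    (hfin : {c : ℂ | (NonLift (φ ∘ blowUpChart (OnePoint.some c)) S).Nonempty}.Finite)
    (hinf : NonLift (φ ∘ blowUpChart OnePoint.infty) S = ∅) : Good F P φ S := by
  have horig : .origin ∈ NonLift φ S := h0
  have hcases : ∀ p ∈ NonLift φ S, p = .origin ∨
      ∃ c : ℂ, ∃ q ∈ NonLift (φ ∘ blowUpChart (OnePoint.some c)) S,
        p = q.prepend (OnePoint.some c) := by
    intro p hp
    rcases p.eq_origin_or_prepend with rfl | ⟨d, q, rfl⟩
    · exact Or.inl rfl
    · have hq : q ∈ NonLift (φ ∘ blowUpChart d) S := by rw [← sub_nonLift]; exact hp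
      rcases d with _ | c
      · have : q ∈ NonLift (φ ∘ blowUpChart OnePoint.infty) S := hq
        simp [hinf] at this
      · exact Or.inr ⟨c, q, hq, rfl⟩
  refine ⟨?_, ?_, ?_⟩
  · refine ((Set.finite_singleton InfNearPoint.origin).union (hfin.biUnion fun c _ =>
      ((h (OnePoint.some c)).finite.image (InfNearPoint.prepend (OnePoint.some c))))).subset ?_
    intro p hp
    rcases hcases p hp with rfl | ⟨c, q, hq, rfl⟩
    · exact Or.inl rfl
    · exact Or.inr (Set.mem_biUnion (x := c) ⟨q, hq⟩ ⟨q, hq, rfl⟩)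
  · intro p hp
    rcases hcases p hp with rfl | ⟨c, q, hq, rfl⟩
    · trivial
    · exact ((h _).finiteDirections q hq).prepend
  · intro p hp
    rcases p.eq_origin_or_prepend with rfl | ⟨d, q, rfl⟩
    · exact absurd horig hp.1
    · rw [prepend_mem_ptsS horig, sub_nonLift] at hp
      have := (h d).simple q hp
      rwa [InfNearPoint.proj_prepend]

namespace FoliationGerm

lemma charpoly_dualField (F : FoliationGerm) :
    LinearMap.charpoly (fderiv ℂ F.dualField 0 : ℂ × ℂ →ₗ[ℂ] ℂ × ℂ)
      = Polynomial.X ^ 2 - Polynomial.C (pd1 F.coeff2 0 - pd2 F.coeff1 0) * Polynomial.X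
        + Polynomial.C (pd1 F.coeff1 0 * pd2 F.coeff2 0 - pd1 F.coeff2 0 * pd2 F.coeff1 0) := by
  have h1 := F.analyticAt_coeff1
  have h2 := F.analyticAt_coeff2
  have hd : F.dualField = fun q => (F.coeff2 q, - F.coeff1 q) := rfl
  have hdiff : DifferentiableAt ℂ F.dualField 0 := by
    rw [hd]; exact (h2.differentiableAt).prodMk h1.differentiableAt.neg
  have hn1 : pd1 (fun z => -F.coeff1 z) 0 = - pd1 F.coeff1 0 := by simp [pd1, fderiv_fun_neg]
  have hn2 : pd2 (fun z => -F.coeff1 z) 0 = - pd2 F.coeff1 0 := by simp [pd2, fderiv_fun_neg]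
  have hm : LinearMap.toMatrix (Module.Basis.finTwoProd ℂ) (Module.Basis.finTwoProd ℂ)
      (fderiv ℂ F.dualField 0 : ℂ × ℂ →ₗ[ℂ] ℂ × ℂ)
      = !![pd1 F.coeff2 0, pd2 F.coeff2 0; - pd1 F.coeff1 0, - pd2 F.coeff1 0] := by
    have := fderiv_eq_jacobian hdiff
    ext i j
    fin_cases i <;> fin_cases j <;> simp [LinearMap.toMatrix_apply, this] <;> simp [hd, hn1, hn2]
  rw [← LinearMap.charpoly_toMatrix _ (Module.Basis.finTwoProd ℂ), hm, Matrix.charpoly_fin_two]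
  simp [Matrix.trace_fin_two, Matrix.det_fin_two]
  ring

/-- A criterion for simple singularities: `l` and `m` below are the eigenvalues of the linear
part of the dual vector field. -/
lemma isSimpleSingularity_iff (F : FoliationGerm) (h : pd1 F.coeff1 0 * pd2 F.coeff2 0 = 0) :
    F.IsSimpleSingularity ↔ F.coeff1 0 = 0 ∧ F.coeff2 0 = 0 ∧
      ∀ p q : ℕ, 0 < p → 0 < q → p * pd1 F.coeff2 0 + q * pd2 F.coeff1 0 ≠ 0 := by
  -- Under `h` the product of the off-diagonal entries vanishes, so the eigenvalues are the diagonal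
  -- entries.
  have hroots : (LinearMap.charpoly
      (fderiv ℂ F.dualField 0 : ℂ × ℂ →ₗ[ℂ] ℂ × ℂ)).roots
      = {pd1 F.coeff2 0, - pd2 F.coeff1 0} := by
    have : LinearMap.charpoly (fderiv ℂ F.dualField 0 : ℂ × ℂ →ₗ[ℂ] ℂ × ℂ)
        = (Polynomial.X - Polynomial.C (pd1 F.coeff2 0))
          * (Polynomial.X - Polynomial.C (- pd2 F.coeff1 0)) := by
      rw [charpoly_dualField, h]
      simp only [map_sub, map_neg, zero_sub, map_mul]
      ring
    rw [this, Polynomial.roots_mul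
      (mul_ne_zero (Polynomial.X_sub_C_ne_zero _) (Polynomial.X_sub_C_ne_zero _)),
      Polynomial.roots_X_sub_C, Polynomial.roots_X_sub_C]
    rfl
  rw [IsSimpleSingularity, ω_eq_zero_iff, hroots, and_assoc]
  refine and_congr_right fun _ => and_congr_right fun _ => ?_
  generalize pd1 F.coeff2 0 = x
  generalize pd2 F.coeff1 0 = y
  constructor
  · rintro ⟨l, m, e, hm, hr⟩ p q hp hq h0
    have e1 := congrArg Multiset.sum e
    have e2 := congrArg Multiset.prod e
    simp at e1 e2
    have hp' : (p : ℂ) ≠ 0 := by exact_mod_cast hp.ne'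
    have hq' : (q : ℂ) ≠ 0 := by exact_mod_cast hq.ne'
    have e3 : (l - x) * (l + y) = 0 := by linear_combination -l * e1 + e2
    rcases mul_eq_zero.mp e3 with e4 | e4
    · refine hr (q / p : ℚ) (by positivity) ?_
      push_cast
      rw [div_eq_div_iff hm hp']
      linear_combination p * e4 + q * e4 + h0 + q * e1
    · refine hr (p / q : ℚ) (by positivity) ?_
      push_cast
      rw [div_eq_div_iff hm hq']
      linear_combination q * e4 - h0 + p * e1 + p * e4
  · intro h0
    -- The second eigenvalue must be nonzero. If `-y = 0` the two are listed in the other order; `p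
    -- = q = 1` shows that they do not both vanish.
    by_cases hy : y = 0
    · subst hy
      have hx : x ≠ 0 := by
        rintro rfl
        simpa using h0 1 1 one_pos one_pos
      refine ⟨0, x, by rw [neg_zero]; exact Multiset.pair_comm _ _, hx, fun r hr => ?_⟩
      rw [zero_div]
      exact_mod_cast hr.ne
    · refine ⟨x, -y, rfl, neg_ne_zero.mpr hy, fun r hr e => ?_⟩
      have hn : 0 < r.num := Rat.num_pos.mpr hr
      obtain ⟨n, hn'⟩ := Int.eq_ofNat_of_zero_le hn.le
      refine h0 r.den n r.den_pos (by omega) ?_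
      have hd : (r.den : ℂ) ≠ 0 := by exact_mod_cast r.den_ne_zero
      have : (r : ℂ) = n / r.den := by
        rw [Rat.cast_def, hn']; simp
      rw [this, div_eq_div_iff (neg_ne_zero.mpr hy) hd] at e
      linear_combination e

/-- The foliation obtained by interchanging the coordinates. -/
noncomputable def swap (F : FoliationGerm) : FoliationGerm :=
  ofCoeff (fun q => F.coeff2 q.swap) (fun q => F.coeff1 q.swap)
    (isHolMapGerm_swap.comp_analyticAt F.analyticAt_coeff2)
    (isHolMapGerm_swap.comp_analyticAt F.analyticAt_coeff1) (by
      filter_upwards [tendsto_swap_zero.eventually F.isolated_coeff] with q h h0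
      exact (h fun e => h0 (congrArg Prod.swap e)).symm)

lemma coeff1_swap (F : FoliationGerm) : F.swap.coeff1 = fun q => F.coeff2 q.swap := by
  ext q; exact coeff1_ofCoeff q

lemma coeff2_swap (F : FoliationGerm) : F.swap.coeff2 = fun q => F.coeff1 q.swap := by
  ext q; exact coeff2_ofCoeff q

lemma isPullback_swap (F : FoliationGerm) : IsPullback Prod.swap F F.swap := by
  refine isPullback_of_coeff (h := fun _ => 1) (analyticAt_swap 0) analyticAt_const (by simp) ?_ ?_
  · refine Eventually.of_forall fun q => ?_
    simp [pull1, coeff1_swap]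
  · refine Eventually.of_forall fun q => ?_
    simp [pull2, coeff2_swap]

end FoliationGerm

lemma pd1_swap {f : ℂ × ℂ → ℂ} {q : ℂ × ℂ} (hf : DifferentiableAt ℂ f q.swap) :
    pd1 (fun z => f z.swap) q = pd2 f q.swap :=
  (pd1_eq_deriv (f := fun z => f z.swap) (DifferentiableAt.comp q hf
    (analyticAt_swap q).differentiableAt)).unique (pd2_eq_deriv hf)

lemma pd2_swap {f : ℂ × ℂ → ℂ} {q : ℂ × ℂ} (hf : DifferentiableAt ℂ f q.swap) :
    pd2 (fun z => f z.swap) q = pd1 f q.swap :=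
  (pd2_eq_deriv (f := fun z => f z.swap) (DifferentiableAt.comp q hf
    (analyticAt_swap q).differentiableAt)).unique (pd1_eq_deriv hf)

/-! ### Foliations adapted to the axes -/

/-- The foliation is regular, and each of the marked axes is invariant or transversal, or it has a
simple singularity, and the marked axes are invariant. -/
def Adapted (e1 e2 : Prop) (G : FoliationGerm) : Prop :=
  (G.IsRegular ∧ (e1 → G.InvariantFst ∨ G.TransversalFst) ∧
    (e2 → G.InvariantSnd ∨ G.TransversalSnd)) ∨
  (G.IsSimpleSingularity ∧ (e1 → G.InvariantFst) ∧ (e2 → G.InvariantSnd))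

lemma FoliationGerm.InvariantFst.exists_eq {G : FoliationGerm} (h : G.InvariantFst) :
    ∃ B, AnalyticAt ℂ B 0 ∧ ∀ᶠ q in 𝓝 0, G.coeff2 q = q.1 * B q :=
  exists_eq_fst_mul G.analyticAt_coeff2 h

lemma FoliationGerm.InvariantSnd.exists_eq {G : FoliationGerm} (h : G.InvariantSnd) :
    ∃ A, AnalyticAt ℂ A 0 ∧ ∀ᶠ q in 𝓝 0, G.coeff1 q = q.2 * A q :=
  exists_eq_snd_mul G.analyticAt_coeff1 h

lemma pd1_fst_mul_zero {f g : ℂ × ℂ → ℂ} (hg : AnalyticAt ℂ g 0)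
    (h : ∀ᶠ q in 𝓝 0, f q = q.1 * g q) : pd1 f 0 = g 0 := by
  have := (Filter.EventuallyEq.pd1 (show f =ᶠ[𝓝 0] _ from h)).self_of_nhds
  rw [this, pd1_mul (by fun_prop) hg.differentiableAt]
  simp

lemma pd2_fst_mul_zero {f g : ℂ × ℂ → ℂ} (hg : AnalyticAt ℂ g 0)
    (h : ∀ᶠ q in 𝓝 0, f q = q.1 * g q) : pd2 f 0 = 0 := by
  have := (Filter.EventuallyEq.pd2 (show f =ᶠ[𝓝 0] _ from h)).self_of_nhds
  rw [this, pd2_mul (by fun_prop) hg.differentiableAt]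
  simp

lemma pd1_snd_mul_zero {f g : ℂ × ℂ → ℂ} (hg : AnalyticAt ℂ g 0)
    (h : ∀ᶠ q in 𝓝 0, f q = q.2 * g q) : pd1 f 0 = 0 := by
  have := (Filter.EventuallyEq.pd1 (show f =ᶠ[𝓝 0] _ from h)).self_of_nhds
  rw [this, pd1_mul (by fun_prop) hg.differentiableAt]
  simp

lemma pd2_snd_mul_zero {f g : ℂ × ℂ → ℂ} (hg : AnalyticAt ℂ g 0)
    (h : ∀ᶠ q in 𝓝 0, f q = q.2 * g q) : pd2 f 0 = g 0 := by
  have := (Filter.EventuallyEq.pd2 (show f =ᶠ[𝓝 0] _ from h)).self_of_nhds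
  rw [this, pd2_mul (by fun_prop) hg.differentiableAt]
  simp

/-- A marked axis is invariant in the singular case. This makes the linear part triangular, so that
the eigenvalue criterion applies before and after the exchange. -/
lemma Adapted.swap {e1 e2 : Prop} {G : FoliationGerm} (h : Adapted e1 e2 G) (he : e1 ∨ e2) :
    Adapted e2 e1 G.swap := by
  have hi1 : G.InvariantFst → G.swap.InvariantSnd := fun h => by
    refine Eventually.mono h fun v hv => ?_
    show G.swap.coeff1 (v, 0) = 0
    rw [G.coeff1_swap]; exact hv
  have hi2 : G.InvariantSnd → G.swap.InvariantFst := fun h => by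
    refine Eventually.mono h fun v hv => ?_
    show G.swap.coeff2 (0, v) = 0
    rw [G.coeff2_swap]; exact hv
  rcases h with ⟨h1, h2, h3⟩ | ⟨h1, h2, h3⟩
  · refine Or.inl ⟨?_, fun e => (h3 e).imp hi2 fun h => ?_, fun e => (h2 e).imp hi1 fun h => ?_⟩
    · rw [FoliationGerm.isRegular_iff] at h1 ⊢
      rw [G.coeff1_swap, G.coeff2_swap]; exact h1.symm
    · show G.swap.coeff2 0 ≠ 0
      rw [G.coeff2_swap]; exact h
    · show G.swap.coeff1 0 ≠ 0
      rw [G.coeff1_swap]; exact h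
  · refine Or.inr ⟨?_, fun e => hi2 (h3 e), fun e => hi1 (h2 e)⟩
    have h0 : pd1 G.coeff1 0 * pd2 G.coeff2 0 = 0 := by
      rcases he with e | e
      · obtain ⟨B, hB, hB'⟩ := (h2 e).exists_eq
        rw [pd2_fst_mul_zero hB hB', mul_zero]
      · obtain ⟨A, hA, hA'⟩ := (h3 e).exists_eq
        rw [pd1_snd_mul_zero hA hA', zero_mul]
    rw [FoliationGerm.isSimpleSingularity_iff _ h0] at h1
    have d1 : DifferentiableAt ℂ G.coeff1 (Prod.swap (0 : ℂ × ℂ)) :=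
      G.analyticAt_coeff1.differentiableAt
    have d2 : DifferentiableAt ℂ G.coeff2 (Prod.swap (0 : ℂ × ℂ)) :=
      G.analyticAt_coeff2.differentiableAt
    rw [FoliationGerm.isSimpleSingularity_iff, G.coeff1_swap, G.coeff2_swap, pd2_swap d2,
      pd1_swap d1]
    · refine ⟨h1.2.1, h1.1, fun p q hp hq => ?_⟩
      have := h1.2.2 q p hq hp
      rwa [add_comm] at this
    · rw [G.coeff1_swap, G.coeff2_swap, pd1_swap d2, pd2_swap d1, mul_comm]
      exact h0

lemma SimpleAfter.of_swap {G : FoliationGerm} {φ : ℂ × ℂ → ℂ × ℂ} (hφ : IsHolMapGerm φ)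
    (hd : Dominant φ) (h : SimpleAfter G.swap φ) : SimpleAfter G (Prod.swap ∘ φ) := by
  obtain ⟨H, h1, h2⟩ := h
  exact ⟨H, G.isPullback_swap.comp (analyticAt_swap 0) hφ hd h1, h2⟩

lemma SimpleAfter.of_comp {F G : FoliationGerm} {P φ : ℂ × ℂ → ℂ × ℂ} (hP : AnalyticAt ℂ P 0)
    (hG : FoliationGerm.IsPullback P F G) (hφ : IsHolMapGerm φ) (hd : Dominant φ)
    (h : SimpleAfter G φ) : SimpleAfter F (P ∘ φ) := by
  obtain ⟨H, h1, h2⟩ := h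
  exact ⟨H, hG.comp hP hφ hd h1, h2⟩

/-! ### Constructing pullbacks -/

open FoliationGerm

section
variable {F : FoliationGerm} {φ : ℂ × ℂ → ℂ × ℂ} {m H1 H2 : ℂ × ℂ → ℂ}

/-- The coefficient identities are required only off the axes, where the logarithmic formulas for `t
∂/∂t` and `y ∂/∂y` may be divided by `t` and `y`. -/
lemma exists_pullback (hφ : IsHolMapGerm φ) (hm : AnalyticAt ℂ m 0) (hm0 : ∃ᶠ q in 𝓝 0, m q ≠ 0)
    (hH1 : AnalyticAt ℂ H1 0) (hH2 : AnalyticAt ℂ H2 0)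
    (e1 : ∀ᶠ q in 𝓝 0, q.1 ≠ 0 → q.2 ≠ 0 → F.pull1 φ q = m q * H1 q)
    (e2 : ∀ᶠ q in 𝓝 0, q.1 ≠ 0 → q.2 ≠ 0 → F.pull2 φ q = m q * H2 q)
    (iso : ∀ᶠ q in 𝓝 0, q ≠ 0 → H1 q ≠ 0 ∨ H2 q ≠ 0) :
    IsPullback φ F (ofCoeff H1 H2 hH1 hH2 iso) := by
  refine isPullback_of_coeff hφ.1 hm hm0 ?_ ?_
  · simpa using eventually_eq_of_axes_ne (F.analyticAt_pull1 hφ) (hm.mul hH1) e1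
  · simpa using eventually_eq_of_axes_ne (F.analyticAt_pull2 hφ) (hm.mul hH2) e2

lemma simpleAfter_of_regular (hφ : IsHolMapGerm φ) (hm : AnalyticAt ℂ m 0)
    (hm0 : ∃ᶠ q in 𝓝 0, m q ≠ 0) (hH1 : AnalyticAt ℂ H1 0) (hH2 : AnalyticAt ℂ H2 0)
    (e1 : ∀ᶠ q in 𝓝 0, q.1 ≠ 0 → q.2 ≠ 0 → F.pull1 φ q = m q * H1 q)
    (e2 : ∀ᶠ q in 𝓝 0, q.1 ≠ 0 → q.2 ≠ 0 → F.pull2 φ q = m q * H2 q)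
    (h : H1 0 ≠ 0 ∨ H2 0 ≠ 0) : SimpleAfter F φ := by
  have iso : ∀ᶠ q in 𝓝 0, q ≠ 0 → H1 q ≠ 0 ∨ H2 q ≠ 0 := by
    rcases h with h | h
    · exact (hH1.continuousAt.eventually_ne h).mono fun q hq _ => Or.inl hq
    · exact (hH2.continuousAt.eventually_ne h).mono fun q hq _ => Or.inr hq
  refine ⟨_, exists_pullback hφ hm hm0 hH1 hH2 e1 e2 iso, Or.inl ?_⟩
  rw [isRegular_iff]; simpa using h

lemma simpleAfter_of_simple (hφ : IsHolMapGerm φ) (hm : AnalyticAt ℂ m 0)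
    (hm0 : ∃ᶠ q in 𝓝 0, m q ≠ 0) (hH1 : AnalyticAt ℂ H1 0) (hH2 : AnalyticAt ℂ H2 0)
    (e1 : ∀ᶠ q in 𝓝 0, q.1 ≠ 0 → q.2 ≠ 0 → F.pull1 φ q = m q * H1 q)
    (e2 : ∀ᶠ q in 𝓝 0, q.1 ≠ 0 → q.2 ≠ 0 → F.pull2 φ q = m q * H2 q)
    (iso : ∀ᶠ q in 𝓝 0, q ≠ 0 → H1 q ≠ 0 ∨ H2 q ≠ 0)
    (h1 : H1 0 = 0) (h2 : H2 0 = 0) (h3 : pd2 H2 0 = 0)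
    (h : ∀ p q : ℕ, 0 < p → 0 < q → p * pd1 H2 0 + q * pd2 H1 0 ≠ 0) : SimpleAfter F φ := by
  refine ⟨_, exists_pullback hφ hm hm0 hH1 hH2 e1 e2 iso, Or.inr ?_⟩
  have c1 : (ofCoeff H1 H2 hH1 hH2 iso).coeff1 = H1 := by ext; simp
  have c2 : (ofCoeff H1 H2 hH1 hH2 iso).coeff2 = H2 := by ext; simp
  rw [isSimpleSingularity_iff _ (by rw [c2, h3, mul_zero]), c1, c2]
  exact ⟨h1, h2, h⟩

/-- The zero of a form with nondegenerate triangular linear part is isolated. -/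
lemma isolated_of_eigenvalues_ne (hH1 : AnalyticAt ℂ H1 0) (hH2 : AnalyticAt ℂ H2 0)
    (h3 : pd2 H2 0 = 0) (h4 : pd1 H2 0 ≠ 0) (h5 : pd2 H1 0 ≠ 0) :
    ∀ᶠ q in 𝓝 0, q ≠ 0 → H1 q ≠ 0 ∨ H2 q ≠ 0 := by
  have hH := hH1.prod hH2
  have hd := hH.differentiableAt.hasFDerivAt
  -- An injective derivative is bounded below, hence the zero of `(H1, H2)` is isolated.
  have hker : (fderiv ℂ (fun q => (H1 q, H2 q)) 0).ker = ⊥ := by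
    rw [LinearMap.ker_eq_bot']
    intro v hv
    have := fderiv_eq_jacobian hH.differentiableAt v
    simp only [ContinuousLinearMap.coe_coe] at hv
    rw [this] at hv
    simp only [Prod.mk_eq_zero] at hv
    have e2 : v.1 = 0 := by
      have := hv.2
      rw [show pd2 (fun z => H2 z) 0 = 0 from h3] at this
      simpa [show pd1 (fun z => H2 z) 0 ≠ 0 from h4] using this
    have e1 : v.2 = 0 := by
      have := hv.1
      simpa [e2, show pd2 (fun z => H1 z) 0 ≠ 0 from h5] using this
    exact Prod.ext e2 e1
  obtain ⟨K, _, hK⟩ := LinearMap.exists_antilipschitzWith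
    (fderiv ℂ (fun q => (H1 q, H2 q)) 0 : ℂ × ℂ →ₗ[ℂ] ℂ × ℂ) hker
  have := hd.eventually_ne (c := 0) ⟨K, hK⟩
  filter_upwards [eventually_nhdsWithin_iff.mp this] with q hq h0
  by_contra hc
  push Not at hc
  exact hq h0 (Prod.ext hc.1 hc.2)

/-- Where the Jacobian is invertible, a common zero of the pulled-back coefficients is a zero of `F`
at the image. By Cramer's rule isolatedness then only has to be checked on the critical set. -/
lemma coeff_ne_zero_of_jac (hφ : IsHolMapGerm φ) (hm : AnalyticAt ℂ m 0)
    (hH1 : AnalyticAt ℂ H1 0) (hH2 : AnalyticAt ℂ H2 0)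
    (e1 : ∀ᶠ q in 𝓝 0, q.1 ≠ 0 → q.2 ≠ 0 → F.pull1 φ q = m q * H1 q)
    (e2 : ∀ᶠ q in 𝓝 0, q.1 ≠ 0 → q.2 ≠ 0 → F.pull2 φ q = m q * H2 q)
    {p : ℂ × ℂ → Prop} (hJ : ∀ᶠ q in 𝓝 0, p q → jac φ q ≠ 0 ∧ φ q ≠ 0) :
    ∀ᶠ q in 𝓝 0, p q → H1 q ≠ 0 ∨ H2 q ≠ 0 := by
  filter_upwards [eventually_eq_of_axes_ne (F.analyticAt_pull1 hφ) (hm.mul hH1) e1,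
    eventually_eq_of_axes_ne (F.analyticAt_pull2 hφ) (hm.mul hH2) e2, hJ,
    hφ.tendsto.eventually F.isolated_coeff] with q a1 a2 a3 a4 h1
  by_contra hc
  push Not at hc
  obtain ⟨b1, b2⟩ := a3 h1
  simp only [Pi.mul_apply] at a1 a2
  rw [hc.1, mul_zero] at a1
  rw [hc.2, mul_zero] at a2
  simp only [pull1, pull2] at a1 a2
  have c1 : F.coeff1 (φ q) * jac φ q = 0 := by
    simp only [jac]
    linear_combination pd2 (fun z => (φ z).2) q * a1 - pd1 (fun z => (φ z).2) q * a2
  have c2 : F.coeff2 (φ q) * jac φ q = 0 := by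
    simp only [jac]
    linear_combination pd1 (fun z => (φ z).1) q * a2 - pd2 (fun z => (φ z).1) q * a1
  rcases a4 b2 with h | h
  · exact h ((mul_eq_zero.mp c1).resolve_right b1)
  · exact h ((mul_eq_zero.mp c2).resolve_right b1)

end

/-! ### Germs ramified along the first axis -/

/-- The map `(t, y) ↦ (t ^ a U, t ^ b V)`. -/
def powMap (a b : ℕ) (U V : ℂ × ℂ → ℂ) (q : ℂ × ℂ) : ℂ × ℂ := (q.1 ^ a * U q, q.1 ^ b * V q)

/-- The value at the origin of the Jacobian determinant of `powMap a b U V`, up to a power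
of `t`. -/
noncomputable def powDelta (a b : ℕ) (U V : ℂ × ℂ → ℂ) : ℂ := a * U 0 * pd2 V 0 - b * V 0 * pd2 U 0

section
variable {a b : ℕ} {U V : ℂ × ℂ → ℂ} {q : ℂ × ℂ}

lemma fst_mul_pull1_powMap (F : FoliationGerm) (hU : DifferentiableAt ℂ U q)
    (hV : DifferentiableAt ℂ V q) :
    q.1 * F.pull1 (powMap a b U V) q =
      F.coeff1 (powMap a b U V q) * (q.1 ^ a * (a * U q + q.1 * pd1 U q))
      + F.coeff2 (powMap a b U V q) * (q.1 ^ b * (b * V q + q.1 * pd1 V q)) := by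
  rw [← fst_mul_pd1_fst_pow_mul a hU, ← fst_mul_pd1_fst_pow_mul b hV]
  simp only [pull1, powMap]
  ring

lemma pull2_powMap (F : FoliationGerm) (hU : DifferentiableAt ℂ U q)
    (hV : DifferentiableAt ℂ V q) :
    F.pull2 (powMap a b U V) q =
      F.coeff1 (powMap a b U V q) * (q.1 ^ a * pd2 U q)
      + F.coeff2 (powMap a b U V q) * (q.1 ^ b * pd2 V q) := by
  rw [← pd2_fst_pow_mul a hU, ← pd2_fst_pow_mul b hV]
  simp only [pull2, powMap]

lemma fst_mul_jac_powMap (hU : DifferentiableAt ℂ U q) (hV : DifferentiableAt ℂ V q) :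
    q.1 * jac (powMap a b U V) q = q.1 ^ (a + b) *
      ((a * U q + q.1 * pd1 U q) * pd2 V q - pd2 U q * (b * V q + q.1 * pd1 V q)) := by
  have e1 := fst_mul_pd1_fst_pow_mul a hU
  have e2 := fst_mul_pd1_fst_pow_mul b hV
  have e3 := pd2_fst_pow_mul a hU
  have e4 := pd2_fst_pow_mul b hV
  simp only [jac, powMap, e3, e4, pow_add]
  linear_combination q.1 ^ b * pd2 V q * e1 - q.1 ^ a * pd2 U q * e2

lemma isHolMapGerm_powMap (hU : AnalyticAt ℂ U 0) (hV : AnalyticAt ℂ V 0)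
    (h1 : a = 0 → U 0 = 0) (h2 : b = 0 → V 0 = 0) : IsHolMapGerm (powMap a b U V) := by
  refine isHolMapGerm_mk ((analyticAt_fst.pow a).mul hU) ((analyticAt_fst.pow b).mul hV) ?_ ?_
  · rcases Nat.eq_zero_or_pos a with h | h
    · simp [h1 h]
    · simp [h.ne']
  · rcases Nat.eq_zero_or_pos b with h | h
    · simp [h2 h]
    · simp [h.ne']

lemma jac_powMap_ne_zero (hU : AnalyticAt ℂ U 0) (hV : AnalyticAt ℂ V 0)
    (hΔ : powDelta a b U V ≠ 0) :
    ∀ᶠ q : ℂ × ℂ in 𝓝 0, q.1 ≠ 0 → jac (powMap a b U V) q ≠ 0 := by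
  have hK : AnalyticAt ℂ (fun q : ℂ × ℂ => (a * U q + q.1 * pd1 U q) * pd2 V q
      - pd2 U q * (b * V q + q.1 * pd1 V q)) 0 :=
    (((analyticAt_const.mul hU).add (analyticAt_fst.mul hU.pd1)).mul hV.pd2).sub
      (hU.pd2.mul ((analyticAt_const.mul hV).add (analyticAt_fst.mul hV.pd1)))
  have := hK.continuousAt.eventually_ne (y := 0) (by
    simp only [Prod.fst_zero, zero_mul, add_zero]
    rw [powDelta] at hΔ
    convert hΔ using 1; ring)
  filter_upwards [this, hU.eventually_analyticAt, hV.eventually_analyticAt] with q h1 h2 h3 h0 h4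
  have := fst_mul_jac_powMap (a := a) (b := b) h2.differentiableAt h3.differentiableAt
  rw [h4, mul_zero] at this
  exact mul_ne_zero (pow_ne_zero _ h0) h1 this.symm

lemma dominant_powMap (hU : AnalyticAt ℂ U 0) (hV : AnalyticAt ℂ V 0)
    (h1 : a = 0 → U 0 = 0) (h2 : b = 0 → V 0 = 0) (hΔ : powDelta a b U V ≠ 0) :
    Dominant (powMap a b U V) := by
  refine Dominant.of_jac (isHolMapGerm_powMap hU hV h1 h2) ?_
  exact (frequently_fst_ne_zero.and_eventually (jac_powMap_ne_zero hU hV hΔ)).mono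
    fun q hq => hq.2 hq.1

lemma powDelta_swap : powDelta b a V U = - powDelta a b U V := by
  simp only [powDelta]; ring

/-- Regular foliations for which the image of the ramification axis is invariant. -/
lemma simpleAfter_powMap_of_invariantFst {G : FoliationGerm} (hU : AnalyticAt ℂ U 0)
    (hV : AnalyticAt ℂ V 0) (ha : 1 ≤ a) (hU0 : U 0 ≠ 0) (hb : b = 0 → V 0 = 0)
    (hG : G.InvariantFst) (hA : G.coeff1 0 ≠ 0) : SimpleAfter G (powMap a b U V) := by
  obtain ⟨B, hB, hBe⟩ := hG.exists_eq
  have hφ := isHolMapGerm_powMap (a := a) (b := b) hU hV (fun h => by omega) hb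
  have hAφ := hφ.comp_analyticAt G.analyticAt_coeff1
  have hBφ := hφ.comp_analyticAt hB
  -- With `B` divisible by `x = t ^ a U`, both coefficients are divisible by `t ^ (a - 1)`; the
  -- remaining `dt`-coefficient at `0` is `A(0) a U(0)`.
  refine simpleAfter_of_regular (m := fun q => q.1 ^ (a - 1))
    (H1 := fun q => G.coeff1 (powMap a b U V q) * (a * U q + q.1 * pd1 U q)
      + U q * B (powMap a b U V q) * (q.1 ^ b * (b * V q + q.1 * pd1 V q)))
    (H2 := fun q => q.1 * (G.coeff1 (powMap a b U V q) * pd2 U q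
      + U q * B (powMap a b U V q) * (q.1 ^ b * pd2 V q)))
    hφ (analyticAt_fst.pow _) (frequently_fst_ne_zero.mono fun q hq => pow_ne_zero _ hq)
    ?_ ?_ ?_ ?_ (Or.inl ?_)
  · exact (hAφ.mul ((analyticAt_const.mul hU).add (analyticAt_fst.mul hU.pd1))).add
      ((hU.mul hBφ).mul ((analyticAt_fst.pow _).mul
        ((analyticAt_const.mul hV).add (analyticAt_fst.mul hV.pd1))))
  · exact analyticAt_fst.mul ((hAφ.mul hU.pd2).add
      ((hU.mul hBφ).mul ((analyticAt_fst.pow _).mul hV.pd2)))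
  · filter_upwards [hU.eventually_analyticAt, hV.eventually_analyticAt,
      hφ.tendsto.eventually hBe] with q h1 h2 h3 h0 _
    have e := fst_mul_pull1_powMap (a := a) (b := b) G h1.differentiableAt h2.differentiableAt
    rw [h3] at e
    have e3 : (powMap a b U V q).1 = q.1 ^ a * U q := rfl
    have e4 : q.1 ^ a = q.1 * q.1 ^ (a - 1) := by rw [← pow_succ', Nat.sub_add_cancel ha]
    rw [e3, e4] at e
    refine mul_left_cancel₀ h0 (e.trans ?_)
    ring
  · filter_upwards [hU.eventually_analyticAt, hV.eventually_analyticAt,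
      hφ.tendsto.eventually hBe] with q h1 h2 h3 h0 _
    have e := pull2_powMap (a := a) (b := b) G h1.differentiableAt h2.differentiableAt
    rw [h3] at e
    have e3 : (powMap a b U V q).1 = q.1 ^ a * U q := rfl
    have e4 : q.1 ^ a = q.1 * q.1 ^ (a - 1) := by rw [← pow_succ', Nat.sub_add_cancel ha]
    rw [e3, e4] at e
    refine e.trans ?_
    ring
  · have h1 : (0 : ℂ) ^ b * b = 0 := by
      rcases Nat.eq_zero_or_pos b with h | h
      · simp [h]
      · simp [h.ne']
    have h2 : (0 : ℂ) ^ b * (b * V 0) = 0 := by rw [← mul_assoc, h1, zero_mul]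
    simp only [hφ.2, Prod.fst_zero, zero_mul, add_zero, h2, mul_zero]
    exact mul_ne_zero hA (mul_ne_zero (by exact_mod_cast (by omega : a ≠ 0)) hU0)

/-- Regular foliations transversal to the image of the ramification axis. -/
lemma simpleAfter_powMap_of_transversalFst {G : FoliationGerm} (hU : AnalyticAt ℂ U 0)
    (hV : AnalyticAt ℂ V 0) (ha : 1 ≤ a) (hba : b ≤ a) (hb : b = 0 → V 0 = 0)
    (hΔ : powDelta a b U V ≠ 0) (hB : G.coeff2 0 ≠ 0) : SimpleAfter G (powMap a b U V) := by
  have hφ := isHolMapGerm_powMap (a := a) (b := b) hU hV (fun h => by omega) hb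
  have hAφ := hφ.comp_analyticAt G.analyticAt_coeff1
  have hBφ := hφ.comp_analyticAt G.analyticAt_coeff2
  have ha' : (a : ℂ) ≠ 0 := by exact_mod_cast (by omega : a ≠ 0)
  rcases Nat.eq_zero_or_pos b with rfl | hb0
  · have hV0 := hb rfl
    refine simpleAfter_of_regular (m := fun _ => 1) (H1 := G.pull1 (powMap a 0 U V))
      (H2 := G.pull2 (powMap a 0 U V)) hφ analyticAt_const (by simp) (G.analyticAt_pull1 hφ)
      (G.analyticAt_pull2 hφ) (by simp) (by simp) (Or.inr ?_)
    rw [pull2_powMap G hU.differentiableAt hV.differentiableAt, hφ.2]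
    have : a ≠ 0 := by omega
    simp only [powDelta, Nat.cast_zero, zero_mul, sub_zero] at hΔ
    simpa [this] using ⟨hB, right_ne_zero_of_mul hΔ⟩
  -- After division by `t ^ (b - 1)` the form is `H1 dt + t K dy`. It is regular unless `H1`
  -- vanishes at the origin.
  let H1 : ℂ × ℂ → ℂ := fun q => G.coeff2 (powMap a b U V q) * (b * V q + q.1 * pd1 V q)
      + G.coeff1 (powMap a b U V q) * (q.1 ^ (a - b) * (a * U q + q.1 * pd1 U q))
  let K : ℂ × ℂ → ℂ := fun q => G.coeff2 (powMap a b U V q) * pd2 V q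
      + G.coeff1 (powMap a b U V q) * (q.1 ^ (a - b) * pd2 U q)
  have hH1 : AnalyticAt ℂ H1 0 := (hBφ.mul ((analyticAt_const.mul hV).add
    (analyticAt_fst.mul hV.pd1))).add (hAφ.mul ((analyticAt_fst.pow _).mul
      ((analyticAt_const.mul hU).add (analyticAt_fst.mul hU.pd1))))
  have hK : AnalyticAt ℂ K 0 := (hBφ.mul hV.pd2).add (hAφ.mul ((analyticAt_fst.pow _).mul hU.pd2))
  have e1 : ∀ᶠ q in 𝓝 0, q.1 ≠ 0 → q.2 ≠ 0 →
      G.pull1 (powMap a b U V) q = q.1 ^ (b - 1) * H1 q := by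
    filter_upwards [hU.eventually_analyticAt, hV.eventually_analyticAt] with q h1 h2 h0 _
    have e := fst_mul_pull1_powMap (a := a) (b := b) G h1.differentiableAt h2.differentiableAt
    have e4 : q.1 ^ a = q.1 * q.1 ^ (b - 1) * q.1 ^ (a - b) := by
      rw [← pow_succ', ← pow_add]; congr 1; omega
    have e5 : q.1 ^ b = q.1 * q.1 ^ (b - 1) := by rw [← pow_succ', Nat.sub_add_cancel hb0]
    rw [e4, e5] at e
    refine mul_left_cancel₀ h0 (e.trans ?_)
    simp only [H1]; ring
  have e2 : ∀ᶠ q in 𝓝 0, q.1 ≠ 0 → q.2 ≠ 0 →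
      G.pull2 (powMap a b U V) q = q.1 ^ (b - 1) * (q.1 * K q) := by
    filter_upwards [hU.eventually_analyticAt, hV.eventually_analyticAt] with q h1 h2 h0 _
    have e := pull2_powMap (a := a) (b := b) G h1.differentiableAt h2.differentiableAt
    have e4 : q.1 ^ a = q.1 * q.1 ^ (b - 1) * q.1 ^ (a - b) := by
      rw [← pow_succ', ← pow_add]; congr 1; omega
    have e5 : q.1 ^ b = q.1 * q.1 ^ (b - 1) := by rw [← pow_succ', Nat.sub_add_cancel hb0]
    rw [e4, e5] at e
    refine e.trans ?_
    simp only [K]; ring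
  have hm : AnalyticAt ℂ (fun q : ℂ × ℂ => q.1 ^ (b - 1)) 0 := analyticAt_fst.pow _
  have hm0 : ∃ᶠ q : ℂ × ℂ in 𝓝 0, q.1 ^ (b - 1) ≠ 0 :=
    frequently_fst_ne_zero.mono fun q hq => pow_ne_zero _ hq
  have hH2 : AnalyticAt ℂ (fun q => q.1 * K q) 0 := analyticAt_fst.mul hK
  by_cases h0 : H1 0 = 0
  swap
  · exact simpleAfter_of_regular hφ hm hm0 hH1 hH2 e1 e2 (Or.inl h0)
  -- The axis `t = 0` is contracted, so on it `H1` involves only the values `A(0)`, `B(0)`. Its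
  -- `y`-derivative is `b K(0)`, which gives the eigenvalues `K(0)` and `-b K(0)`, of negative
  -- ratio.
  have hφ0 : ∀ y : ℂ, powMap a b U V (0, y) = 0 := fun y => by
    have : a ≠ 0 := by omega
    simp [powMap, this, hb0.ne']
  have hd : pd2 H1 0 = b * K 0 := by
    have hr : (fun y : ℂ => H1 (0, y)) = fun y => G.coeff2 0 * (b * V (0, y))
        + G.coeff1 0 * (0 ^ (a - b) * (b * U (0, y))) := by
      ext y
      simp only [H1, hφ0, zero_mul, add_zero]
      rcases hba.eq_or_lt with rfl | h
      · rfl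
      · have : a - b ≠ 0 := by omega
        simp [this]
    have h1 := pd2_eq_deriv hH1.differentiableAt
    simp only [Prod.fst_zero, hr] at h1
    have h2 := pd2_eq_deriv hV.differentiableAt
    have h3 := pd2_eq_deriv hU.differentiableAt
    simp only [Prod.fst_zero] at h2 h3
    have h4 := ((h2.const_mul (b : ℂ)).const_mul (G.coeff2 0)).add
      (((h3.const_mul (b : ℂ)).const_mul ((0 : ℂ) ^ (a - b))).const_mul (G.coeff1 0))
    refine h1.unique (h4.congr_deriv ?_)
    simp only [K, hφ.2, Prod.fst_zero]
    ring
  have hd2 : pd1 (fun q => q.1 * K q) 0 = K 0 := pd1_fst_mul_zero hK (by simp)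
  have hd3 : pd2 (fun q => q.1 * K q) 0 = 0 := pd2_fst_mul_zero hK (by simp)
  -- If `H1` and `K` both vanished at the origin, so would `powDelta`, the leading coefficient of
  -- the Jacobian.
  have hK0 : K 0 ≠ 0 := by
    intro hK0
    simp only [H1, K, hφ.2, Prod.fst_zero, zero_mul, add_zero] at h0 hK0
    simp only [powDelta] at hΔ
    rcases hba.eq_or_lt with rfl | h
    · simp only [Nat.sub_self, pow_zero, one_mul] at h0 hK0
      have h2 : G.coeff2 0 * V 0 + G.coeff1 0 * U 0 = 0 := by
        apply mul_left_cancel₀ ha'; linear_combination h0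
      refine mul_ne_zero hB hΔ ?_
      linear_combination b * U 0 * hK0 - b * pd2 U 0 * h2
    · have hab : a - b ≠ 0 := by omega
      have hb' : (b : ℂ) ≠ 0 := by exact_mod_cast hb0.ne'
      simp [hab, hB, hb'] at h0 hK0
      simp [h0, hK0] at hΔ
  have hbK : (b : ℂ) * K 0 ≠ 0 := mul_ne_zero (by exact_mod_cast hb0.ne') hK0
  refine simpleAfter_of_simple hφ hm hm0 hH1 hH2 e1 e2 ?_ h0 (by simp) hd3 ?_
  · exact isolated_of_eigenvalues_ne hH1 hH2 hd3 (by rwa [hd2]) (by rwa [hd])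
  · intro p q hp hq
    rw [hd, hd2]
    have : ((p + q * b : ℕ) : ℂ) * K 0 ≠ 0 :=
      mul_ne_zero (by exact_mod_cast (by omega : p + q * b ≠ 0)) hK0
    intro h; apply this; push_cast; linear_combination h

/-- Simple singularities for which only the image of the ramification axis is marked. -/
lemma simpleAfter_powMap_of_simple_of_zero {G : FoliationGerm} (hU : AnalyticAt ℂ U 0)
    (hV : AnalyticAt ℂ V 0) (hba : b < a) (hU0 : U 0 ≠ 0) (hV0 : V 0 = 0)
    (hΔ : powDelta a b U V ≠ 0) (hG : G.InvariantFst) (hs : G.IsSimpleSingularity) :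
    SimpleAfter G (powMap a b U V) := by
  obtain ⟨B, hB, hBe⟩ := hG.exists_eq
  rw [isSimpleSingularity_iff _ (by rw [pd2_fst_mul_zero hB hBe, mul_zero])] at hs
  obtain ⟨hA0, -, hs⟩ := hs
  rw [pd1_fst_mul_zero hB hBe] at hs
  obtain ⟨A1, hA1, hA1e⟩ := exists_eq_add_fst_mul G.analyticAt_coeff1
  obtain ⟨A2, hA2, hA2e⟩ := exists_eq_snd_mul (f := fun q => G.coeff1 (0, q.2))
    (AnalyticAt.comp (g := G.coeff1) (f := fun q : ℂ × ℂ => ((0 : ℂ), q.2)) G.analyticAt_coeff1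
      (analyticAt_const.prod analyticAt_snd)) (Eventually.of_forall fun _ => hA0)
  have hAe : ∀ᶠ q in 𝓝 0, G.coeff1 q = q.1 * A1 q + q.2 * A2 q := by
    filter_upwards [hA1e, hA2e] with q h1 h2
    rw [h1, h2, add_comm]
  have hpA : pd2 G.coeff1 0 = A2 0 := by
    have := (Filter.EventuallyEq.pd2 (show G.coeff1 =ᶠ[𝓝 0] _ from hAe)).self_of_nhds
    have d1 := hA1.differentiableAt
    have d2 := hA2.differentiableAt
    rw [this, pd2_add (by fun_prop) (by fun_prop), pd2_mul (by fun_prop) d1,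
      pd2_mul (by fun_prop) d2]
    simp
  rw [hpA] at hs
  have ha : 1 ≤ a := by omega
  have ha0 : a ≠ 0 := by omega
  have hab0 : a - b ≠ 0 := by omega
  have hφ := isHolMapGerm_powMap (a := a) (b := b) hU hV (fun h => by omega) (fun _ => hV0)
  have hA1φ := hφ.comp_analyticAt hA1
  have hA2φ := hφ.comp_analyticAt hA2
  have hBφ := hφ.comp_analyticAt hB
  have hVy : pd2 V 0 ≠ 0 := by
    intro h
    simp [powDelta, hV0, h] at hΔ
  -- From `A = x A1 + y A2` and `b < a`, the germ `t ^ b` divides the pullback of `A`, and `C` is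
  -- the quotient. Together with `B` divisible by `x`, this allows division by `t ^ (a - 1 + b)`.
  let C : ℂ × ℂ → ℂ := fun q => q.1 ^ (a - b) * (U q * A1 (powMap a b U V q))
    + V q * A2 (powMap a b U V q)
  have hC : AnalyticAt ℂ C 0 := ((analyticAt_fst.pow _).mul (hU.mul hA1φ)).add (hV.mul hA2φ)
  let H1 : ℂ × ℂ → ℂ := fun q => C q * (a * U q + q.1 * pd1 U q)
    + U q * B (powMap a b U V q) * (b * V q + q.1 * pd1 V q)
  let K : ℂ × ℂ → ℂ := fun q => C q * pd2 U q + U q * B (powMap a b U V q) * pd2 V q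
  have hH1 : AnalyticAt ℂ H1 0 := (hC.mul ((analyticAt_const.mul hU).add
    (analyticAt_fst.mul hU.pd1))).add ((hU.mul hBφ).mul ((analyticAt_const.mul hV).add
      (analyticAt_fst.mul hV.pd1)))
  have hK : AnalyticAt ℂ K 0 := (hC.mul hU.pd2).add ((hU.mul hBφ).mul hV.pd2)
  have hH2 : AnalyticAt ℂ (fun q => q.1 * K q) 0 := analyticAt_fst.mul hK
  have hm : AnalyticAt ℂ (fun q : ℂ × ℂ => q.1 ^ (a - 1 + b)) 0 := analyticAt_fst.pow _
  have hm0 : ∃ᶠ q : ℂ × ℂ in 𝓝 0, q.1 ^ (a - 1 + b) ≠ 0 :=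
    frequently_fst_ne_zero.mono fun q hq => pow_ne_zero _ hq
  have hAφe : ∀ᶠ q in 𝓝 0, G.coeff1 (powMap a b U V q) = q.1 ^ b * C q := by
    filter_upwards [hφ.tendsto.eventually hAe] with q h1
    have e4 : q.1 ^ a = q.1 ^ b * q.1 ^ (a - b) := by
      rw [← pow_add]; congr 1; omega
    have e3 : (powMap a b U V q).1 = q.1 ^ a * U q := rfl
    have e5 : (powMap a b U V q).2 = q.1 ^ b * V q := rfl
    rw [h1, e3, e5, e4]
    simp only [C]; ring
  have e1 : ∀ᶠ q in 𝓝 0, q.1 ≠ 0 → q.2 ≠ 0 →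
      G.pull1 (powMap a b U V) q = q.1 ^ (a - 1 + b) * H1 q := by
    filter_upwards [hU.eventually_analyticAt, hV.eventually_analyticAt, hAφe,
      hφ.tendsto.eventually hBe] with q h1 h2 h3 h4 h0 _
    have e := fst_mul_pull1_powMap (a := a) (b := b) G h1.differentiableAt h2.differentiableAt
    have e3 : (powMap a b U V q).1 = q.1 ^ a * U q := rfl
    have e4 : q.1 ^ a = q.1 * q.1 ^ (a - 1) := by rw [← pow_succ', Nat.sub_add_cancel ha]
    rw [h3, h4, e3, e4] at e
    refine mul_left_cancel₀ h0 (e.trans ?_)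
    simp only [H1, pow_add]; ring
  have e2 : ∀ᶠ q in 𝓝 0, q.1 ≠ 0 → q.2 ≠ 0 →
      G.pull2 (powMap a b U V) q = q.1 ^ (a - 1 + b) * (q.1 * K q) := by
    filter_upwards [hU.eventually_analyticAt, hV.eventually_analyticAt, hAφe,
      hφ.tendsto.eventually hBe] with q h1 h2 h3 h4 h0 _
    have e := pull2_powMap (a := a) (b := b) G h1.differentiableAt h2.differentiableAt
    have e3 : (powMap a b U V q).1 = q.1 ^ a * U q := rfl
    have e4 : q.1 ^ a = q.1 * q.1 ^ (a - 1) := by rw [← pow_succ', Nat.sub_add_cancel ha]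
    rw [h3, h4, e3, e4] at e
    refine e.trans ?_
    simp only [K, pow_add]; ring
  have hC0 : C 0 = 0 := by simp [C, hab0, hV0]
  have h0 : H1 0 = 0 := by simp [H1, hC0, hV0]
  let E : ℂ × ℂ → ℂ := fun q => U q * (a * A2 (powMap a b U V q) + b * B (powMap a b U V q))
  have hE : AnalyticAt ℂ E 0 :=
    hU.mul ((analyticAt_const.mul hA2φ).add (analyticAt_const.mul hBφ))
  have hline : ∀ y : ℂ, H1 (0, y) = V (0, y) * E (0, y) := by
    intro y
    simp only [H1, C, E, zero_pow hab0, zero_mul, zero_add, add_zero]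
    ring
  have hd : pd2 H1 0 = pd2 V 0 * E 0 := by
    have h1 := pd2_eq_deriv hH1.differentiableAt
    have h2 := pd2_eq_deriv hV.differentiableAt
    have h3 := pd2_eq_deriv hE.differentiableAt
    simp only [Prod.fst_zero, hline] at h1 h2 h3
    refine h1.unique ((h2.mul h3).congr_deriv ?_)
    have : V (0, (0 : ℂ × ℂ).2) = 0 := hV0
    rw [this, zero_mul, add_zero]; rfl
  have hd2 : pd1 (fun q => q.1 * K q) 0 = K 0 := pd1_fst_mul_zero hK (by simp)
  have hd3 : pd2 (fun q => q.1 * K q) 0 = 0 := pd2_fst_mul_zero hK (by simp)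
  have hVne : ∀ᶠ y : ℂ in 𝓝 0, y ≠ 0 → V (0, y) ≠ 0 := by
    have h2 := pd2_eq_deriv hV.differentiableAt
    exact eventually_nhdsWithin_iff.mp (h2.eventually_ne hVy)
  refine simpleAfter_of_simple hφ hm hm0 hH1 hH2 e1 e2 ?_ h0 (by simp) hd3 ?_
  -- For `b = 0` the value `E 0` can vanish (a saddle-node). Since `t = 0` is then mapped into `x =
  -- 0` without being contracted, the isolatedness of the zeros of `G` is used instead. For `b > 0`,
  -- simplicity gives `E 0 ≠ 0`.
  · have hEne : ∀ᶠ y : ℂ in 𝓝 0, y ≠ 0 → E (0, y) ≠ 0 := by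
      rcases Nat.eq_zero_or_pos b with rfl | hb0
      · have hline2 : ∀ y : ℂ, powMap a 0 U V (0, y) = (0, V (0, y)) := fun y => by
          simp [powMap, ha0]
        have hVt : Tendsto (fun y : ℂ => ((0 : ℂ), V (0, y))) (𝓝 0) (𝓝 0) := by
          have : Tendsto (fun y : ℂ => V (0, y)) (𝓝 0) (𝓝 0) := by
            have := hV.continuousAt.tendsto.comp tendsto_inr_zero
            rwa [hV0] at this
          exact tendsto_inr_zero.comp this
        filter_upwards [hVne, hVt.eventually G.isolated_coeff, hVt.eventually hAe,
          hVt.eventually hBe, tendsto_inr_zero.eventually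
            (hU.continuousAt.eventually_ne hU0)] with y h1 h2 h3 h4 h5 hy
        have h6 := h1 hy
        have h7 := h2 (by simpa using h6)
        simp only [zero_mul, zero_add] at h3 h4
        simp only [h4, ne_eq, not_true_eq_false, or_false] at h7
        rw [h3] at h7
        simp only [E, hline2, Nat.cast_zero, zero_mul, add_zero]
        exact mul_ne_zero h5 (mul_ne_zero (by exact_mod_cast ha0) (right_ne_zero_of_mul h7))
      · have hE0 : E 0 ≠ 0 := by
          simp only [E, hφ.2]
          refine mul_ne_zero hU0 ?_
          have := hs b a hb0 ha
          rwa [add_comm] at this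
        exact (tendsto_inr_zero.eventually (hE.continuousAt.eventually_ne hE0)).mono
          fun y h _ => h
    have hJ : ∀ᶠ q : ℂ × ℂ in 𝓝 0, q.1 ≠ 0 → jac (powMap a b U V) q ≠ 0 ∧ powMap a b U V q ≠ 0 := by
      filter_upwards [jac_powMap_ne_zero hU hV hΔ, hU.continuousAt.eventually_ne hU0]
        with q h1 h2 h3
      refine ⟨h1 h3, fun h => ?_⟩
      have := congrArg Prod.fst h
      simp [powMap, h2, h3] at this
    have hoff := coeff_ne_zero_of_jac hφ hm hH1 hH2 e1 e2 hJ
    filter_upwards [hoff, tendsto_snd_zero.eventually hVne, tendsto_snd_zero.eventually hEne]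
      with q h1 h2 h3 hq
    by_cases hq1 : q.1 = 0
    · have hq2 : q.2 ≠ 0 := fun h => hq (Prod.ext hq1 h)
      left
      have : q = (0, q.2) := Prod.ext hq1 rfl
      rw [this, hline]
      exact mul_ne_zero (h2 hq2) (h3 hq2)
    · exact h1 hq1
  · intro p q hp hq
    rw [hd, hd2]
    have hK0 : K 0 = U 0 * B 0 * pd2 V 0 := by simp [K, hC0, hφ.2]
    have hE0 : E 0 = U 0 * (a * A2 0 + b * B 0) := by simp [E, hφ.2]
    -- The combination to be excluded is `U V_y ((p + q b) B + q a A2)` at the origin, again a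
    -- positive integer combination.
    have := hs (p + q * b) (q * a) (by positivity) (by positivity)
    intro h
    rw [hK0, hE0] at h
    refine mul_ne_zero (mul_ne_zero hU0 hVy) this ?_
    push_cast
    linear_combination h

/-- Simple singularities for which both axes are marked. -/
lemma simpleAfter_powMap_of_simple {G : FoliationGerm} (hU : AnalyticAt ℂ U 0)
    (hV : AnalyticAt ℂ V 0) (ha : 1 ≤ a) (hb : 1 ≤ b) (hU0 : U 0 ≠ 0) (hV0 : V 0 ≠ 0)
    (hG1 : G.InvariantFst) (hG2 : G.InvariantSnd) (hs : G.IsSimpleSingularity) :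
    SimpleAfter G (powMap a b U V) := by
  obtain ⟨B, hB, hBe⟩ := hG1.exists_eq
  obtain ⟨A, hA, hAe⟩ := hG2.exists_eq
  rw [isSimpleSingularity_iff _ (by rw [pd2_fst_mul_zero hB hBe, mul_zero])] at hs
  obtain ⟨-, -, hs⟩ := hs
  rw [pd1_fst_mul_zero hB hBe, pd2_snd_mul_zero hA hAe] at hs
  have hφ := isHolMapGerm_powMap (a := a) (b := b) hU hV (fun h => by omega) (fun h => by omega)
  have hAφ := hφ.comp_analyticAt hA
  have hBφ := hφ.comp_analyticAt hB
  refine simpleAfter_of_regular (m := fun q => q.1 ^ (a - 1 + b))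
    (H1 := fun q => V q * A (powMap a b U V q) * (a * U q + q.1 * pd1 U q)
      + U q * B (powMap a b U V q) * (b * V q + q.1 * pd1 V q))
    (H2 := fun q => q.1 * (V q * A (powMap a b U V q) * pd2 U q
      + U q * B (powMap a b U V q) * pd2 V q))
    hφ (analyticAt_fst.pow _) (frequently_fst_ne_zero.mono fun q hq => pow_ne_zero _ hq)
    ?_ ?_ ?_ ?_ (Or.inl ?_)
  · exact ((hV.mul hAφ).mul ((analyticAt_const.mul hU).add (analyticAt_fst.mul hU.pd1))).add
      ((hU.mul hBφ).mul ((analyticAt_const.mul hV).add (analyticAt_fst.mul hV.pd1)))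
  · exact analyticAt_fst.mul (((hV.mul hAφ).mul hU.pd2).add ((hU.mul hBφ).mul hV.pd2))
  · filter_upwards [hU.eventually_analyticAt, hV.eventually_analyticAt,
      hφ.tendsto.eventually hAe, hφ.tendsto.eventually hBe] with q h1 h2 h3 h4 h0 _
    have e := fst_mul_pull1_powMap (a := a) (b := b) G h1.differentiableAt h2.differentiableAt
    have e3 : (powMap a b U V q).1 = q.1 ^ a * U q := rfl
    have e5 : (powMap a b U V q).2 = q.1 ^ b * V q := rfl
    have e4 : q.1 ^ a = q.1 * q.1 ^ (a - 1) := by rw [← pow_succ', Nat.sub_add_cancel ha]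
    rw [h3, h4, e3, e5, e4] at e
    refine mul_left_cancel₀ h0 (e.trans ?_)
    rw [pow_add]; ring
  · filter_upwards [hU.eventually_analyticAt, hV.eventually_analyticAt,
      hφ.tendsto.eventually hAe, hφ.tendsto.eventually hBe] with q h1 h2 h3 h4 h0 _
    have e := pull2_powMap (a := a) (b := b) G h1.differentiableAt h2.differentiableAt
    have e3 : (powMap a b U V q).1 = q.1 ^ a * U q := rfl
    have e5 : (powMap a b U V q).2 = q.1 ^ b * V q := rfl
    have e4 : q.1 ^ a = q.1 * q.1 ^ (a - 1) := by rw [← pow_succ', Nat.sub_add_cancel ha]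
    rw [h3, h4, e3, e5, e4] at e
    refine e.trans ?_
    rw [pow_add]; ring
  -- The `dt`-coefficient at the origin is `U V (a A + b B)`, so the singularity becomes a regular
  -- point.
  · have := hs b a hb ha
    simp only [hφ.2, Prod.fst_zero, zero_mul, add_zero]
    intro h
    refine mul_ne_zero (mul_ne_zero hU0 hV0) this ?_
    linear_combination h

/-- A germ ramified along the first axis, with the image of that axis marked. -/
lemma Adapted.simpleAfter_powMap_of_zero {G : FoliationGerm} {e2 : Prop} (h : Adapted True e2 G)
    (hU : AnalyticAt ℂ U 0) (hV : AnalyticAt ℂ V 0) (hba : b < a) (hU0 : U 0 ≠ 0) (hV0 : V 0 = 0)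
    (hΔ : powDelta a b U V ≠ 0) : SimpleAfter G (powMap a b U V) := by
  rcases h with ⟨h1, h2, -⟩ | ⟨h1, h2, -⟩
  · rcases h2 trivial with h | h
    · refine simpleAfter_powMap_of_invariantFst hU hV (by omega) hU0 (fun _ => hV0) h ?_
      have : G.coeff2 0 = 0 := h.self_of_nhds
      rw [isRegular_iff] at h1
      tauto
    · exact simpleAfter_powMap_of_transversalFst hU hV (by omega) hba.le (fun _ => hV0) hΔ h
  · exact simpleAfter_powMap_of_simple_of_zero hU hV hba hU0 hV0 hΔ (h2 trivial) h1

/-- A germ that maps a smooth curve to both axes at once, with both axes marked. -/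
lemma Adapted.simpleAfter_powMap {G : FoliationGerm} (h : Adapted True True G)
    (hU : AnalyticAt ℂ U 0) (hV : AnalyticAt ℂ V 0) (ha : 1 ≤ a) (hb : 1 ≤ b) (hU0 : U 0 ≠ 0)
    (hV0 : V 0 ≠ 0) (hΔ : powDelta a b U V ≠ 0) : SimpleAfter G (powMap a b U V) := by
  have hsw : SimpleAfter G.swap (powMap b a V U) → SimpleAfter G (powMap a b U V) := fun h =>
    h.of_swap (isHolMapGerm_powMap hV hU (fun h => by omega) (fun h => by omega))
      (dominant_powMap hV hU (fun h => by omega) (fun h => by omega)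
        (by rw [powDelta_swap]; exact neg_ne_zero.mpr hΔ))
  have hΔ' : powDelta b a V U ≠ 0 := by rw [powDelta_swap]; exact neg_ne_zero.mpr hΔ
  have main : ∀ {G : FoliationGerm} {a b : ℕ} {U V : ℂ × ℂ → ℂ}, G.IsRegular → G.InvariantFst →
      AnalyticAt ℂ U 0 → AnalyticAt ℂ V 0 → 1 ≤ a → 1 ≤ b → U 0 ≠ 0 →
      SimpleAfter G (powMap a b U V) := by
    intro G a b U V h1 h hU hV ha hb hU0
    refine simpleAfter_powMap_of_invariantFst hU hV ha hU0 (fun h => by omega) h ?_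
    have : G.coeff2 0 = 0 := h.self_of_nhds
    rw [isRegular_iff] at h1
    tauto
  have h' := h.swap (Or.inl trivial)
  rcases h with ⟨h1, h2, h3⟩ | ⟨h1, h2, h3⟩
  · rcases h2 trivial with h4 | h4
    · exact main h1 h4 hU hV ha hb hU0
    rcases h3 trivial with h5 | h5
    · refine hsw (main ?_ ?_ hV hU hb ha hV0)
      · rw [isRegular_iff] at h1 ⊢
        rw [G.coeff1_swap, G.coeff2_swap]; exact h1.symm
      · refine Eventually.mono h5 fun v hv => ?_
        show G.swap.coeff2 (0, v) = 0
        rw [G.coeff2_swap]; exact hv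
    -- Both axes are transversal: the coordinates are exchanged if necessary so that the exponent of
    -- the second component is the smaller one.
    rcases le_total b a with h6 | h6
    · exact simpleAfter_powMap_of_transversalFst hU hV ha h6 (fun h => by omega) hΔ h4
    · refine hsw (simpleAfter_powMap_of_transversalFst hV hU hb h6 (fun h => by omega) hΔ' ?_)
      rw [G.coeff2_swap]; exact h5
  · exact simpleAfter_powMap_of_simple hU hV ha hb hU0 hV0 (h2 trivial) (h3 trivial) h1

end

/-! ### Monomial germs at corners -/

/-- The map `(t, y) ↦ (t ^ a y ^ b U, t ^ c y ^ d V)`. -/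
def monMap (a b c d : ℕ) (U V : ℂ × ℂ → ℂ) (q : ℂ × ℂ) : ℂ × ℂ :=
  (q.1 ^ a * q.2 ^ b * U q, q.1 ^ c * q.2 ^ d * V q)

section
variable {a b c d : ℕ} {U V : ℂ × ℂ → ℂ} {q : ℂ × ℂ}

lemma fst_mul_pull1_monMap (F : FoliationGerm) (hU : DifferentiableAt ℂ U q)
    (hV : DifferentiableAt ℂ V q) :
    q.1 * F.pull1 (monMap a b c d U V) q =
      F.coeff1 (monMap a b c d U V q) * (q.1 ^ a * q.2 ^ b * (a * U q + q.1 * pd1 U q))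
      + F.coeff2 (monMap a b c d U V q) * (q.1 ^ c * q.2 ^ d * (c * V q + q.1 * pd1 V q)) := by
  rw [← fst_mul_pd1_monomial a b hU, ← fst_mul_pd1_monomial c d hV]
  simp only [pull1, monMap]
  ring

lemma snd_mul_pull2_monMap (F : FoliationGerm) (hU : DifferentiableAt ℂ U q)
    (hV : DifferentiableAt ℂ V q) :
    q.2 * F.pull2 (monMap a b c d U V) q =
      F.coeff1 (monMap a b c d U V q) * (q.1 ^ a * q.2 ^ b * (b * U q + q.2 * pd2 U q))
      + F.coeff2 (monMap a b c d U V q) * (q.1 ^ c * q.2 ^ d * (d * V q + q.2 * pd2 V q)) := by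
  rw [← snd_mul_pd2_monomial a b hU, ← snd_mul_pd2_monomial c d hV]
  simp only [pull2, monMap]
  ring

lemma isHolMapGerm_monMap (hU : AnalyticAt ℂ U 0) (hV : AnalyticAt ℂ V 0)
    (h : a * d ≠ b * c) : IsHolMapGerm (monMap a b c d U V) := by
  refine isHolMapGerm_mk (((analyticAt_fst.pow a).mul (analyticAt_snd.pow b)).mul hU)
    (((analyticAt_fst.pow c).mul (analyticAt_snd.pow d)).mul hV) ?_ ?_
  · have : a ≠ 0 ∨ b ≠ 0 := by
      by_contra! h0; simp [h0] at h
    rcases this with h0 | h0 <;> simp [h0]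
  · have : c ≠ 0 ∨ d ≠ 0 := by
      by_contra! h0; simp [h0] at h
    rcases this with h0 | h0 <;> simp [h0]

lemma jac_monMap_ne_zero (hU : AnalyticAt ℂ U 0) (hV : AnalyticAt ℂ V 0) (hU0 : U 0 ≠ 0)
    (hV0 : V 0 ≠ 0) (h : a * d ≠ b * c) :
    ∀ᶠ q : ℂ × ℂ in 𝓝 0, q.1 ≠ 0 ∧ q.2 ≠ 0 →
      jac (monMap a b c d U V) q ≠ 0 ∧ monMap a b c d U V q ≠ 0 := by
  have hK : AnalyticAt ℂ (fun q : ℂ × ℂ =>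
      (a * U q + q.1 * pd1 U q) * (d * V q + q.2 * pd2 V q)
      - (b * U q + q.2 * pd2 U q) * (c * V q + q.1 * pd1 V q)) 0 :=
    (((analyticAt_const.mul hU).add (analyticAt_fst.mul hU.pd1)).mul
      ((analyticAt_const.mul hV).add (analyticAt_snd.mul hV.pd2))).sub
    (((analyticAt_const.mul hU).add (analyticAt_snd.mul hU.pd2)).mul
      ((analyticAt_const.mul hV).add (analyticAt_fst.mul hV.pd1)))
  have hne := hK.continuousAt.eventually_ne (y := 0) (by
    simp only [Prod.fst_zero, Prod.snd_zero, zero_mul, add_zero]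
    have h' : (a * d : ℂ) - b * c ≠ 0 := by
      rw [sub_ne_zero]; exact_mod_cast h
    intro h0
    refine mul_ne_zero h' (mul_ne_zero hU0 hV0) ?_
    linear_combination h0)
  filter_upwards [hne, hU.eventually_analyticAt, hV.eventually_analyticAt,
    hU.continuousAt.eventually_ne hU0] with q h1 h2 h3 h4 h0
  obtain ⟨h01, h02⟩ := h0
  constructor
  · intro h5
    have e1 := fst_mul_pd1_monomial a b h2.differentiableAt
    have e2 := fst_mul_pd1_monomial c d h3.differentiableAt
    have e3 := snd_mul_pd2_monomial a b h2.differentiableAt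
    have e4 := snd_mul_pd2_monomial c d h3.differentiableAt
    simp only [jac, monMap] at h5
    refine mul_ne_zero (mul_ne_zero (mul_ne_zero (pow_ne_zero a h01) (pow_ne_zero b h02))
      (mul_ne_zero (pow_ne_zero c h01) (pow_ne_zero d h02))) h1 ?_
    have e5 : ∀ x1 x2 y1 y2 : ℂ, x1 * y2 - x2 * y1 = 0 →
      (q.1 * x1) * (q.2 * y2) - (q.2 * x2) * (q.1 * y1) = 0 := by
      intro x1 x2 y1 y2 h
      linear_combination q.1 * q.2 * h
    have e6 := e5 _ _ _ _ h5
    rw [e1, e2, e3, e4] at e6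
    linear_combination e6
  · intro h5
    have := congrArg Prod.fst h5
    simp [monMap, h01, h02, h4] at this

lemma dominant_monMap (hU : AnalyticAt ℂ U 0) (hV : AnalyticAt ℂ V 0) (hU0 : U 0 ≠ 0)
    (hV0 : V 0 ≠ 0) (h : a * d ≠ b * c) : Dominant (monMap a b c d U V) := by
  refine Dominant.of_jac (isHolMapGerm_monMap hU hV h) ?_
  exact (frequently_fst_mul_snd_ne_zero.and_eventually (jac_monMap_ne_zero hU hV hU0 hV0 h)).mono
    fun q hq => (hq.2 ⟨left_ne_zero_of_mul hq.1, right_ne_zero_of_mul hq.1⟩).1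

/-- The pullback of a regular foliation, transversal to the second axis, whose form divides to
`A dx + B dy` with `B y = x N` for a monomial multiple `N`. -/
lemma simpleAfter_monMap_of_transversalSnd {G : FoliationGerm} (hU : AnalyticAt ℂ U 0)
    (hV : AnalyticAt ℂ V 0) (hU0 : U 0 ≠ 0) (h : a * d ≠ b * c) (hA : G.coeff1 0 ≠ 0)
    {e f : ℕ} {N : ℂ × ℂ → ℂ} (hN : AnalyticAt ℂ N 0) (ha : a = 0 → 1 ≤ e) (hb : b = 0 → 1 ≤ f)
    (hef : e ≠ 0 ∨ f ≠ 0)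
    (hNe : ∀ᶠ q in 𝓝 0, G.coeff2 (monMap a b c d U V q) * (q.1 ^ c * q.2 ^ d)
      = q.1 ^ a * q.2 ^ b * (q.1 ^ e * q.2 ^ f * N q)) : SimpleAfter G (monMap a b c d U V) := by
  have hφ := isHolMapGerm_monMap (a := a) (b := b) (c := c) (d := d) hU hV h
  have hAφ := hφ.comp_analyticAt G.analyticAt_coeff1
  have hφ0 := hφ.2
  generalize hφe : monMap a b c d U V = φ at hφ hAφ hφ0 hNe
  have hp1 : ∀ᶠ q in 𝓝 0, q.1 * G.pull1 φ q = q.1 ^ a * q.2 ^ b *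
      (G.coeff1 (φ q) * (a * U q + q.1 * pd1 U q)
        + q.1 ^ e * q.2 ^ f * N q * (c * V q + q.1 * pd1 V q)) := by
    filter_upwards [hU.eventually_analyticAt, hV.eventually_analyticAt, hNe] with q h1 h2 h3
    have := fst_mul_pull1_monMap (a := a) (b := b) (c := c) (d := d) G h1.differentiableAt
      h2.differentiableAt
    rw [hφe] at this
    rw [this]
    linear_combination (c * V q + q.1 * pd1 V q) * h3
  have hp2 : ∀ᶠ q in 𝓝 0, q.2 * G.pull2 φ q = q.1 ^ a * q.2 ^ b *
      (G.coeff1 (φ q) * (b * U q + q.2 * pd2 U q)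
        + q.1 ^ e * q.2 ^ f * N q * (d * V q + q.2 * pd2 V q)) := by
    filter_upwards [hU.eventually_analyticAt, hV.eventually_analyticAt, hNe] with q h1 h2 h3
    have := snd_mul_pull2_monMap (a := a) (b := b) (c := c) (d := d) G h1.differentiableAt
      h2.differentiableAt
    rw [hφe] at this
    rw [this]
    linear_combination (d * V q + q.2 * pd2 V q) * h3
  have hmon : (0 : ℂ) ^ e * 0 ^ f = 0 := by
    rcases hef with h | h <;> simp [h]
  have hUt := (analyticAt_const (v := (a : ℂ)).mul hU).add (analyticAt_fst.mul hU.pd1)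
  have hUy := (analyticAt_const (v := (b : ℂ)).mul hU).add (analyticAt_snd.mul hU.pd2)
  have hVt := (analyticAt_const (v := (c : ℂ)).mul hV).add (analyticAt_fst.mul hV.pd1)
  have hVy := (analyticAt_const (v := (d : ℂ)).mul hV).add (analyticAt_snd.mul hV.pd2)
  have hAU : ∀ n : ℕ, n ≠ 0 → G.coeff1 0 * (n * U 0) ≠ 0 := fun n hn =>
    mul_ne_zero hA (mul_ne_zero (by exact_mod_cast hn) hU0)
  have hmf : ∀ n : ℕ, ∃ᶠ q : ℂ × ℂ in 𝓝 0, q.1 ^ n ≠ 0 := fun n =>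
    frequently_fst_ne_zero.mono fun q hq => pow_ne_zero _ hq
  have hms : ∀ n : ℕ, ∃ᶠ q : ℂ × ℂ in 𝓝 0, q.2 ^ n ≠ 0 := fun n =>
    frequently_snd_ne_zero.mono fun q hq => pow_ne_zero _ hq
  rcases Nat.eq_zero_or_pos a with rfl | ha0
  · -- the first axis is not mapped into the first axis
    have hb0 : b ≠ 0 := by rintro rfl; simp at h
    have he := ha rfl
    refine simpleAfter_of_regular (m := fun q => q.2 ^ (b - 1))
      (H1 := fun q => q.2 * (G.coeff1 (φ q) * pd1 U q
        + q.1 ^ (e - 1) * q.2 ^ f * N q * (c * V q + q.1 * pd1 V q)))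
      (H2 := fun q => G.coeff1 (φ q) * (b * U q + q.2 * pd2 U q)
        + q.1 ^ e * q.2 ^ f * N q * (d * V q + q.2 * pd2 V q)) hφ (analyticAt_snd.pow _) (hms _)
      ?_ ?_ ?_ ?_ (Or.inr ?_)
    · exact analyticAt_snd.mul ((hAφ.mul hU.pd1).add
        ((((analyticAt_fst.pow _).mul (analyticAt_snd.pow _)).mul hN).mul hVt))
    · exact (hAφ.mul hUy).add ((((analyticAt_fst.pow _).mul (analyticAt_snd.pow _)).mul hN).mul hVy)
    · filter_upwards [hp1] with q h1 h2 h3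
      have e4 : q.1 ^ e = q.1 * q.1 ^ (e - 1) := by rw [← pow_succ', Nat.sub_add_cancel he]
      have e5 : q.2 ^ b = q.2 * q.2 ^ (b - 1) := by
        rw [← pow_succ', Nat.sub_add_cancel (Nat.pos_of_ne_zero hb0)]
      rw [e4, e5] at h1
      refine mul_left_cancel₀ h2 (h1.trans ?_)
      simp only [pow_zero, Nat.cast_zero]; ring
    · filter_upwards [hp2] with q h1 h2 h3
      have e5 : q.2 ^ b = q.2 * q.2 ^ (b - 1) := by
        rw [← pow_succ', Nat.sub_add_cancel (Nat.pos_of_ne_zero hb0)]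
      rw [e5] at h1
      refine mul_left_cancel₀ h3 (h1.trans ?_)
      simp only [pow_zero]; ring
    · simp only [hφ0, Prod.fst_zero, Prod.snd_zero, zero_mul, add_zero, hmon]
      exact hAU b hb0
  rcases Nat.eq_zero_or_pos b with rfl | hb0
  · have hf := hb rfl
    refine simpleAfter_of_regular (m := fun q => q.1 ^ (a - 1))
      (H1 := fun q => G.coeff1 (φ q) * (a * U q + q.1 * pd1 U q)
        + q.1 ^ e * q.2 ^ f * N q * (c * V q + q.1 * pd1 V q))
      (H2 := fun q => q.1 * (G.coeff1 (φ q) * pd2 U q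
        + q.1 ^ e * q.2 ^ (f - 1) * N q * (d * V q + q.2 * pd2 V q)))
      hφ (analyticAt_fst.pow _) (hmf _) ?_ ?_ ?_ ?_ (Or.inl ?_)
    · exact (hAφ.mul hUt).add ((((analyticAt_fst.pow _).mul (analyticAt_snd.pow _)).mul hN).mul hVt)
    · exact analyticAt_fst.mul ((hAφ.mul hU.pd2).add
        ((((analyticAt_fst.pow _).mul (analyticAt_snd.pow _)).mul hN).mul hVy))
    · filter_upwards [hp1] with q h1 h2 h3
      have e5 : q.1 ^ a = q.1 * q.1 ^ (a - 1) := by rw [← pow_succ', Nat.sub_add_cancel ha0]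
      rw [e5] at h1
      refine mul_left_cancel₀ h2 (h1.trans ?_)
      simp only [pow_zero]; ring
    · filter_upwards [hp2] with q h1 h2 h3
      have e4 : q.2 ^ f = q.2 * q.2 ^ (f - 1) := by rw [← pow_succ', Nat.sub_add_cancel hf]
      have e5 : q.1 ^ a = q.1 * q.1 ^ (a - 1) := by rw [← pow_succ', Nat.sub_add_cancel ha0]
      rw [e4, e5] at h1
      refine mul_left_cancel₀ h3 (h1.trans ?_)
      simp only [pow_zero, Nat.cast_zero]; ring
    · simp only [hφ0, Prod.fst_zero, Prod.snd_zero, zero_mul, add_zero, hmon]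
      exact hAU a ha0.ne'
  -- Both axes are critical: the form is a monomial times `y K1 dt + t K2 dy`, where `K1(0) : K2(0)
  -- = a : b`. As for the level curves of `t ^ a y ^ b`, the eigenvalue ratio is a negative
  -- rational.
  let K1 : ℂ × ℂ → ℂ := fun q => G.coeff1 (φ q) * (a * U q + q.1 * pd1 U q)
        + q.1 ^ e * q.2 ^ f * N q * (c * V q + q.1 * pd1 V q)
  let K2 : ℂ × ℂ → ℂ := fun q => G.coeff1 (φ q) * (b * U q + q.2 * pd2 U q)
        + q.1 ^ e * q.2 ^ f * N q * (d * V q + q.2 * pd2 V q)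
  have hK1 : AnalyticAt ℂ K1 0 := (hAφ.mul hUt).add
    ((((analyticAt_fst.pow _).mul (analyticAt_snd.pow _)).mul hN).mul hVt)
  have hK2 : AnalyticAt ℂ K2 0 := (hAφ.mul hUy).add
    ((((analyticAt_fst.pow _).mul (analyticAt_snd.pow _)).mul hN).mul hVy)
  have hK10 : K1 0 = G.coeff1 0 * (a * U 0) := by simp [K1, hφ0, hmon]
  have hK20 : K2 0 = G.coeff1 0 * (b * U 0) := by simp [K2, hφ0, hmon]
  have hd1 : pd2 (fun q => q.2 * K1 q) 0 = K1 0 := pd2_snd_mul_zero hK1 (by simp)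
  have hd2 : pd1 (fun q => q.1 * K2 q) 0 = K2 0 := pd1_fst_mul_zero hK2 (by simp)
  have hd3 : pd2 (fun q => q.1 * K2 q) 0 = 0 := pd2_fst_mul_zero hK2 (by simp)
  have hH1 : AnalyticAt ℂ (fun q => q.2 * K1 q) 0 := analyticAt_snd.mul hK1
  have hH2 : AnalyticAt ℂ (fun q => q.1 * K2 q) 0 := analyticAt_fst.mul hK2
  refine simpleAfter_of_simple (m := fun q => q.1 ^ (a - 1) * q.2 ^ (b - 1))
    hφ ((analyticAt_fst.pow _).mul (analyticAt_snd.pow _))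
    (frequently_mul_ne_zero (analyticAt_fst.pow _) (analyticAt_snd.pow _) (hmf _) (hms _))
    hH1 hH2 ?_ ?_ (isolated_of_eigenvalues_ne hH1 hH2 hd3
      (by rw [hd2, hK20]; exact hAU b hb0.ne') (by rw [hd1, hK10]; exact hAU a ha0.ne'))
    (by simp) (by simp) hd3 ?_
  · filter_upwards [hp1] with q h1 h2 h3
    have e4 : q.1 ^ a = q.1 * q.1 ^ (a - 1) := by rw [← pow_succ', Nat.sub_add_cancel ha0]
    have e5 : q.2 ^ b = q.2 * q.2 ^ (b - 1) := by rw [← pow_succ', Nat.sub_add_cancel hb0]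
    rw [e4, e5] at h1
    refine mul_left_cancel₀ h2 (h1.trans ?_)
    simp only [K1]; ring
  · filter_upwards [hp2] with q h1 h2 h3
    have e4 : q.1 ^ a = q.1 * q.1 ^ (a - 1) := by rw [← pow_succ', Nat.sub_add_cancel ha0]
    have e5 : q.2 ^ b = q.2 * q.2 ^ (b - 1) := by rw [← pow_succ', Nat.sub_add_cancel hb0]
    rw [e4, e5] at h1
    refine mul_left_cancel₀ h3 (h1.trans ?_)
    simp only [K2]; ring
  · intro p q hp hq h0
    rw [hd1, hd2, hK10, hK20] at h0
    refine hAU (p * b + q * a) (by positivity) ?_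
    push_cast
    linear_combination h0

/-- Along a curve germ `ψ`, the combination `a A + c B` of the quotients by the coordinates of the
coefficients of a simple singularity does not vanish. -/
lemma combination_ne_zero {G : FoliationGerm} {A B : ℂ × ℂ → ℂ} (hA : AnalyticAt ℂ A 0)
    (hB : AnalyticAt ℂ B 0) (hAe : ∀ᶠ q in 𝓝 0, G.coeff1 q = q.2 * A q)
    (hBe : ∀ᶠ q in 𝓝 0, G.coeff2 q = q.1 * B q)
    (hs : ∀ p q : ℕ, 0 < p → 0 < q → p * B 0 + q * A 0 ≠ 0)
    {ψ : ℂ → ℂ × ℂ} (hψ : Tendsto ψ (𝓝 0) (𝓝 0)) (hac : a ≠ 0 ∨ c ≠ 0)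
    (hc : c = 0 → ∀ᶠ y in 𝓝 0, y ≠ 0 → (ψ y).1 = 0 ∧ (ψ y).2 ≠ 0)
    (ha : a = 0 → ∀ᶠ y in 𝓝 0, y ≠ 0 → (ψ y).2 = 0 ∧ (ψ y).1 ≠ 0) :
    ∀ᶠ y in 𝓝 0, y ≠ 0 → a * A (ψ y) + c * B (ψ y) ≠ 0 := by
  -- When one exponent is zero the other coefficient may vanish at the origin. The curve then lies
  -- in an axis, off whose origin `G` has no zero. With both exponents positive, simplicity
  -- suffices.
  rcases Nat.eq_zero_or_pos c with rfl | hc0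
  · have ha' : (a : ℂ) ≠ 0 := by simpa using hac
    filter_upwards [hc rfl, hψ.eventually hAe, hψ.eventually hBe, hψ.eventually G.isolated_coeff]
      with y h1 h2 h3 h4 hy
    obtain ⟨h5, h6⟩ := h1 hy
    have h7 := h4 fun h => h6 (by rw [h]; rfl)
    rw [h2, h3, h5] at h7
    simp only [zero_mul, ne_eq, not_true_eq_false, or_false] at h7
    simpa [ha'] using right_ne_zero_of_mul h7
  rcases Nat.eq_zero_or_pos a with rfl | ha0
  · filter_upwards [ha rfl, hψ.eventually hAe, hψ.eventually hBe, hψ.eventually G.isolated_coeff]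
      with y h1 h2 h3 h4 hy
    obtain ⟨h5, h6⟩ := h1 hy
    have h7 := h4 fun h => h6 (by rw [h]; rfl)
    rw [h2, h3, h5] at h7
    simp only [zero_mul, ne_eq, not_true_eq_false, false_or] at h7
    simpa [hc0.ne'] using right_ne_zero_of_mul h7
  · have hcont : AnalyticAt ℂ (fun q => a * A q + c * B q) 0 :=
      (analyticAt_const.mul hA).add (analyticAt_const.mul hB)
    have := hcont.continuousAt.eventually_ne (y := 0) (by
      have := hs c a hc0 ha0
      rwa [add_comm] at this)
    exact (hψ.eventually this).mono fun y h _ => h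

/-- Simple singularities for which both axes are marked. -/
lemma simpleAfter_monMap_of_simple {G : FoliationGerm} (hU : AnalyticAt ℂ U 0)
    (hV : AnalyticAt ℂ V 0) (hU0 : U 0 ≠ 0) (hV0 : V 0 ≠ 0) (h : a * d ≠ b * c)
    (hG1 : G.InvariantFst) (hG2 : G.InvariantSnd) (hs : G.IsSimpleSingularity) :
    SimpleAfter G (monMap a b c d U V) := by
  obtain ⟨B, hB, hBe⟩ := hG1.exists_eq
  obtain ⟨A, hA, hAe⟩ := hG2.exists_eq
  rw [isSimpleSingularity_iff _ (by rw [pd2_fst_mul_zero hB hBe, mul_zero])] at hs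
  obtain ⟨-, -, hs⟩ := hs
  rw [pd1_fst_mul_zero hB hBe, pd2_snd_mul_zero hA hAe] at hs
  have hac : a ≠ 0 ∨ c ≠ 0 := by by_contra! h0; simp [h0] at h
  have hbd : b ≠ 0 ∨ d ≠ 0 := by by_contra! h0; simp [h0] at h
  have hφ := isHolMapGerm_monMap (a := a) (b := b) (c := c) (d := d) hU hV h
  have hAφ := hφ.comp_analyticAt hA
  have hBφ := hφ.comp_analyticAt hB
  let K1 : ℂ × ℂ → ℂ := fun q => V q * A (monMap a b c d U V q) * (a * U q + q.1 * pd1 U q)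
        + U q * B (monMap a b c d U V q) * (c * V q + q.1 * pd1 V q)
  let K2 : ℂ × ℂ → ℂ := fun q => V q * A (monMap a b c d U V q) * (b * U q + q.2 * pd2 U q)
        + U q * B (monMap a b c d U V q) * (d * V q + q.2 * pd2 V q)
  have hK1 : AnalyticAt ℂ K1 0 := ((hV.mul hAφ).mul ((analyticAt_const.mul hU).add
    (analyticAt_fst.mul hU.pd1))).add ((hU.mul hBφ).mul ((analyticAt_const.mul hV).add
      (analyticAt_fst.mul hV.pd1)))
  have hK2 : AnalyticAt ℂ K2 0 := ((hV.mul hAφ).mul ((analyticAt_const.mul hU).add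
    (analyticAt_snd.mul hU.pd2))).add ((hU.mul hBφ).mul ((analyticAt_const.mul hV).add
      (analyticAt_snd.mul hV.pd2)))
  have hm : AnalyticAt ℂ (fun q : ℂ × ℂ => q.1 ^ (a + c - 1) * q.2 ^ (b + d - 1)) 0 :=
    (analyticAt_fst.pow _).mul (analyticAt_snd.pow _)
  have hm0 : ∃ᶠ q : ℂ × ℂ in 𝓝 0, q.1 ^ (a + c - 1) * q.2 ^ (b + d - 1) ≠ 0 :=
    frequently_mul_ne_zero (analyticAt_fst.pow _) (analyticAt_snd.pow _)
      (frequently_fst_ne_zero.mono fun q hq => pow_ne_zero _ hq)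
      (frequently_snd_ne_zero.mono fun q hq => pow_ne_zero _ hq)
  have mon : ∀ q : ℂ × ℂ, q.1 ^ a * q.2 ^ b * (q.1 ^ c * q.2 ^ d)
      = q.1 * q.2 * (q.1 ^ (a + c - 1) * q.2 ^ (b + d - 1)) := by
    intro q
    have e4 : q.1 ^ a * q.1 ^ c = q.1 * q.1 ^ (a + c - 1) := by
      rw [← pow_succ', ← pow_add]; congr 1; omega
    have e5 : q.2 ^ b * q.2 ^ d = q.2 * q.2 ^ (b + d - 1) := by
      rw [← pow_succ', ← pow_add]; congr 1; omega
    linear_combination q.2 ^ b * q.2 ^ d * e4 + q.1 * q.1 ^ (a + c - 1) * e5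
  have e1 : ∀ᶠ q in 𝓝 0, q.1 ≠ 0 → q.2 ≠ 0 → G.pull1 (monMap a b c d U V) q
      = q.1 ^ (a + c - 1) * q.2 ^ (b + d - 1) * (q.2 * K1 q) := by
    filter_upwards [hU.eventually_analyticAt, hV.eventually_analyticAt,
      hφ.tendsto.eventually hAe, hφ.tendsto.eventually hBe] with q h1 h2 h3 h4 h5 _
    have e := fst_mul_pull1_monMap (a := a) (b := b) (c := c) (d := d) G h1.differentiableAt
      h2.differentiableAt
    rw [h3, h4] at e
    refine mul_left_cancel₀ h5 (e.trans ?_)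
    have e6 : (monMap a b c d U V q).1 = q.1 ^ a * q.2 ^ b * U q := rfl
    have e7 : (monMap a b c d U V q).2 = q.1 ^ c * q.2 ^ d * V q := rfl
    rw [e6, e7]
    linear_combination K1 q * mon q
  have e2 : ∀ᶠ q in 𝓝 0, q.1 ≠ 0 → q.2 ≠ 0 → G.pull2 (monMap a b c d U V) q
      = q.1 ^ (a + c - 1) * q.2 ^ (b + d - 1) * (q.1 * K2 q) := by
    filter_upwards [hU.eventually_analyticAt, hV.eventually_analyticAt,
      hφ.tendsto.eventually hAe, hφ.tendsto.eventually hBe] with q h1 h2 h3 h4 _ h5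
    have e := snd_mul_pull2_monMap (a := a) (b := b) (c := c) (d := d) G h1.differentiableAt
      h2.differentiableAt
    rw [h3, h4] at e
    refine mul_left_cancel₀ h5 (e.trans ?_)
    have e6 : (monMap a b c d U V q).1 = q.1 ^ a * q.2 ^ b * U q := rfl
    have e7 : (monMap a b c d U V q).2 = q.1 ^ c * q.2 ^ d * V q := rfl
    rw [e6, e7]
    linear_combination K2 q * mon q
  have hH1 : AnalyticAt ℂ (fun q => q.2 * K1 q) 0 := analyticAt_snd.mul hK1
  have hH2 : AnalyticAt ℂ (fun q => q.1 * K2 q) 0 := analyticAt_fst.mul hK2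
  have hd1 : pd2 (fun q => q.2 * K1 q) 0 = K1 0 := pd2_snd_mul_zero hK1 (by simp)
  have hd2 : pd1 (fun q => q.1 * K2 q) 0 = K2 0 := pd1_fst_mul_zero hK2 (by simp)
  have hd3 : pd2 (fun q => q.1 * K2 q) 0 = 0 := pd2_fst_mul_zero hK2 (by simp)
  refine simpleAfter_of_simple hφ hm hm0 hH1 hH2 e1 e2 ?_ (by simp) (by simp) hd3 ?_
  -- Isolatedness has three parts: off the axes by the Jacobian, and on each axis by
  -- `combination_ne_zero` along its image.
  · have hoff := coeff_ne_zero_of_jac hφ hm hH1 hH2 e1 e2 (jac_monMap_ne_zero hU hV hU0 hV0 h)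
    have hcurve : ∀ {ι : ℂ → ℂ × ℂ}, Tendsto ι (𝓝 0) (𝓝 0) → 
        Tendsto (fun y => monMap a b c d U V (ι y)) (𝓝 0) (𝓝 0) := fun h => hφ.tendsto.comp h
    have hUne := hU.continuousAt.eventually_ne hU0
    have hVne := hV.continuousAt.eventually_ne hV0
    have c1 := combination_ne_zero (a := a) (c := c) hA hB hAe hBe hs (hcurve tendsto_inr_zero) hac
      (by
        rintro rfl
        have ha : a ≠ 0 := by simpa using hac
        filter_upwards [tendsto_inr_zero.eventually hVne] with y hy h0
        simp [monMap, ha, hy, h0])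
      (by
        rintro rfl
        have hc : c ≠ 0 := by simpa using hac
        filter_upwards [tendsto_inr_zero.eventually hUne] with y hy h0
        simp [monMap, hc, hy, h0])
    have c2 := combination_ne_zero (a := b) (c := d) hA hB hAe hBe hs (hcurve tendsto_inl_zero) hbd
      (by
        rintro rfl
        have hb : b ≠ 0 := by simpa using hbd
        filter_upwards [tendsto_inl_zero.eventually hVne] with y hy h0
        simp [monMap, hb, hy, h0])
      (by
        rintro rfl
        have hd : d ≠ 0 := by simpa using hbd
        filter_upwards [tendsto_inl_zero.eventually hUne] with y hy h0
        simp [monMap, hd, hy, h0])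
    filter_upwards [hoff, hUne, hVne, tendsto_snd_zero.eventually c1,
      tendsto_fst_zero.eventually c2] with q g1 g2 g3 g4 g5 hq
    by_cases hq1 : q.1 = 0
    · have hq2 : q.2 ≠ 0 := fun h => hq (Prod.ext hq1 h)
      left
      have hqe : q = (0, q.2) := Prod.ext hq1 rfl
      rw [← hqe] at g4
      intro h0
      refine mul_ne_zero (mul_ne_zero hq2 (mul_ne_zero g2 g3)) (g4 hq2) ?_
      simp only [K1, hq1] at h0
      linear_combination h0
    · by_cases hq2 : q.2 = 0
      · right
        have hqe : q = (q.1, 0) := Prod.ext rfl hq2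
        rw [← hqe] at g5
        intro h0
        refine mul_ne_zero (mul_ne_zero hq1 (mul_ne_zero g2 g3)) (g5 hq1) ?_
        simp only [K2, hq2] at h0
        linear_combination h0
      · exact g1 ⟨hq1, hq2⟩
  · intro p q hp hq
    have hK10 : K1 0 = U 0 * V 0 * (a * A 0 + c * B 0) := by
      simp only [K1, hφ.2, Prod.fst_zero]; ring
    have hK20 : K2 0 = U 0 * V 0 * (b * A 0 + d * B 0) := by
      simp only [K2, hφ.2, Prod.snd_zero]; ring
    have pos : ∀ {i j k l : ℕ}, i ≠ 0 ∨ j ≠ 0 → 0 < k → 0 < l → 0 < k * i + l * j := by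
      intro i j k l hij hk hl
      rcases hij with h | h
      · have := Nat.mul_pos hk (Nat.pos_of_ne_zero h); omega
      · have := Nat.mul_pos hl (Nat.pos_of_ne_zero h); omega
    have hda : d ≠ 0 ∨ c ≠ 0 := by by_contra! h0; simp [h0] at h
    have hba : b ≠ 0 ∨ a ≠ 0 := by by_contra! h0; simp [h0] at h
    -- The determinant being nonzero, no pair of exponents belonging to one component vanishes, so
    -- both integer weights are positive.
    have := hs (p * d + q * c) (p * b + q * a) (pos hda hp hq) (pos hba hp hq)
    rw [hd1, hd2, hK10, hK20]
    intro h0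
    refine mul_ne_zero (mul_ne_zero hU0 hV0) this ?_
    push_cast
    linear_combination h0

/-- A monomial germ at a corner, with both axes marked. -/
lemma Adapted.simpleAfter_monMap {G : FoliationGerm} (hG : Adapted True True G)
    (hU : AnalyticAt ℂ U 0) (hV : AnalyticAt ℂ V 0) (hU0 : U 0 ≠ 0) (hV0 : V 0 ≠ 0)
    (h : a * d ≠ b * c) (hsep : (a ≤ c ∧ b ≤ d) ∨ (c ≤ a ∧ d ≤ b)) :
    SimpleAfter G (monMap a b c d U V) := by
  have hsw : SimpleAfter G.swap (monMap c d a b V U) → SimpleAfter G (monMap a b c d U V) :=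
    fun h' => h'.of_swap (isHolMapGerm_monMap hV hU (by rw [mul_comm c, mul_comm d]; exact h.symm))
      (dominant_monMap hV hU hV0 hU0 (by rw [mul_comm c, mul_comm d]; exact h.symm))
  -- Invariance of `x = 0` puts a factor `x = t ^ a y ^ b U` into the second coefficient, so the
  -- leftover monomial is all of `t ^ c y ^ d`.
  have inv : ∀ {G : FoliationGerm} {a b c d : ℕ} {U V : ℂ × ℂ → ℂ}, G.IsRegular →
      G.InvariantFst → AnalyticAt ℂ U 0 → AnalyticAt ℂ V 0 → U 0 ≠ 0 → a * d ≠ b * c →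
      SimpleAfter G (monMap a b c d U V) := by
    intro G a b c d U V h1 h2 hU hV hU0 h
    obtain ⟨B, hB, hBe⟩ := h2.exists_eq
    have h3 : G.coeff2 0 = 0 := h2.self_of_nhds
    have hφ := isHolMapGerm_monMap (a := a) (b := b) (c := c) (d := d) hU hV h
    rw [isRegular_iff] at h1
    refine simpleAfter_monMap_of_transversalSnd hU hV hU0 h (by tauto) (e := c) (f := d)
      (hU.mul (hφ.comp_analyticAt hB)) ?_ ?_ ?_ ?_
    · rintro rfl; by_contra h0; simp [show c = 0 by omega] at h
    · rintro rfl; by_contra h0; simp [show d = 0 by omega] at h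
    · by_contra! h0; simp [h0] at h
    · filter_upwards [hφ.tendsto.eventually hBe] with q h4
      rw [h4]
      simp only [monMap, Pi.mul_apply]; ring
  -- Here the second monomial must be divisible by the first; this is where comparability of the
  -- exponents is needed.
  have trans : ∀ {G : FoliationGerm} {a b c d : ℕ} {U V : ℂ × ℂ → ℂ}, G.TransversalSnd →
      AnalyticAt ℂ U 0 → AnalyticAt ℂ V 0 → U 0 ≠ 0 → a * d ≠ b * c → a ≤ c → b ≤ d →
      SimpleAfter G (monMap a b c d U V) := by
    intro G a b c d U V h1 hU hV hU0 h hac hbd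
    have hφ := isHolMapGerm_monMap (a := a) (b := b) (c := c) (d := d) hU hV h
    refine simpleAfter_monMap_of_transversalSnd hU hV hU0 h h1 (e := c - a) (f := d - b)
      (hφ.comp_analyticAt G.analyticAt_coeff2) ?_ ?_ ?_ ?_
    · rintro rfl; by_contra h0; simp [show c = 0 by omega] at h
    · rintro rfl; by_contra h0; simp [show d = 0 by omega] at h
    · by_contra! h0
      have h1 : a = c := by omega
      have h2 : b = d := by omega
      subst h1 h2
      exact h (mul_comm _ _)
    · refine Eventually.of_forall fun q => ?_
      have e4 : q.1 ^ c = q.1 ^ a * q.1 ^ (c - a) := by rw [← pow_add]; congr 1; omega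
      have e5 : q.2 ^ d = q.2 ^ b * q.2 ^ (d - b) := by rw [← pow_add]; congr 1; omega
      have e6 : (q.1 ^ a * q.1 ^ (c - a)) * (q.2 ^ b * q.2 ^ (d - b)) = q.1 ^ c * q.2 ^ d := by
        rw [← e4, ← e5]
      linear_combination - G.coeff2 (monMap a b c d U V q) * e6
  have h' : c * b ≠ d * a := by rw [mul_comm c, mul_comm d]; exact h.symm
  rcases hG with ⟨h1, h2, h3⟩ | ⟨h1, h2, h3⟩
  · rcases h2 trivial with h4 | h4
    · exact inv h1 h4 hU hV hU0 h
    rcases h3 trivial with h5 | h5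
    · refine hsw (inv ?_ ?_ hV hU hV0 h')
      · rw [isRegular_iff] at h1 ⊢
        rw [G.coeff1_swap, G.coeff2_swap]; exact h1.symm
      · refine Eventually.mono h5 fun v hv => ?_
        show G.swap.coeff2 (0, v) = 0
        rw [G.coeff2_swap]; exact hv
    rcases hsep with h6 | h6
    · exact trans h5 hU hV hU0 h h6.1 h6.2
    · refine hsw (trans ?_ hV hU hV0 h' h6.1 h6.2)
      show G.swap.coeff1 0 ≠ 0
      rw [G.coeff1_swap]; exact h4
  · exact simpleAfter_monMap_of_simple hU hV hU0 hV0 h (h2 trivial) (h3 trivial) h1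

end

/-! ### Trees of centres with adapted foliations -/

/-- The axes at an infinitely near point that are marked when the marked axes at the origin are
given by `e1` and `e2`, and exceptional divisors are marked. -/
def flags (e1 e2 : Prop) : InfNearPoint → Prop × Prop
  | .origin => (e1, e2)
  | .above p none => ((flags e1 e2 p).1, True)
  | .above p (some c) => (True, c = 0 ∧ (flags e1 e2 p).2)

lemma flags_prepend_infty (e1 e2 : Prop) (p : InfNearPoint) :
    flags e1 e2 (p.prepend OnePoint.infty) = flags e1 True p := by
  induction p with
  | origin => rfl
  | above p d ih =>
    rcases d with _ | c <;> simp only [InfNearPoint.prepend, flags, ih]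

lemma flags_prepend_some (e1 e2 : Prop) (c : ℂ) (p : InfNearPoint) :
    flags e1 e2 (p.prepend (OnePoint.some c)) = flags True (c = 0 ∧ e2) p := by
  induction p with
  | origin => rfl
  | above p d ih =>
    rcases d with _ | c <;> simp only [InfNearPoint.prepend, flags, ih]

/-- The number of blowing-ups that lead to an infinitely near point. -/
def InfNearPoint.depth : InfNearPoint → ℕ
  | .origin => 0
  | .above p _ => p.depth + 1

lemma InfNearPoint.depth_prepend (d : OnePoint ℂ) (p : InfNearPoint) :
    (p.prepend d).depth = p.depth + 1 := by
  induction p with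
  | origin => rfl
  | above p e ih => simp [InfNearPoint.prepend, depth, ih]

/-- `S` is a finite set of centres over the target of `P`, of height at most `m`, and the pullback
of `F` is adapted to the marked axes at all points that lie over the origin. -/
structure IsAdaptedTree (F : FoliationGerm) (P : ℂ × ℂ → ℂ × ℂ) (S : Set InfNearPoint)
    (e1 e2 : Prop) (m : ℕ) : Prop where
  closed : TreeClosed S
  finite : S.Finite
  height : ∀ p ∈ S, p.depth < m
  analytic : AnalyticAt ℂ P 0
  adapted : ∀ p ∈ ptsS S, ∃ G, IsPullback (P ∘ p.proj) F G ∧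
    Adapted (flags e1 e2 p).1 (flags e1 e2 p).2 G

section
variable {F : FoliationGerm} {P : ℂ × ℂ → ℂ × ℂ} {S : Set InfNearPoint} {e1 e2 : Prop} {m : ℕ}

lemma IsAdaptedTree.origin_notMem (h : IsAdaptedTree F P S e1 e2 0) : .origin ∉ S :=
  fun h0 => absurd (h.height _ h0) (by simp [InfNearPoint.depth])

lemma IsAdaptedTree.analytic_chart (h : IsAdaptedTree F P S e1 e2 m) (d : OnePoint ℂ) :
    AnalyticAt ℂ (P ∘ blowUpChart d) 0 :=
  AnalyticAt.comp (by rw [(isHolMapGerm_blowUpChart d).2]; exact h.analytic)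
    (analyticAt_blowUpChart d 0)

lemma IsAdaptedTree.infty (h : IsAdaptedTree F P S e1 e2 (m + 1)) (h0 : .origin ∈ S) :
    IsAdaptedTree F (P ∘ blowUpChart OnePoint.infty) (sub S OnePoint.infty) e1 True m where
  closed := h.closed.sub _
  finite := finite_sub h.finite _
  height p hp := by
    have := h.height _ hp
    rw [InfNearPoint.depth_prepend] at this
    omega
  analytic := h.analytic_chart _
  adapted p hp := by
    have := h.adapted _ ((prepend_mem_ptsS h0).mpr hp)
    rwa [flags_prepend_infty, InfNearPoint.proj_prepend] at this

lemma IsAdaptedTree.some (h : IsAdaptedTree F P S e1 e2 (m + 1)) (h0 : .origin ∈ S) (c : ℂ) :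
    IsAdaptedTree F (P ∘ blowUpChart (OnePoint.some c)) (sub S (OnePoint.some c)) True
      (c = 0 ∧ e2) m where
  closed := h.closed.sub _
  finite := finite_sub h.finite _
  height p hp := by
    have := h.height _ hp
    rw [InfNearPoint.depth_prepend] at this
    omega
  analytic := h.analytic_chart _
  adapted p hp := by
    have := h.adapted _ ((prepend_mem_ptsS h0).mpr hp)
    rwa [flags_prepend_some, InfNearPoint.proj_prepend] at this

lemma IsAdaptedTree.good_of_leaf (h : IsAdaptedTree F P S e1 e2 m) (h0 : .origin ∉ S)
    {φ : ℂ × ℂ → ℂ × ℂ} (hφ : IsHolMapGerm φ) (hd : Dominant φ)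
    (hG : ∀ G, Adapted e1 e2 G → SimpleAfter G φ) : Good F P φ S := by
  obtain ⟨G, h1, h2⟩ := h.adapted .origin ⟨h0, trivial⟩
  exact Good.of_lifts (liftsS_of_origin_notMem h0 hφ) ((hG G h2).of_comp h.analytic h1 hφ hd)

end

lemma NonLift.congr {φ ψ : ℂ × ℂ → ℂ × ℂ} (e : φ =ᶠ[𝓝 0] ψ) (S : Set InfNearPoint) :
    NonLift φ S = NonLift ψ S := by
  ext p
  have := p.isHolMapGerm_proj.tendsto.eventually e
  exact not_congr ⟨fun h => h.congr this, fun h => h.congr (EventuallyEq.symm this)⟩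

lemma Good.congr {F : FoliationGerm} {P φ ψ : ℂ × ℂ → ℂ × ℂ} {S : Set InfNearPoint}
    (h : Good F P φ S) (e : φ =ᶠ[𝓝 0] ψ) : Good F P ψ S := by
  refine ⟨NonLift.congr e S ▸ h.finite, NonLift.congr e S ▸ h.finiteDirections, fun p hp => ?_⟩
  rw [← NonLift.congr e S] at hp
  refine (h.simple p hp).congr ?_
  filter_upwards [p.isHolMapGerm_proj.tendsto.eventually e] with q hq
  simp [hq]

/-! ### Lifting monomial germs -/

section
variable {a b c d : ℕ} {U V : ℂ × ℂ → ℂ}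

lemma analyticAt_mul_inv (hU : AnalyticAt ℂ U 0) (hV : AnalyticAt ℂ V 0) (hU0 : U 0 ≠ 0) :
    AnalyticAt ℂ (fun q => V q * (U q)⁻¹) 0 := hV.mul (hU.inv hU0)

lemma monMap_eq_chart_zero (hU : AnalyticAt ℂ U 0) (hU0 : U 0 ≠ 0) :
    monMap a b (a + c) (b + d) U V =ᶠ[𝓝 0]
      blowUpChart (OnePoint.some 0) ∘ monMap a b c d U (fun q => V q * (U q)⁻¹) := by
  filter_upwards [hU.continuousAt.eventually_ne hU0] with q hq
  simp only [Function.comp, blowUpChart_some, monMap, pow_add]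
  ext
  · rfl
  · field_simp
    ring

lemma monMap_eq_chart_infty (hV : AnalyticAt ℂ V 0) (hV0 : V 0 ≠ 0) :
    monMap (a + c) (b + d) c d U V =ᶠ[𝓝 0]
      blowUpChart OnePoint.infty ∘ monMap a b c d (fun q => U q * (V q)⁻¹) V := by
  filter_upwards [hV.continuousAt.eventually_ne hV0] with q hq
  simp only [Function.comp, blowUpChart_infty, monMap, pow_add]
  ext
  · field_simp
  · rfl

lemma powMap_eq_chart_zero (hU : AnalyticAt ℂ U 0) (hU0 : U 0 ≠ 0) :
    powMap a (a + b) U V =ᶠ[𝓝 0]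
      blowUpChart (OnePoint.some 0) ∘ powMap a b U (fun q => V q * (U q)⁻¹) := by
  filter_upwards [hU.continuousAt.eventually_ne hU0] with q hq
  simp only [Function.comp, blowUpChart_some, powMap, pow_add]
  ext
  · rfl
  · field_simp
    ring

lemma powMap_eq_chart_infty (hV : AnalyticAt ℂ V 0) (hV0 : V 0 ≠ 0) :
    powMap (a + b) b U V =ᶠ[𝓝 0]
      blowUpChart OnePoint.infty ∘ powMap a b (fun q => U q * (V q)⁻¹) V := by
  filter_upwards [hV.continuousAt.eventually_ne hV0] with q hq
  simp only [Function.comp, blowUpChart_infty, powMap, pow_add]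
  ext
  · field_simp
  · rfl

lemma powMap_eq_chart_some (hU : AnalyticAt ℂ U 0) (hU0 : U 0 ≠ 0) (c : ℂ) :
    powMap a a U V =ᶠ[𝓝 0]
      blowUpChart (OnePoint.some c) ∘ powMap a 0 U (fun q => V q * (U q)⁻¹ + -c) := by
  filter_upwards [hU.continuousAt.eventually_ne hU0] with q hq
  simp only [Function.comp, blowUpChart_some, powMap]
  ext
  · rfl
  · simp only [pow_zero, one_mul, neg_add_cancel_right]
    field_simp

lemma pd2_mul_inv (hU : AnalyticAt ℂ U 0) (hV : AnalyticAt ℂ V 0) (hU0 : U 0 ≠ 0) :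
    pd2 (fun q => V q * (U q)⁻¹) 0 = (pd2 V 0 * U 0 - V 0 * pd2 U 0) / U 0 ^ 2 := by
  rw [pd2_mul (f := V) (g := fun q => (U q)⁻¹) hV.differentiableAt (hU.inv hU0).differentiableAt,
    pd2_inv hU.differentiableAt hU0]
  field_simp
  ring

/-- Nondegeneracy of the germ survives a lift to a chart; the two following lemmas serve the other
charts. -/
lemma powDelta_mul_inv_snd (hU : AnalyticAt ℂ U 0) (hV : AnalyticAt ℂ V 0) (hU0 : U 0 ≠ 0) :
    powDelta a b U (fun q => V q * (U q)⁻¹) = powDelta a (a + b) U V / U 0 := by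
  simp only [powDelta, pd2_mul_inv hU hV hU0]
  push_cast
  field_simp
  ring

lemma powDelta_mul_inv_fst (hU : AnalyticAt ℂ U 0) (hV : AnalyticAt ℂ V 0) (hV0 : V 0 ≠ 0) :
    powDelta a b (fun q => U q * (V q)⁻¹) V = powDelta (a + b) b U V / V 0 := by
  simp only [powDelta, pd2_mul_inv hV hU hV0]
  push_cast
  field_simp
  ring

lemma powDelta_mul_inv_add_const (hU : AnalyticAt ℂ U 0) (hV : AnalyticAt ℂ V 0) (hU0 : U 0 ≠ 0)
    (c : ℂ) : powDelta a 0 U (fun q => V q * (U q)⁻¹ + c) = powDelta a a U V / U 0 := by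
  have : pd2 (fun q => V q * (U q)⁻¹ + c) 0 = pd2 (fun q => V q * (U q)⁻¹) 0 := by
    rw [pd2_add (f := fun q => V q * (U q)⁻¹) (g := fun _ => c)
      (analyticAt_mul_inv hU hV hU0).differentiableAt (by fun_prop)]
    simp
  simp only [powDelta, this, pd2_mul_inv hU hV hU0]
  push_cast
  field_simp
  ring

end

/-- The slopes of the rays spanned by the exponents `(a, c)` and `(b, d)` are not separated by the
slope of any divisor that is created by at most `m` blowing-ups. -/
def Unseparated (m a b c d : ℕ) : Prop :=
  ∀ p q : ℕ, p + q ≤ 2 ^ (m + 1) → (p * c ≤ q * a ∧ p * d ≤ q * b) ∨ (q * a ≤ p * c ∧ q * b ≤ p * d)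

/-- The ray `(1, 1)` belongs to the divisor of a single blowing-up. The exponent `m + 1` in the
bound makes it available already for `m = 0`, where the leaves need it. -/
lemma Unseparated.le {m a b c d : ℕ} (h : Unseparated m a b c d) :
    (a ≤ c ∧ b ≤ d) ∨ (c ≤ a ∧ d ≤ b) := by
  have := h 1 1 (by rw [pow_succ]; have := Nat.one_le_two_pow (n := m); omega)
  simp only [one_mul] at this
  exact this.symm

/-- The ray `(p, q)` of the chart is the ray `(p, p + q)` below, and the sum of its entries at most
doubles. -/
lemma Unseparated.chart_zero {m a b c d : ℕ} (h : Unseparated (m + 1) a b (a + c) (b + d)) :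
    Unseparated m a b c d := by
  intro p q hpq
  have := h p (p + q) (by rw [pow_succ]; omega)
  rcases this with ⟨h1, h2⟩ | ⟨h1, h2⟩
  · left; constructor <;> linarith
  · right; constructor <;> linarith

lemma Unseparated.chart_infty {m a b c d : ℕ} (h : Unseparated (m + 1) (a + c) (b + d) c d) :
    Unseparated m a b c d := by
  intro p q hpq
  have := h (p + q) q (by rw [pow_succ]; omega)
  rcases this with ⟨h1, h2⟩ | ⟨h1, h2⟩
  · left; constructor <;> linarith
  · right; constructor <;> linarith

/-- The ray `(p, q)` meets the vertical line at abscissa `n` at height `q n / p`. This is an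
integer, so it is not strictly between `k` and `k + 1`. -/
lemma unseparated_of_dvd {m n k : ℕ} (h : ∀ p : ℕ, 0 < p → p ≤ 2 ^ (m + 1) → p ∣ n) :
    Unseparated m n n k (k + 1) := by
  intro p q hpq
  rcases Nat.eq_zero_or_pos p with rfl | hp
  · left; simp
  · obtain ⟨j, rfl⟩ := h p hp (by omega)
    have e : q * (p * j) = p * (q * j) := by ring
    rw [e]
    rcases le_or_gt (k + 1) (q * j) with h1 | h1
    · left
      exact ⟨Nat.mul_le_mul_left _ (by omega), Nat.mul_le_mul_left _ h1⟩
    · right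
      exact ⟨Nat.mul_le_mul_left _ (by omega), Nat.mul_le_mul_left _ (by omega)⟩

/-- Monomial germs at corners lift, and desingularize. -/
theorem IsAdaptedTree.good_monMap {F : FoliationGerm} (m : ℕ) :
    ∀ {P : ℂ × ℂ → ℂ × ℂ} {S : Set InfNearPoint} {e1 e2 : Prop},
      IsAdaptedTree F P S e1 e2 m → e1 → e2 →
      ∀ {a b c d : ℕ} {U V : ℂ × ℂ → ℂ}, AnalyticAt ℂ U 0 → AnalyticAt ℂ V 0 → U 0 ≠ 0 →
      V 0 ≠ 0 → a * d ≠ b * c → Unseparated m a b c d →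
      Good F P (monMap a b c d U V) S ∧ NonLift (monMap a b c d U V) S = ∅ := by
  induction m with
  | zero =>
    intro P S e1 e2 h h1 h2 a b c d U V hU hV hU0 hV0 hD hsep
    have h0 := h.origin_notMem
    have hφ := isHolMapGerm_monMap hU hV hD
    refine ⟨h.good_of_leaf h0 hφ (dominant_monMap hU hV hU0 hV0 hD) fun G hG => ?_,
      nonLift_eq_empty (liftsS_of_origin_notMem h0 hφ)⟩
    rw [eq_true h1, eq_true h2] at hG
    exact hG.simpleAfter_monMap hU hV hU0 hV0 hD hsep.le
  | succ m ih =>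
    intro P S e1 e2 h h1 h2 a b c d U V hU hV hU0 hV0 hD hsep
    have hφ := isHolMapGerm_monMap hU hV hD
    have hdom := dominant_monMap hU hV hU0 hV0 hD
    by_cases h0 : .origin ∈ S
    -- One of the two monomials divides the other, so the germ lifts to a corner of the blown-up
    -- target, at direction `0` or `∞`, and stays monomial.
    · rcases hsep.le with ⟨hac, hbd⟩ | ⟨hca, hdb⟩
      · obtain ⟨c, rfl⟩ := Nat.exists_eq_add_of_le hac
        obtain ⟨d, rfl⟩ := Nat.exists_eq_add_of_le hbd
        have hW := analyticAt_mul_inv hU hV hU0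
        have hD' : a * d ≠ b * c := fun h => hD (by linarith)
        have e := monMap_eq_chart_zero (a := a) (b := b) (c := c) (d := d) (V := V) hU hU0
        have hψ := isHolMapGerm_monMap hU hW hD'
        obtain ⟨g1, g2⟩ := ih (h.some h0 0) trivial ⟨rfl, h2⟩ hU hW hU0
          (mul_ne_zero hV0 (inv_ne_zero hU0)) hD' hsep.chart_zero
        exact ⟨Good.of_chart h0 hφ hdom hψ e g1, (nonLift_chart h0 hφ hdom hψ e).trans g2⟩
      · obtain ⟨a, rfl⟩ := Nat.exists_eq_add_of_le' hca
        obtain ⟨b, rfl⟩ := Nat.exists_eq_add_of_le' hdb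
        have hW := analyticAt_mul_inv hV hU hV0
        have hD' : a * d ≠ b * c := fun h => hD (by linarith)
        have e := monMap_eq_chart_infty (a := a) (b := b) (c := c) (d := d) (U := U) hV hV0
        have hψ := isHolMapGerm_monMap hW hV hD'
        obtain ⟨g1, g2⟩ := ih (h.infty h0) h1 trivial hW hV
          (mul_ne_zero hU0 (inv_ne_zero hV0)) hV0 hD' hsep.chart_infty
        exact ⟨Good.of_chart h0 hφ hdom hψ e g1, (nonLift_chart h0 hφ hdom hψ e).trans g2⟩
    · refine ⟨h.good_of_leaf h0 hφ hdom fun G hG => ?_,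
        nonLift_eq_empty (liftsS_of_origin_notMem h0 hφ)⟩
      rw [eq_true h1, eq_true h2] at hG
      exact hG.simpleAfter_monMap hU hV hU0 hV0 hD hsep.le

/-- For germs `(t ^ a U, t ^ b V)` that do not lift, the number `V ^ a / U ^ b` takes only finitely
many values. -/
theorem exists_finite_of_nonLift (m : ℕ) :
    ∀ {S : Set InfNearPoint}, TreeClosed S → S.Finite → (∀ p ∈ S, p.depth < m) →
      ∀ {a b : ℕ}, 1 ≤ a → 1 ≤ b → ∃ K : Set ℂ, K.Finite ∧ ∀ {U V : ℂ × ℂ → ℂ},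
        AnalyticAt ℂ U 0 → AnalyticAt ℂ V 0 → U 0 ≠ 0 → V 0 ≠ 0 → powDelta a b U V ≠ 0 →
        (NonLift (powMap a b U V) S).Nonempty → V 0 ^ a / U 0 ^ b ∈ K := by
  induction m with
  | zero =>
    intro S _ _ hm a b ha hb
    refine ⟨∅, Set.finite_empty, fun {U V} hU hV hU0 hV0 hΔ hne => ?_⟩
    have h0 : .origin ∉ S := fun h => absurd (hm _ h) (by simp)
    rw [nonLift_eq_empty (liftsS_of_origin_notMem h0
      (isHolMapGerm_powMap hU hV (fun h => by omega) (fun h => by omega)))] at hne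
    exact absurd hne Set.not_nonempty_empty
  | succ m ih =>
    intro S hS hSf hm a b ha hb
    by_cases h0 : .origin ∈ S
    · have hm' : ∀ d, ∀ p ∈ sub S d, p.depth < m := fun d p hp => by
        have := hm _ hp
        rw [InfNearPoint.depth_prepend] at this
        omega
      rcases lt_trichotomy a b with hab | rfl | hab
      · obtain ⟨b, rfl⟩ := Nat.exists_eq_add_of_le hab.le
        obtain ⟨K, hK, hK'⟩ := ih (hS.sub (OnePoint.some 0)) (finite_sub hSf _) (hm' _)
          (a := a) (b := b) ha (by omega)
        refine ⟨K, hK, fun {U V} hU hV hU0 hV0 hΔ hne => ?_⟩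
        have hW := analyticAt_mul_inv hU hV hU0
        have hW0 : V 0 * (U 0)⁻¹ ≠ 0 := mul_ne_zero hV0 (inv_ne_zero hU0)
        have hΔ' : powDelta a b U (fun q => V q * (U q)⁻¹) ≠ 0 := by
          rw [powDelta_mul_inv_snd hU hV hU0]; exact div_ne_zero hΔ hU0
        rw [nonLift_chart h0 (isHolMapGerm_powMap hU hV (fun h => by omega) (fun h => by omega))
          (dominant_powMap hU hV (fun h => by omega) (fun h => by omega) hΔ)
          (isHolMapGerm_powMap hU hW (fun h => by omega) (fun h => by omega))
          (powMap_eq_chart_zero hU hU0)] at hne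
        have := hK' hU hW hU0 hW0 hΔ' hne
        convert this using 1
        rw [pow_add, mul_pow, inv_pow]; field_simp
      -- For equal exponents the germ lifts to the direction `V(0) / U(0)`, and can fail to lift
      -- further only if there is a centre over it. In the other two cases the invariant is
      -- unchanged by the chart.
      · refine ⟨(fun z => z ^ a) '' {c : ℂ | (sub S (OnePoint.some c)).Nonempty}, ?_,
          fun {U V} hU hV hU0 hV0 hΔ hne => ?_⟩
        · exact ((finite_directions hSf hS).preimage (f := OnePoint.some)
            (OnePoint.coe_injective.injOn)).image _
        · have hW : AnalyticAt ℂ (fun q => V q * (U q)⁻¹ + -(V 0 * (U 0)⁻¹)) 0 :=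
            (analyticAt_mul_inv hU hV hU0).add analyticAt_const
          have hψ := isHolMapGerm_powMap (a := a) (b := 0) hU hW (fun h => by omega)
            (fun _ => by simp)
          rw [nonLift_chart h0 (isHolMapGerm_powMap hU hV (fun h => by omega) (fun h => by omega))
            (dominant_powMap hU hV (fun h => by omega) (fun h => by omega) hΔ) hψ
            (powMap_eq_chart_some hU hU0 (V 0 * (U 0)⁻¹))] at hne
          refine ⟨V 0 * (U 0)⁻¹, ?_, by simp [mul_pow, div_eq_mul_inv]⟩
          by_contra h1
          have h2 : .origin ∉ sub S (OnePoint.some (V 0 * (U 0)⁻¹)) := fun h => h1 ⟨_, h⟩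
          rw [nonLift_eq_empty (liftsS_of_origin_notMem h2 hψ)] at hne
          exact absurd hne Set.not_nonempty_empty
      · obtain ⟨a, rfl⟩ := Nat.exists_eq_add_of_le' hab.le
        obtain ⟨K, hK, hK'⟩ := ih (hS.sub OnePoint.infty) (finite_sub hSf _) (hm' _)
          (a := a) (b := b) (by omega) hb
        refine ⟨K, hK, fun {U V} hU hV hU0 hV0 hΔ hne => ?_⟩
        have hW := analyticAt_mul_inv hV hU hV0
        have hW0 : U 0 * (V 0)⁻¹ ≠ 0 := mul_ne_zero hU0 (inv_ne_zero hV0)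
        have hΔ' : powDelta a b (fun q => U q * (V q)⁻¹) V ≠ 0 := by
          rw [powDelta_mul_inv_fst hU hV hV0]; exact div_ne_zero hΔ hV0
        rw [nonLift_chart h0 (isHolMapGerm_powMap hU hV (fun h => by omega) (fun h => by omega))
          (dominant_powMap hU hV (fun h => by omega) (fun h => by omega) hΔ)
          (isHolMapGerm_powMap hW hV (fun h => by omega) (fun h => by omega))
          (powMap_eq_chart_infty hV hV0)] at hne
        have := hK' hW hV hW0 hV0 hΔ' hne
        convert this using 1
        rw [pow_add, mul_pow, inv_pow]; field_simp
    · refine ⟨∅, Set.finite_empty, fun {U V} hU hV hU0 hV0 hΔ hne => ?_⟩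
      rw [nonLift_eq_empty (liftsS_of_origin_notMem h0
        (isHolMapGerm_powMap hU hV (fun h => by omega) (fun h => by omega)))] at hne
      exact absurd hne Set.not_nonempty_empty

/-! ### Blowing up the source of a ramification -/

/-- A power of `t` times a unit is not a multiple of a germ that vanishes at the origin but not on
the axis `t = 0`. -/
lemma pow_mul_ne_mul {U V : ℂ × ℂ → ℂ} (hU : AnalyticAt ℂ U 0) (hU0 : U 0 ≠ 0)
    (hV : AnalyticAt ℂ V 0) (hV0 : V 0 = 0) (hVy : ∀ᶠ y in 𝓝[≠] (0 : ℂ), V (0, y) ≠ 0) (j : ℕ) :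
    ∀ {g : ℂ × ℂ → ℂ}, AnalyticAt ℂ g 0 → ¬ ∀ᶠ q : ℂ × ℂ in 𝓝 0, q.1 ^ j * U q = V q * g q := by
  induction j with
  | zero =>
    intro g _ h
    have := h.self_of_nhds
    simp [hV0, hU0] at this
  | succ j ih =>
    intro g hg h
    -- On `t = 0` the left side vanishes and `V` does not, so `g` does; a factor `t` cancels and the
    -- exponent drops.
    have h1 : ∀ᶠ y in 𝓝[≠] (0 : ℂ), g (0, y) = 0 := by
      filter_upwards [hVy, (tendsto_inr_zero.eventually h).filter_mono nhdsWithin_le_nhds]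
        with y h2 h3
      simpa [h2] using h3.symm
    have hc : ContinuousAt (fun y : ℂ => g (0, y)) 0 :=
      ContinuousAt.comp (f := fun y : ℂ => ((0 : ℂ), y)) (g := g) hg.continuousAt
        (by fun_prop)
    have h2 : g 0 = 0 := by
      have e1 : Tendsto (fun y : ℂ => g (0, y)) (𝓝[≠] 0) (𝓝 (g 0)) :=
        hc.tendsto.mono_left nhdsWithin_le_nhds
      have e2 : Tendsto (fun y : ℂ => g (0, y)) (𝓝[≠] 0) (𝓝 0) :=
        tendsto_const_nhds.congr' (h1.mono fun y h => h.symm)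
      exact tendsto_nhds_unique e1 e2
    have h3 : ∀ᶠ y in 𝓝 (0 : ℂ), g (0, y) = 0 := by
      filter_upwards [eventually_nhdsWithin_iff.mp h1] with y hy
      by_cases h0 : y = 0
      · rw [h0]; exact h2
      · exact hy h0
    obtain ⟨k, hk, hke⟩ := exists_eq_fst_mul hg h3
    refine ih hk (eventually_eq_of_fst_ne ((analyticAt_fst.pow j).mul hU) (hV.mul hk) ?_)
    filter_upwards [h, hke] with q h4 h5 h0
    rw [h5] at h4
    refine mul_left_cancel₀ h0 ?_
    linear_combination h4

/-- The components of a map germ that lifts to the blowing-up of the origin. -/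
lemma LiftsS.dvd {φ : ℂ × ℂ → ℂ × ℂ} {S : Set InfNearPoint} (h0 : .origin ∈ S) (h : LiftsS φ S) :
    ∃ g, AnalyticAt ℂ g 0 ∧ ((∀ᶠ q in 𝓝 0, (φ q).2 = (φ q).1 * g q) ∨
      ((∀ᶠ q in 𝓝 0, (φ q).1 = (φ q).2 * g q) ∧ g 0 = 0)) := by
  obtain ⟨d, ψ, hψ, e, -⟩ := h.exists_chart h0
  rcases d with _ | c
  · refine ⟨fun q => (ψ q).1, analyticAt_fst.comp hψ.1, Or.inr ⟨?_, by simp [hψ.2]⟩⟩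
    filter_upwards [e] with q hq
    rw [hq]; simp [blowUpChart, mul_comm]
  · refine ⟨fun q => (ψ q).2 + c, (analyticAt_snd.comp hψ.1).add analyticAt_const, Or.inl ?_⟩
    filter_upwards [e] with q hq
    rw [hq]; simp [blowUpChart]

/-- A lift would make one component divide the other. After cancelling `t ^ k`, neither of `t ^ (n -
k) U` and `V` divides the other, as `V` is transversal to `t = 0`. -/
lemma not_liftsS_powMap {S : Set InfNearPoint} (h0 : .origin ∈ S) {n k : ℕ} (hkn : k < n)
    {U V : ℂ × ℂ → ℂ} (hU : AnalyticAt ℂ U 0) (hV : AnalyticAt ℂ V 0) (hU0 : U 0 ≠ 0)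
    (hV0 : V 0 = 0) (hVy : pd2 V 0 ≠ 0) {s : ℂ × ℂ → ℂ × ℂ} (hs : s = id ∨ s = Prod.swap) :
    ¬ LiftsS (s ∘ powMap n k U V) S := by
  intro h
  have hVne : ∀ᶠ y in 𝓝[≠] (0 : ℂ), V (0, y) ≠ 0 := by
    have := pd2_eq_deriv hV.differentiableAt
    exact this.eventually_ne hVy
  have hd : ∃ g, AnalyticAt ℂ g 0 ∧
      ((∀ᶠ q : ℂ × ℂ in 𝓝 0, q.1 ^ k * V q = q.1 ^ n * U q * g q) ∨
      (∀ᶠ q : ℂ × ℂ in 𝓝 0, q.1 ^ n * U q = q.1 ^ k * V q * g q)) := by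
    obtain ⟨g, hg, h1⟩ := h.dvd h0
    rcases hs with rfl | rfl
    · exact ⟨g, hg, h1.imp id And.left⟩
    · exact ⟨g, hg, (h1.imp id And.left).symm⟩
  have hn : ∀ t : ℂ, t ^ n = t ^ k * t ^ (n - k) := fun t => by rw [← pow_add]; congr 1; omega
  obtain ⟨g, hg, h1 | h1⟩ := hd
  · have h2 := eventually_eq_of_fst_ne hV (((analyticAt_fst.pow (n - k)).mul hU).mul hg) (by
      filter_upwards [h1] with q hq hq0
      rw [hn] at hq
      refine mul_left_cancel₀ (pow_ne_zero k hq0) ?_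
      simp only [Pi.mul_apply, Pi.pow_apply]
      linear_combination hq)
    obtain ⟨y, h3, h4⟩ :=
      (hVne.and ((tendsto_inr_zero.eventually h2).filter_mono nhdsWithin_le_nhds)).exists
    have : n - k ≠ 0 := by omega
    simp [this] at h4
    exact h3 h4
  · refine pow_mul_ne_mul hU hU0 hV hV0 hVne (n - k) hg
      (eventually_eq_of_fst_ne ((analyticAt_fst.pow (n - k)).mul hU) (hV.mul hg) ?_)
    filter_upwards [h1] with q hq hq0
    rw [hn] at hq
    refine mul_left_cancel₀ (pow_ne_zero k hq0) ?_
    linear_combination hq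

lemma finite_setOf_affine_pow_mem {α β : ℂ} (hβ : β ≠ 0) {n : ℕ} (hn : 0 < n) {K : Set ℂ}
    (hK : K.Finite) : {c : ℂ | (α + c * β) ^ n ∈ K}.Finite := by
  have h1 : {z : ℂ | z ^ n ∈ K}.Finite := by
    have : {z : ℂ | z ^ n ∈ K} = ⋃ w ∈ K, {z : ℂ | z ^ n = w} := by
      ext z; simp
    rw [this]
    refine hK.biUnion fun w _ => ?_
    refine (Polynomial.nthRoots n w).toFinset.finite_toSet.subset fun z hz => ?_
    simpa [Polynomial.mem_nthRoots hn] using hz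
  refine h1.preimage (f := fun c : ℂ => α + c * β) fun x _ y _ hxy => ?_
  simpa [hβ] using hxy

/-- Blowing up the source of a ramification, all of whose transforms are known to desingularize. -/
lemma good_of_blowUp_powMap {F : FoliationGerm} {P : ℂ × ℂ → ℂ × ℂ} {S : Set InfNearPoint}
    (h0 : .origin ∈ S) {n k : ℕ} (hkn : k < n) {U V : ℂ × ℂ → ℂ} (hU : AnalyticAt ℂ U 0)
    (hV : AnalyticAt ℂ V 0) (hU0 : U 0 ≠ 0) (hV0 : V 0 = 0) (hVy : pd2 V 0 ≠ 0)
    {s : ℂ × ℂ → ℂ × ℂ} (hs : s = id ∨ s = Prod.swap)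
    (hT : ∀ {U V : ℂ × ℂ → ℂ}, AnalyticAt ℂ U 0 → AnalyticAt ℂ V 0 → U 0 ≠ 0 →
      powDelta n (k + 1) U V ≠ 0 → Good F P (s ∘ powMap n (k + 1) U V) S)
    (hC : ∀ {U V : ℂ × ℂ → ℂ}, AnalyticAt ℂ U 0 → AnalyticAt ℂ V 0 → U 0 ≠ 0 → V 0 ≠ 0 →
      Good F P (s ∘ monMap n n k (k + 1) U V) S ∧ NonLift (s ∘ monMap n n k (k + 1) U V) S = ∅)
    {K : Set ℂ} (hKf : K.Finite) (hK : ∀ {U V : ℂ × ℂ → ℂ}, AnalyticAt ℂ U 0 → AnalyticAt ℂ V 0 →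
      U 0 ≠ 0 → V 0 ≠ 0 → powDelta n (k + 1) U V ≠ 0 →
      (NonLift (s ∘ powMap n (k + 1) U V) S).Nonempty → V 0 ^ n / U 0 ^ (k + 1) ∈ K) :
    Good F P (s ∘ powMap n k U V) S := by
  have hn : (n : ℂ) ≠ 0 := by exact_mod_cast (by omega : n ≠ 0)
  -- decompose `V = y H + t R`
  obtain ⟨R, hR, hRe⟩ := exists_eq_add_fst_mul hV
  obtain ⟨H, hH, hHe⟩ := exists_eq_snd_mul (f := fun q => V (0, q.2))
    (AnalyticAt.comp (g := V) (f := fun q : ℂ × ℂ => ((0 : ℂ), q.2)) hV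
      (analyticAt_const.prod analyticAt_snd)) (Eventually.of_forall fun _ => hV0)
  have hVe : ∀ᶠ q in 𝓝 0, V q = q.2 * H q + q.1 * R q := by
    filter_upwards [hRe, hHe] with q h1 h2
    rw [h1, h2]
  have hH0 : H 0 ≠ 0 := by
    have := (Filter.EventuallyEq.pd2 (show V =ᶠ[𝓝 0] _ from hVe)).self_of_nhds
    have d1 := hH.differentiableAt
    have d2 := hR.differentiableAt
    rw [this, pd2_add (by fun_prop) (by fun_prop), pd2_mul (by fun_prop) d1,
      pd2_mul (by fun_prop) d2] at hVy
    simpa using hVy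
  -- the transforms at the finite directions
  let ch : ℂ → ℂ × ℂ → ℂ × ℂ := fun c => blowUpChart (OnePoint.some c)
  have hch : ∀ c, IsHolMapGerm (ch c) := fun c => isHolMapGerm_blowUpChart _
  let Vc : ℂ → ℂ × ℂ → ℂ := fun c q => (q.2 + c) * H (ch c q) + R (ch c q)
  have hUc : ∀ c, AnalyticAt ℂ (fun q => U (ch c q)) 0 := fun c => (hch c).comp_analyticAt hU
  have hVc : ∀ c, AnalyticAt ℂ (Vc c) 0 := fun c =>
    ((analyticAt_snd.add analyticAt_const).mul ((hch c).comp_analyticAt hH)).add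
      ((hch c).comp_analyticAt hR)
  have hUc0 : ∀ c, U (ch c 0) ≠ 0 := fun c => by rw [(hch c).2]; exact hU0
  have hVc0 : ∀ c, Vc c 0 = R 0 + c * H 0 := fun c => by
    simp only [Vc, (hch c).2, Prod.snd_zero]; ring
  have hline : ∀ c y : ℂ, ch c (0, y) = 0 := fun c y => by simp [ch, blowUpChart_some]
  -- The chart contracts `t = 0`, so `U` becomes constant there while the transform of `V` is affine
  -- in `y` with slope `H(0)`; the new `powDelta` is `n U(0) H(0)`.
  have hUcy : ∀ c, pd2 (fun q => U (ch c q)) 0 = 0 := fun c => by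
    have h1 := pd2_eq_deriv (hUc c).differentiableAt
    simp only [Prod.fst_zero, hline] at h1
    exact h1.unique (hasDerivAt_const _ _)
  have hVcy : ∀ c, pd2 (Vc c) 0 = H 0 := fun c => by
    have h1 := pd2_eq_deriv (hVc c).differentiableAt
    simp only [Prod.fst_zero, Vc, hline] at h1
    refine h1.unique ?_
    have h2 := ((((hasDerivAt_id (0 : ℂ)).add_const c).mul_const (H 0)).add_const (R 0))
    simpa using h2
  have hΔc : ∀ c, powDelta n (k + 1) (fun q => U (ch c q)) (Vc c) ≠ 0 := fun c => by
    simp only [powDelta, hUcy, hVcy, mul_zero, sub_zero]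
    exact mul_ne_zero (mul_ne_zero hn (hUc0 c)) hH0
  have ec : ∀ c, (s ∘ powMap n k U V) ∘ ch c
      =ᶠ[𝓝 0] s ∘ powMap n (k + 1) (fun q => U (ch c q)) (Vc c) := fun c => by
    filter_upwards [(hch c).tendsto.eventually hVe] with q hq
    simp only [Function.comp, powMap]
    congr 2
    have e1 : (ch c q).1 = q.1 := rfl
    have e2 : (ch c q).2 = q.1 * (q.2 + c) := rfl
    rw [hq, e1, e2]
    simp only [Vc, pow_succ]
    ring
  -- the transform at the infinite direction
  let ci : ℂ × ℂ → ℂ × ℂ := blowUpChart OnePoint.infty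
  have hci : IsHolMapGerm ci := isHolMapGerm_blowUpChart _
  let Vi : ℂ × ℂ → ℂ := fun q => H (ci q) + q.1 * R (ci q)
  have hUi : AnalyticAt ℂ (fun q => U (ci q)) 0 := hci.comp_analyticAt hU
  have hVi : AnalyticAt ℂ Vi 0 :=
    (hci.comp_analyticAt hH).add (analyticAt_fst.mul (hci.comp_analyticAt hR))
  have hUi0 : U (ci 0) ≠ 0 := by rw [hci.2]; exact hU0
  have hVi0 : Vi 0 ≠ 0 := by simpa [Vi, hci.2] using hH0
  have ei : (s ∘ powMap n k U V) ∘ ci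
      =ᶠ[𝓝 0] s ∘ monMap n n k (k + 1) (fun q => U (ci q)) Vi := by
    filter_upwards [hci.tendsto.eventually hVe] with q hq
    simp only [Function.comp, powMap, monMap]
    have e1 : (ci q).1 = q.1 * q.2 := rfl
    have e2 : (ci q).2 = q.2 := rfl
    have e3 : (q.1 * q.2) ^ k * (q.2 * H (ci q) + q.1 * q.2 * R (ci q))
        = q.1 ^ k * q.2 ^ (k + 1) * Vi q := by
      simp only [Vi, mul_pow, pow_succ]; ring
    rw [hq, e1, e2, e3, mul_pow]
  obtain ⟨hi1, hi2⟩ := hC hUi hVi hUi0 hVi0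
  refine Good.of_blowUp (not_liftsS_powMap h0 hkn hU hV hU0 hV0 hVy hs) ?_ ?_ ?_
  · intro d
    rcases d with _ | c
    · exact hi1.congr ei.symm
    · exact (hT (hUc c) (hVc c) (hUc0 c) (hΔc c)).congr (ec c).symm
  -- There is one direction where `V` still vanishes. The others without a lift satisfy one of
  -- finitely many equations `(R(0) + c H(0)) ^ n = const`.
  · have f1 : {c : ℂ | (R 0 + c * H 0) ^ 1 ∈ ({0} : Set ℂ)}.Finite :=
      finite_setOf_affine_pow_mem hH0 one_pos (Set.finite_singleton 0)
    have f2 : {c : ℂ | (R 0 + c * H 0) ^ n ∈ (fun z => z * U 0 ^ (k + 1)) '' K}.Finite :=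
      finite_setOf_affine_pow_mem hH0 (by omega) (hKf.image _)
    refine (f1.union f2).subset fun c hc => ?_
    by_cases hc0 : R 0 + c * H 0 = 0
    · left; simpa using hc0
    · right
      have hc' : (NonLift ((s ∘ powMap n k U V) ∘ ch c) S).Nonempty := hc
      rw [NonLift.congr (ec c)] at hc'
      have := hK (hUc c) (hVc c) (hUc0 c) (by rwa [hVc0]) (hΔc c) hc'
      refine ⟨_, this, ?_⟩
      simp only [hVc0, (hch c).2]
      field_simp
  · show NonLift ((s ∘ powMap n k U V) ∘ ci) S = ∅
    rw [NonLift.congr ei, hi2]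

/-! ### Ramifications of divisible order -/

/-- A small positive combination of `a` and `b` is divisible by `B! ^ m`; for the germs
`(t ^ a U, t ^ b V)` this bounds below the divisibility of the ramification orders that appear
when they are lifted. -/
def DivisibleOrder (B m a b : ℕ) : Prop :=
  ∃ x y : ℕ, 1 ≤ x + y ∧ (x + y) * 2 ^ m ≤ B ∧ B.factorial ^ m ∣ x * a + y * b

lemma DivisibleOrder.swap {B m a b : ℕ} (h : DivisibleOrder B m a b) : DivisibleOrder B m b a := by
  obtain ⟨x, y, h1, h2, h3⟩ := h
  exact ⟨y, x, by omega, by rwa [add_comm], by rwa [add_comm]⟩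

/-- The number `x a + y b` is kept by each step of Euclid's algorithm; the sum of the coefficients
at most doubles, which the factor `2 ^ m` allows for. -/
lemma DivisibleOrder.sub {B m a b : ℕ} (h : DivisibleOrder B (m + 1) a (a + b)) :
    DivisibleOrder B m a b := by
  obtain ⟨x, y, h1, h2, h3⟩ := h
  refine ⟨x + y, y, by omega, ?_, ?_⟩
  · refine le_trans ?_ h2
    calc (x + y + y) * 2 ^ m ≤ ((x + y) * 2) * 2 ^ m := Nat.mul_le_mul_right _ (by omega)
      _ = (x + y) * 2 ^ (m + 1) := by ring
  · refine (pow_dvd_pow _ (Nat.le_succ m)).trans ?_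
    have e : (x + y) * a + y * b = x * a + y * (a + b) := by ring
    rwa [e]

/-- Here `B! ^ (m + 1)` divides `(x + y) a`, and `x + y ≤ B` divides `B!`; exactly one factor `B!`
is spent. -/
lemma DivisibleOrder.dvd {B m a : ℕ} (h : DivisibleOrder B (m + 1) a a) :
    B.factorial ^ m ∣ a := by
  obtain ⟨x, y, h1, h2, h3⟩ := h
  have h4 : x + y ≤ B := le_trans (Nat.le_mul_of_pos_right _ (by positivity)) h2
  obtain ⟨z, hz⟩ := Nat.dvd_factorial h1 h4
  have h5 : (x + y) * (z * B.factorial ^ m) ∣ (x + y) * a := by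
    have : (x + y) * (z * B.factorial ^ m) = B.factorial ^ (m + 1) := by
      rw [pow_succ, ← mul_assoc, ← hz, mul_comm]
    rw [this, add_mul]; exact h3
  exact (Dvd.intro_left z rfl).trans (Nat.dvd_of_mul_dvd_mul_left h1 h5)

/-- The statement that ramifications of order divisible by `B! ^ m` desingularize over trees of
height at most `m`, when the image of the ramification axis is marked. -/
def RamificationsGood (F : FoliationGerm) (B m : ℕ) : Prop :=
  ∀ {P : ℂ × ℂ → ℂ × ℂ} {S : Set InfNearPoint} {e1 e2 : Prop}, IsAdaptedTree F P S e1 e2 m →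
    ∀ {n k : ℕ}, 1 ≤ n → k ≤ n → (k = n → .origin ∈ S) → B.factorial ^ m ∣ n →
    ∀ {U V : ℂ × ℂ → ℂ}, AnalyticAt ℂ U 0 → AnalyticAt ℂ V 0 → U 0 ≠ 0 → V 0 = 0 →
      powDelta n k U V ≠ 0 →
      (e1 → Good F P (powMap n k U V) S) ∧ (e2 → Good F P (powMap k n V U) S)

/-- The analogous statement for the germs `(t ^ a U, t ^ b V)` with units `U`, `V`. -/
def PowersGood (F : FoliationGerm) (B m : ℕ) : Prop :=
  ∀ {P : ℂ × ℂ → ℂ × ℂ} {S : Set InfNearPoint} {e1 e2 : Prop}, IsAdaptedTree F P S e1 e2 m →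
    ∀ {a b : ℕ}, 1 ≤ a → 1 ≤ b → DivisibleOrder B m a b →
    ((e1 ∧ e2) ∨ (.origin ∈ S ∧ b ≤ a ∧ e1) ∨ (.origin ∈ S ∧ a ≤ b ∧ e2)) →
    ∀ {U V : ℂ × ℂ → ℂ}, AnalyticAt ℂ U 0 → AnalyticAt ℂ V 0 → U 0 ≠ 0 → V 0 ≠ 0 →
      powDelta a b U V ≠ 0 → Good F P (powMap a b U V) S

lemma powersGood_of_leaf {F : FoliationGerm} {P : ℂ × ℂ → ℂ × ℂ} {S : Set InfNearPoint}
    {e1 e2 : Prop} {m : ℕ} (h : IsAdaptedTree F P S e1 e2 m) (h0 : .origin ∉ S) {a b : ℕ}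
    (ha : 1 ≤ a) (hb : 1 ≤ b) (he : e1 ∧ e2) {U V : ℂ × ℂ → ℂ} (hU : AnalyticAt ℂ U 0)
    (hV : AnalyticAt ℂ V 0) (hU0 : U 0 ≠ 0) (hV0 : V 0 ≠ 0) (hΔ : powDelta a b U V ≠ 0) :
    Good F P (powMap a b U V) S := by
  refine h.good_of_leaf h0 (isHolMapGerm_powMap hU hV (fun h => by omega) (fun h => by omega))
    (dominant_powMap hU hV (fun h => by omega) (fun h => by omega) hΔ) fun G hG => ?_
  rw [eq_true he.1, eq_true he.2] at hG
  exact hG.simpleAfter_powMap hU hV ha hb hU0 hV0 hΔ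

lemma powersGood_zero (F : FoliationGerm) (B : ℕ) : PowersGood F B 0 := by
  intro P S e1 e2 h a b ha hb _ he U V hU hV hU0 hV0 hΔ
  have h0 := h.origin_notMem
  exact powersGood_of_leaf h h0 ha hb (by tauto) hU hV hU0 hV0 hΔ

/-- One step of Euclid's algorithm. Unequal exponents lead to a corner of the target with both axes
marked; equal exponents lead to a ramification over the new divisor, handled by `hR`. -/
lemma powersGood_succ {F : FoliationGerm} {B m : ℕ} (hR : RamificationsGood F B m)
    (hT : PowersGood F B m) : PowersGood F B (m + 1) := by
  intro P S e1 e2 h a b ha hb hdiv he U V hU hV hU0 hV0 hΔ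
  by_cases h0 : .origin ∈ S
  swap
  · exact powersGood_of_leaf h h0 ha hb (by tauto) hU hV hU0 hV0 hΔ
  have hφ := isHolMapGerm_powMap (a := a) (b := b) hU hV (fun h => by omega) (fun h => by omega)
  have hd := dominant_powMap hU hV (fun h => by omega) (fun h => by omega) hΔ
  rcases lt_trichotomy a b with hab | rfl | hab
  · have he2 : e2 := by
      rcases he with h | h | h
      · exact h.2
      · omega
      · exact h.2.2
    obtain ⟨b, rfl⟩ := Nat.exists_eq_add_of_le hab.le
    have hW := analyticAt_mul_inv hU hV hU0
    refine Good.of_chart h0 hφ hd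
      (isHolMapGerm_powMap hU hW (fun h => by omega) (fun h => by omega))
      (powMap_eq_chart_zero hU hU0)
      (hT (h.some h0 0) ha (by omega) hdiv.sub (Or.inl ⟨trivial, rfl, he2⟩) hU hW hU0
        (mul_ne_zero hV0 (inv_ne_zero hU0)) ?_)
    rw [powDelta_mul_inv_snd hU hV hU0]; exact div_ne_zero hΔ hU0
  · have hW : AnalyticAt ℂ (fun q => V q * (U q)⁻¹ + -(V 0 * (U 0)⁻¹)) 0 :=
      (analyticAt_mul_inv hU hV hU0).add analyticAt_const
    have hW0 : V 0 * (U 0)⁻¹ + -(V 0 * (U 0)⁻¹) = 0 := by ring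
    refine Good.of_chart h0 hφ hd (isHolMapGerm_powMap hU hW (fun h => by omega) (fun _ => hW0))
      (powMap_eq_chart_some hU hU0 (V 0 * (U 0)⁻¹))
      ((hR (h.some h0 _) ha (by omega) (fun h => by omega) hdiv.dvd hU hW hU0 hW0 ?_).1 trivial)
    rw [powDelta_mul_inv_add_const hU hV hU0]; exact div_ne_zero hΔ hU0
  · have he1 : e1 := by
      rcases he with h | h | h
      · exact h.1
      · exact h.2.2
      · omega
    obtain ⟨a, rfl⟩ := Nat.exists_eq_add_of_le' hab.le
    have hW := analyticAt_mul_inv hV hU hV0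
    have hdiv' : DivisibleOrder B m a b := by
      have := hdiv.swap
      rw [add_comm a b] at this
      exact this.sub.swap
    refine Good.of_chart h0 hφ hd
      (isHolMapGerm_powMap hW hV (fun h => by omega) (fun h => by omega))
      (powMap_eq_chart_infty hV hV0)
      (hT (h.infty h0) (by omega) hb hdiv' (Or.inl ⟨he1, trivial⟩) hW hV
        (mul_ne_zero hU0 (inv_ne_zero hV0)) hV0 ?_)
    rw [powDelta_mul_inv_fst hU hV hV0]; exact div_ne_zero hΔ hV0

lemma ramificationsGood_of_leaf {F : FoliationGerm} {P : ℂ × ℂ → ℂ × ℂ} {S : Set InfNearPoint}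
    {e1 e2 : Prop} {m : ℕ} (h : IsAdaptedTree F P S e1 e2 m) (h0 : .origin ∉ S) {n k : ℕ}
    (hkn : k < n) {U V : ℂ × ℂ → ℂ} (hU : AnalyticAt ℂ U 0)
    (hV : AnalyticAt ℂ V 0) (hU0 : U 0 ≠ 0) (hV0 : V 0 = 0) (hΔ : powDelta n k U V ≠ 0) :
    (e1 → Good F P (powMap n k U V) S) ∧ (e2 → Good F P (powMap k n V U) S) := by
  have hΔ' : powDelta k n V U ≠ 0 := by rw [powDelta_swap]; exact neg_ne_zero.mpr hΔ
  have hφ := isHolMapGerm_powMap (a := n) (b := k) hU hV (fun h => by omega) (fun _ => hV0)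
  have hd := dominant_powMap hU hV (fun h => by omega) (fun _ => hV0) hΔ
  refine ⟨fun he => h.good_of_leaf h0 hφ hd fun G hG => ?_, fun he => ?_⟩
  · rw [eq_true he] at hG
    exact hG.simpleAfter_powMap_of_zero hU hV hkn hU0 hV0 hΔ
  · refine h.good_of_leaf h0 (isHolMapGerm_powMap hV hU (fun _ => hV0) (fun h => by omega))
      (dominant_powMap hV hU (fun _ => hV0) (fun h => by omega) hΔ') fun G hG => ?_
    rw [eq_true he] at hG
    exact SimpleAfter.of_swap hφ hd
      ((hG.swap (Or.inr trivial)).simpleAfter_powMap_of_zero hU hV hkn hU0 hV0 hΔ)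

/-- Descending induction on `k`. At `k = n` the germ lifts to a ramification of order `n` over a
tree of height `m`. Below `n` the source is blown up, and the points of the new divisor fall to the
case `k + 1`, to `hT`, or to the monomial case. -/
lemma ramificationsGood_succ {F : FoliationGerm} {B m : ℕ} (hB : 2 ^ (m + 2) ≤ B)
    (hR : RamificationsGood F B m) (hT : PowersGood F B (m + 1)) :
    RamificationsGood F B (m + 1) := by
  intro P S e1 e2 h n k hn hkn hk hdiv U V
  by_cases h0 : .origin ∈ S
  swap
  · intro hU hV hU0 hV0 hΔ
    have hne : k ≠ n := fun h => h0 (hk h)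
    exact ramificationsGood_of_leaf h h0 (by omega) hU hV hU0 hV0 hΔ
  clear hk
  have hVy : ∀ {U V : ℂ × ℂ → ℂ} {k : ℕ}, V 0 = 0 → powDelta n k U V ≠ 0 → pd2 V 0 ≠ 0 := by
    intro U V k hV0 hΔ h; simp [powDelta, hV0, h] at hΔ
  obtain ⟨j, hj⟩ := Nat.exists_eq_add_of_le hkn
  induction j generalizing k U V with
  | zero =>
    obtain rfl : n = k := hj
    intro hU hV hU0 hV0 hΔ
    have hW := analyticAt_mul_inv hU hV hU0
    have hW0 : V 0 * (U 0)⁻¹ = 0 := by rw [hV0, zero_mul]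
    have hΔ' : powDelta n n V U ≠ 0 := by rw [powDelta_swap]; exact neg_ne_zero.mpr hΔ
    have hΔW : powDelta n 0 U (fun q => V q * (U q)⁻¹) ≠ 0 := by
      rw [powDelta_mul_inv_snd hU hV hU0]; exact div_ne_zero hΔ hU0
    have hdiv' : B.factorial ^ m ∣ n := (pow_dvd_pow _ (Nat.le_succ m)).trans hdiv
    refine ⟨fun _ => ?_, fun he => ?_⟩
    · exact Good.of_chart h0
        (isHolMapGerm_powMap hU hV (fun h => by omega) (fun h => by omega))
        (dominant_powMap hU hV (fun h => by omega) (fun h => by omega) hΔ)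
        (isHolMapGerm_powMap hU hW (fun h => by omega) (fun _ => hW0))
        (powMap_eq_chart_zero (a := n) (b := 0) hU hU0)
        ((hR (h.some h0 0) hn (by omega) (fun h => by omega) hdiv' hU hW hU0 hW0 hΔW).1 trivial)
    · have e := powMap_eq_chart_infty (a := 0) (b := n) (U := V) hU hU0
      rw [zero_add] at e
      exact Good.of_chart h0
        (isHolMapGerm_powMap hV hU (fun h => by omega) (fun h => by omega))
        (dominant_powMap hV hU (fun h => by omega) (fun h => by omega) hΔ')
        (isHolMapGerm_powMap hW hU (fun _ => hW0) (fun h => by omega)) e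
        ((hR (h.infty h0) hn (by omega) (fun h => by omega) hdiv' hU hW hU0 hW0 hΔW).2 trivial)
  | succ j ih =>
    intro hU hV hU0 hV0 hΔ
    have hlt : k < n := by omega
    have ih' : ∀ {U V : ℂ × ℂ → ℂ}, AnalyticAt ℂ U 0 → AnalyticAt ℂ V 0 → U 0 ≠ 0 → V 0 = 0 →
        powDelta n (k + 1) U V ≠ 0 →
        (e1 → Good F P (powMap n (k + 1) U V) S) ∧ (e2 → Good F P (powMap (k + 1) n V U) S) :=
      ih (by omega) (by omega)
    -- The first exponent is the order of ramification itself, whence the coefficients `1` and `0`.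
    have hdo : DivisibleOrder B (m + 1) n (k + 1) := by
      refine ⟨1, 0, by omega, ?_, by simpa using hdiv⟩
      have : 2 ^ (m + 2) = 2 * 2 ^ (m + 1) := by ring
      omega
    -- As `k + 1 ≤ n`, the first lift is to the direction `∞`, which subtracts the second row. Rays
    -- with `p ≤ 2 ^ (m + 2) ≤ B` are excluded because `p ∣ B!` and `B! ∣ n`.
    have hsep : Unseparated m (n - k) (n - (k + 1)) k (k + 1) := by
      refine Unseparated.chart_infty ?_
      rw [Nat.sub_add_cancel hkn, Nat.sub_add_cancel hlt]
      refine unseparated_of_dvd fun p hp hpm => ?_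
      exact (Nat.dvd_factorial hp (hpm.trans hB)).trans
        ((dvd_pow_self _ (Nat.succ_ne_zero m)).trans hdiv)
    have hdet : (n - k) * (k + 1) ≠ (n - (k + 1)) * k := by
      obtain ⟨i, rfl⟩ := Nat.exists_eq_add_of_lt hlt
      have e1 : k + i + 1 - k = i + 1 := by omega
      have e2 : k + i + 1 - (k + 1) = i := by omega
      rw [e1, e2]
      intro h
      have : (i + 1) * (k + 1) = i * k + i + k + 1 := by ring
      omega
    have hdet1 : n * (k + 1) ≠ n * k := by
      intro h
      have := Nat.eq_of_mul_eq_mul_left (by omega) h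
      omega
    have hC : ∀ {U V : ℂ × ℂ → ℂ}, AnalyticAt ℂ U 0 → AnalyticAt ℂ V 0 → U 0 ≠ 0 → V 0 ≠ 0 →
        (e1 → Good F P (monMap n n k (k + 1) U V) S ∧ NonLift (monMap n n k (k + 1) U V) S = ∅) ∧
        (e2 → Good F P (monMap k (k + 1) n n V U) S ∧
          NonLift (monMap k (k + 1) n n V U) S = ∅) := by
      intro U V hU hV hU0 hV0
      refine ⟨fun he => ?_, fun he => ?_⟩
      · have hW := analyticAt_mul_inv hV hU hV0
        have e := monMap_eq_chart_infty (a := n - k) (b := n - (k + 1)) (c := k) (d := k + 1)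
          (U := U) hV hV0
        rw [Nat.sub_add_cancel hkn, Nat.sub_add_cancel hlt] at e
        obtain ⟨g1, g2⟩ := (h.infty h0).good_monMap m he trivial hW hV
          (mul_ne_zero hU0 (inv_ne_zero hV0)) hV0 hdet hsep
        have hφ := isHolMapGerm_monMap hU hV hdet1
        have hd := dominant_monMap hU hV hU0 hV0 hdet1
        have hψ := isHolMapGerm_monMap hW hV hdet
        exact ⟨Good.of_chart h0 hφ hd hψ e g1, (nonLift_chart h0 hφ hd hψ e).trans g2⟩
      · have hW := analyticAt_mul_inv hV hU hV0
        have e := monMap_eq_chart_zero (a := k) (b := k + 1) (c := n - k) (d := n - (k + 1))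
          (V := U) hV hV0
        rw [Nat.add_sub_cancel' hkn, Nat.add_sub_cancel' hlt] at e
        have hdet' : k * (n - (k + 1)) ≠ (k + 1) * (n - k) := by
          rw [mul_comm k, mul_comm (k + 1)]; exact hdet.symm
        have hdet1' : k * n ≠ (k + 1) * n := by
          rw [mul_comm k, mul_comm (k + 1)]; exact hdet1.symm
        have hsep' : Unseparated m k (k + 1) (n - k) (n - (k + 1)) := fun p q hpq =>
          (hsep q p (by omega)).symm
        obtain ⟨g1, g2⟩ := (h.some h0 0).good_monMap m trivial ⟨rfl, he⟩ hV hW hV0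
          (mul_ne_zero hU0 (inv_ne_zero hV0)) hdet' hsep'
        have hφ := isHolMapGerm_monMap hV hU hdet1'
        have hd := dominant_monMap hV hU hV0 hU0 hdet1'
        have hψ := isHolMapGerm_monMap hV hW hdet'
        exact ⟨Good.of_chart h0 hφ hd hψ e g1, (nonLift_chart h0 hφ hd hψ e).trans g2⟩
    refine ⟨fun he => ?_, fun he => ?_⟩
    · obtain ⟨K, hK, hK'⟩ := exists_finite_of_nonLift (m + 1) h.closed h.finite h.height
        (a := n) (b := k + 1) hn (by omega)
      refine good_of_blowUp_powMap (s := id) h0 hlt hU hV hU0 hV0 (hVy hV0 hΔ) (Or.inl rfl) ?_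
        (fun hU hV hU0 hV0 => (hC hU hV hU0 hV0).1 he) hK hK'
      intro U V hU hV hU0 hΔ
      by_cases hV0 : V 0 = 0
      · exact (ih' hU hV hU0 hV0 hΔ).1 he
      · exact hT h hn (by omega) hdo (Or.inr (Or.inl ⟨h0, by omega, he⟩)) hU hV hU0 hV0 hΔ
    · obtain ⟨K, hK, hK'⟩ := exists_finite_of_nonLift (m + 1) h.closed h.finite h.height
        (a := k + 1) (b := n) (by omega) hn
      -- With the target coordinates exchanged, the invariant `V ^ a / U ^ b` is replaced by its
      -- inverse.
      refine good_of_blowUp_powMap (s := Prod.swap) h0 hlt hU hV hU0 hV0 (hVy hV0 hΔ) (Or.inr rfl)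
        ?_ (fun hU hV hU0 hV0 => (hC hU hV hU0 hV0).2 he) (hK.image Inv.inv) ?_
      · intro U V hU hV hU0 hΔ
        by_cases hV0 : V 0 = 0
        · exact (ih' hU hV hU0 hV0 hΔ).2 he
        · exact hT h (by omega) hn hdo.swap (Or.inr (Or.inr ⟨h0, by omega, he⟩)) hV hU hV0 hU0
            (by rw [powDelta_swap]; exact neg_ne_zero.mpr hΔ)
      · intro U V hU hV hU0 hV0 hΔ hne
        exact ⟨_, hK' hV hU hV0 hU0 (by rw [powDelta_swap]; exact neg_ne_zero.mpr hΔ) hne,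
          inv_div _ _⟩

/-- `B` is fixed in advance for all heights. At each level `PowersGood` comes first, from the level
below, and then serves for `RamificationsGood`. -/
theorem ramificationsGood_and_powersGood (F : FoliationGerm) {B : ℕ} (m : ℕ)
    (hB : 2 ^ (m + 1) ≤ B) : RamificationsGood F B m ∧ PowersGood F B m := by
  induction m with
  | zero =>
    refine ⟨?_, powersGood_zero F B⟩
    intro P S e1 e2 h n k hn hkn hk _ U V hU hV hU0 hV0 hΔ
    have h0 := h.origin_notMem
    have hne : k ≠ n := fun h => h0 (hk h)
    exact ramificationsGood_of_leaf h h0 (by omega) hU hV hU0 hV0 hΔ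
  | succ m ih =>
    obtain ⟨h1, h2⟩ := ih (le_trans (Nat.pow_le_pow_right (by omega) (by omega)) hB)
    have h3 : PowersGood F B (m + 1) := powersGood_succ h1 h2
    exact ⟨ramificationsGood_succ hB h1 h3, h3⟩

/-! ### A generic direction -/

/-- The linear change of coordinates `(u, v) ↦ (u, v + e u)`. -/
noncomputable def shear (e : ℂ) : ℂ × ℂ →L[ℂ] ℂ × ℂ :=
  (ContinuousLinearMap.fst ℂ ℂ ℂ).prod
    (ContinuousLinearMap.snd ℂ ℂ ℂ + e • ContinuousLinearMap.fst ℂ ℂ ℂ)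

@[simp] lemma shear_apply (e : ℂ) (q : ℂ × ℂ) : shear e q = (q.1, q.2 + e * q.1) := by
  simp [shear]

lemma AnalyticAt.eventually_frequently_ne_zero {h : ℂ × ℂ → ℂ} (hh : AnalyticAt ℂ h 0)
    (hn : ∃ᶠ q in 𝓝 0, h q ≠ 0) : ∀ᶠ z in 𝓝 (0 : ℂ × ℂ), ∃ᶠ q in 𝓝 z, h q ≠ 0 := by
  obtain ⟨r, hr, hb⟩ := Metric.eventually_nhds_iff_ball.mp hh.eventually_analyticAt
  filter_upwards [Metric.ball_mem_nhds (0 : ℂ × ℂ) hr] with z hz hz0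
  have h0 := AnalyticOnNhd.eqOn_zero_of_preconnected_of_eventuallyEq_zero (f := h)
    (U := Metric.ball 0 r) hb (convex_ball _ _).isPreconnected hz
    (by filter_upwards [hz0] with q hq using not_not.mp hq)
  refine hn ?_
  filter_upwards [Metric.ball_mem_nhds (0 : ℂ × ℂ) hr] with q hq
  simpa using h0 hq

/-- Near a point of the first axis that is close to the origin, the foliation is regular; in
suitable coordinates the first axis keeps its position and the second one is transversal. -/
lemma eventually_exists_adapted {φ : ℂ × ℂ → ℂ × ℂ} {F G : FoliationGerm}
    (hφ : ∀ z, AnalyticAt ℂ φ z) (h : IsPullback φ F G)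
    (hG : G.InvariantFst ∨ G.TransversalFst) :
    ∀ᶠ v in 𝓝[≠] (0 : ℂ), ∃ (e : ℂ) (H : FoliationGerm),
      IsPullback (fun q => φ (shear e q + (0, v))) F H ∧ Adapted True True H := by
  obtain ⟨h, hh, hn, hhe⟩ := h
  have hv : Tendsto (fun v : ℂ => ((0 : ℂ), v)) (𝓝[≠] 0) (𝓝 0) :=
    tendsto_inr_zero.mono_left nhdsWithin_le_nhds
  have hv' : Tendsto (fun v : ℂ => ((0 : ℂ), v)) (𝓝[≠] 0) (𝓝[≠] 0) :=
    tendsto_nhdsWithin_iff.mpr ⟨hv, by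
      filter_upwards [self_mem_nhdsWithin] with v hv hv0
      exact hv (congrArg Prod.snd hv0)⟩
  have hax : ∀ᶠ v in 𝓝[≠] (0 : ℂ), (∀ᶠ w in 𝓝 v, G.ω (0, w) (0, 1) = 0) ∨
      G.ω (0, v) (0, 1) ≠ 0 := by
    rcases hG with h1 | h1
    · exact (eventually_eventually_nhds.mpr h1).filter_mono nhdsWithin_le_nhds |>.mono
        fun v h => Or.inl h
    · have : ContinuousAt (fun q => G.ω q (0, 1)) 0 := G.analyticAt_coeff2.continuousAt
      exact (hv.eventually (this.eventually_ne h1)).mono fun v h => Or.inr h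
  filter_upwards [hax, hv.eventually hh.eventually_analyticAt,
    hv.eventually (hh.eventually_frequently_ne_zero hn),
    hv.eventually (eventually_eventually_nhds.mpr hhe), hv'.eventually G.isolated,
    hv.eventually G.analytic.eventually_analyticAt] with v h1 h2 h3 h4 h5 h6
  -- The vectors `(1, e)` span the plane, so the nonzero form does not kill all of them. This `e` is
  -- the slope of a curve transversal both to the foliation and to the first axis.
  obtain ⟨e, he⟩ : ∃ e : ℂ, G.ω (0, v) (1, e) ≠ 0 := by
    by_contra! hcon
    refine h5 ((G.ω_eq_zero_iff _).mpr ⟨hcon 0, ?_⟩)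
    have e1 : ((0 : ℂ), (1 : ℂ)) = (1, 1) - (1, 0) := by simp
    show G.ω (0, v) (0, 1) = 0
    rw [e1, map_sub, hcon, hcon, sub_zero]
  let τ : ℂ × ℂ → ℂ × ℂ := fun q => shear e q + (0, v)
  have hτ0 : τ 0 = (0, v) := by simp [τ]
  have hτ : ∀ q, HasFDerivAt τ (shear e) q := fun q => (shear e).hasFDerivAt.add_const _
  have hτa : AnalyticAt ℂ τ 0 := ((shear e).analyticAt 0).add analyticAt_const
  have hτt : Tendsto τ (𝓝 0) (𝓝 (0, v)) := by
    have := hτa.continuousAt.tendsto; rwa [hτ0] at this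
  have ha : AnalyticAt ℂ (fun q => (G.ω (τ q)).comp (shear e)) 0 := by
    have g1 : AnalyticAt ℂ (fun q => G.ω (τ q)) 0 :=
      AnalyticAt.comp (g := G.ω) (f := τ) (by rw [hτ0]; exact h6) hτa
    exact ((ContinuousLinearMap.compL ℂ (ℂ × ℂ) (ℂ × ℂ) ℂ).flip (shear e)).analyticAt _ |>.comp g1
  have h10 : (G.ω (τ 0)).comp (shear e) (1, 0) ≠ 0 := by
    simpa [hτ0] using he
  let H : FoliationGerm := 
    { ω := fun q => (G.ω (τ q)).comp (shear e)
      analytic := ha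
      isolated := by
        refine (ha.continuousAt.eventually_ne ?_).filter_mono nhdsWithin_le_nhds
        intro h0
        exact h10 (by rw [h0]; rfl) }
  refine ⟨e, H, ⟨fun q => h (τ q), AnalyticAt.comp (g := h) (f := τ) (by rw [hτ0]; exact h2) hτa,
    ?_, ?_⟩, Or.inl ⟨fun h0 => h10 (by rw [show (G.ω (τ 0)).comp (shear e) = 0 from h0]; rfl), ?_,
      fun _ => Or.inr h10⟩⟩
  · intro hcon
    refine h3 ?_
    have hσ : Tendsto (fun q : ℂ × ℂ => shear (-e) (q - (0, v))) (𝓝 (0, v)) (𝓝 0) := by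
      have : Continuous (fun q : ℂ × ℂ => shear (-e) (q - (0, v))) := by fun_prop
      have h7 := this.tendsto (0, v)
      rwa [sub_self, map_zero] at h7
    filter_upwards [hσ.eventually hcon] with q hq
    have : τ (shear (-e) (q - (0, v))) = q := by ext <;> simp [τ]
    rwa [this] at hq
  · filter_upwards [hτt.eventually h4] with q hq
    have : fderiv ℂ (fun q => φ (shear e q + (0, v))) q = (fderiv ℂ φ (τ q)).comp (shear e) :=
      ((hφ (τ q)).differentiableAt.hasFDerivAt.comp q (hτ q)).fderiv
    rw [this, ← ContinuousLinearMap.comp_assoc]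
    show ((F.ω (φ (τ q))).comp (fderiv ℂ φ (τ q))).comp (shear e) = _
    rw [hq]; rfl
  · intro _
    rcases h1 with h1 | h1
    · left
      have : Tendsto (fun w : ℂ => w + v) (𝓝 0) (𝓝 v) := by
        have : Continuous (fun w : ℂ => w + v) := by fun_prop
        simpa using this.tendsto 0
      filter_upwards [this.eventually h1] with w hw
      simpa [H, τ] using hw
    · right
      show (G.ω (τ 0)).comp (shear e) (0, 1) ≠ 0
      simpa [hτ0] using h1

/-- There is a direction over which no blowing-up takes place and at which the foliation is regular
and well placed with respect to suitable coordinate axes. -/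
lemma IsAdaptedTree.exists_generic_direction {F : FoliationGerm} {S : Set InfNearPoint} {m : ℕ}
    (h : IsAdaptedTree F id S False False m) (h0 : .origin ∈ S) :
    ∃ (d e : ℂ) (H : FoliationGerm), sub S (OnePoint.some d) = ∅ ∧
      IsPullback (blowUpChart (OnePoint.some d) ∘ shear e) F H ∧ Adapted True True H := by
  have hK : {c : ℂ | (sub S (OnePoint.some c)).Nonempty}.Finite :=
    Set.Finite.preimage (f := OnePoint.some) OnePoint.coe_injective.injOn
      (finite_directions h.finite h.closed)
  obtain ⟨d, hd⟩ := hK.exists_notMem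
  obtain ⟨G, hG, hA⟩ := h.adapted (.above .origin (OnePoint.some d)) ⟨fun hS => hd ⟨.origin, hS⟩, h0⟩
  have hA1 : G.InvariantFst ∨ G.TransversalFst := by
    rcases hA with hA | hA
    · exact hA.2.1 trivial
    · exact Or.inl (hA.2.1 trivial)
  -- At `d` the foliation may still be singular; it is regular at the nearby directions `d + v`,
  -- which also avoid the finitely many directions of centres.
  have hne : ∀ᶠ v in 𝓝[≠] (0 : ℂ), d + v ∉ {c : ℂ | (sub S (OnePoint.some c)).Nonempty} := by
    have hc : Tendsto (fun v => d + v) (𝓝 0) (𝓝 d) := by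
      have : Continuous (fun v : ℂ => d + v) := by fun_prop
      simpa using this.tendsto 0
    exact (hc.eventually (hK.isClosed.isOpen_compl.mem_nhds hd)).filter_mono nhdsWithin_le_nhds
  obtain ⟨v, ⟨e, H, h1, h2⟩, h3⟩ := ((eventually_exists_adapted
    (analyticAt_blowUpChart (OnePoint.some d)) hG hA1).and hne).exists
  refine ⟨d + v, e, H, Set.not_nonempty_iff_eq_empty.mp h3, h1.congr ?_, h2⟩
  refine Eventually.of_forall fun q => ?_
  simp only [Function.comp, blowUpChart_some, shear_apply]
  ext
  · simp
  · simp only [Prod.fst_add, Prod.snd_add]; ring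

/-! ### The ramification along a generic curve -/

/-- The germ `(t, y) ↦ (x, d x + e x² + tⁿ)`, where `x = t ^ j W`. -/
def curveMap (d e : ℂ) (n j : ℕ) (W : ℂ × ℂ → ℂ) (q : ℂ × ℂ) : ℂ × ℂ :=
  (q.1 ^ j * W q, d * (q.1 ^ j * W q) + e * (q.1 ^ j * W q) ^ 2 + q.1 ^ n)

/-- The components generate the ideal `(t ^ k y, t ^ n)`, which is not principal for `k < n`. -/
lemma not_liftsS_curveMap {S : Set InfNearPoint} (h0 : .origin ∈ S) (d e : ℂ) {n k : ℕ}
    (hkn : k < n) : ¬ LiftsS (curveMap d e n k Prod.snd) S := by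
  intro h
  obtain ⟨g, hg, h1 | ⟨h1, hg0⟩⟩ := h.dvd h0
  · have ha : AnalyticAt ℂ (fun q : ℂ × ℂ => g q - d - e * (q.1 ^ k * q.2)) 0 :=
      (hg.sub analyticAt_const).sub
        (analyticAt_const.mul ((analyticAt_fst.pow k).mul analyticAt_snd))
    refine pow_mul_ne_mul (U := fun _ => 1) analyticAt_const one_ne_zero analyticAt_snd rfl
      (eventually_mem_nhdsWithin.mono fun y hy => hy) (n - k) ha
      (eventually_eq_of_fst_ne ((analyticAt_fst.pow (n - k)).mul analyticAt_const)
        (analyticAt_snd.mul ha) ?_)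
    filter_upwards [h1] with q hq hq0
    have hn : q.1 ^ n = q.1 ^ k * q.1 ^ (n - k) := by rw [← pow_add]; congr 1; omega
    simp only [curveMap, hn] at hq
    refine mul_left_cancel₀ (pow_ne_zero k hq0) ?_
    linear_combination hq
  · have ha : AnalyticAt ℂ (fun q : ℂ × ℂ => 1 - (d + e * (q.1 ^ k * q.2)) * g q) 0 :=
      analyticAt_const.sub ((analyticAt_const.add
        (analyticAt_const.mul ((analyticAt_fst.pow k).mul analyticAt_snd))).mul hg)
    have hne := ha.continuousAt.eventually_ne (y := 0) (by simp [hg0])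
    have h2 := eventually_eq_of_fst_ne (analyticAt_snd.mul ha) ((analyticAt_fst.pow (n - k)).mul hg)
      (by
        filter_upwards [h1] with q hq hq0
        have hn : q.1 ^ n = q.1 ^ k * q.1 ^ (n - k) := by rw [← pow_add]; congr 1; omega
        simp only [curveMap, hn] at hq
        refine mul_left_cancel₀ (pow_ne_zero k hq0) ?_
        simp only [Pi.mul_apply, Pi.pow_apply]
        linear_combination hq)
    obtain ⟨y, ⟨h3, h4⟩, hy⟩ := (((tendsto_inr_zero.eventually (hne.and h2)).filter_mono
      nhdsWithin_le_nhds).and (eventually_mem_nhdsWithin (a := (0 : ℂ)) (s := {0}ᶜ))).exists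
    have : n - k ≠ 0 := by omega
    simp only [Pi.mul_apply, Pi.pow_apply, zero_pow this, zero_mul] at h4
    exact (mul_ne_zero hy h3) h4

lemma curveMap_chart_some (d e c : ℂ) (n k : ℕ) :
    curveMap d e n k Prod.snd ∘ blowUpChart (OnePoint.some c)
      = curveMap d e n (k + 1) (fun q => q.2 + c) := by
  funext q
  have e1 : q.1 ^ k * (q.1 * (q.2 + c)) = q.1 ^ (k + 1) * (q.2 + c) := by ring
  simp only [Function.comp, blowUpChart_some, curveMap, e1]

lemma curveMap_chart_infty (d e : ℂ) {n k : ℕ} (hkn : k < n) :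
    curveMap d e n k Prod.snd ∘ blowUpChart OnePoint.infty =ᶠ[𝓝 0]
      (blowUpChart (OnePoint.some d) ∘ shear e) ∘
        monMap k (k + 1) (n - k) (n - (k + 1)) (fun _ => 1) (fun _ => 1) := by
  refine Eventually.of_forall fun q => ?_
  have e1 : (q.1 * q.2) ^ n = q.1 ^ k * q.1 ^ (n - k) * (q.2 ^ (k + 1) * q.2 ^ (n - (k + 1))) := by
    rw [← pow_add, ← pow_add, mul_pow]; congr 2 <;> omega
  simp only [Function.comp, blowUpChart_some, blowUpChart_infty, curveMap, monMap, shear_apply, e1]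
  ext <;> simp only <;> ring

/-- Off the transform of `y = 0`, `y / x` is `d + e x` plus a power of `t` times a unit. For `j < n`
the germ thus lifts to the direction `d`. -/
lemma curveMap_eq_chart {W : ℂ × ℂ → ℂ} (hW : AnalyticAt ℂ W 0) (hW0 : W 0 ≠ 0) (d e : ℂ)
    {n j : ℕ} (hjn : j ≤ n) :
    curveMap d e n j W =ᶠ[𝓝 0] (blowUpChart (OnePoint.some d) ∘ shear e) ∘
      powMap j (n - j) W (fun q => (W q)⁻¹) := by
  filter_upwards [hW.continuousAt.eventually_ne hW0] with q hq
  have e1 : q.1 ^ n = q.1 ^ j * q.1 ^ (n - j) := by rw [← pow_add]; congr 1; omega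
  simp only [Function.comp, blowUpChart_some, curveMap, powMap, shear_apply, e1]
  ext
  · rfl
  · field_simp
    ring

lemma curveMap_eq_powMap (d e : ℂ) (n : ℕ) (W : ℂ × ℂ → ℂ) :
    curveMap d e n n W = powMap n n W (fun q => d * W q + 1 + e * (q.1 ^ n * W q ^ 2)) := by
  funext q
  simp only [curveMap, powMap]
  ext
  · rfl
  · simp only; ring

lemma powDelta_curveMap (d e : ℂ) {n : ℕ} (hn : 1 ≤ n) (c : ℂ) :
    powDelta n n (fun q => q.2 + c)
      (fun q : ℂ × ℂ => d * (q.2 + c) + 1 + e * (q.1 ^ n * (q.2 + c) ^ 2)) ≠ 0 := by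
  have e1 : pd2 (fun q : ℂ × ℂ => q.2 + c) 0 = 1 := by
    have := pd2_eq_deriv (f := fun q : ℂ × ℂ => q.2 + c) (q := 0) (by fun_prop)
    exact this.unique ((hasDerivAt_id (0 : ℂ)).add_const c)
  have hn0 : n ≠ 0 := by omega
  have e2 : pd2 (fun q : ℂ × ℂ => d * (q.2 + c) + 1 + e * (q.1 ^ n * (q.2 + c) ^ 2)) 0 = d := by
    have := pd2_eq_deriv (f := fun q : ℂ × ℂ => d * (q.2 + c) + 1 + e * (q.1 ^ n * (q.2 + c) ^ 2))
      (q := 0) (by fun_prop)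
    simp only [Prod.fst_zero, Prod.snd_zero, zero_pow hn0, zero_mul, mul_zero, add_zero] at this
    refine this.unique ?_
    simpa using (((hasDerivAt_id (0 : ℂ)).add_const c).const_mul d).add_const 1
  have : (n : ℂ) ≠ 0 := by exact_mod_cast hn0
  simp only [powDelta, e1, e2, Prod.fst_zero, Prod.snd_zero, zero_pow hn0]
  ring_nf
  simpa using this

section
variable {F : FoliationGerm} {S : Set InfNearPoint} {B m n : ℕ} {d e : ℂ} {H : FoliationGerm}

/-- Lifting a map germ to a direction over which there is no centre and where the foliation is well
placed. -/
lemma good_of_generic_direction (h0 : .origin ∈ S) (hS : sub S (OnePoint.some d) = ∅)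
    (hH : IsPullback (blowUpChart (OnePoint.some d) ∘ shear e) F H) {φ ψ : ℂ × ℂ → ℂ × ℂ}
    (hψ : IsHolMapGerm ψ) (hd : Dominant ψ)
    (hφ : φ =ᶠ[𝓝 0] (blowUpChart (OnePoint.some d) ∘ shear e) ∘ ψ) (h : SimpleAfter H ψ) :
    LiftsS φ S ∧ SimpleAfter F φ := by
  have hs : IsHolMapGerm (shear e) := ⟨(shear e).analyticAt 0, map_zero _⟩
  refine ⟨LiftsS.of_chart h0 (liftsS_of_origin_notMem (by rw [hS]; simp) (hs.comp hψ)) hφ, ?_⟩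
  exact (h.of_comp ((isHolMapGerm_blowUpChart _).comp hs).1 hH hψ hd).congr hφ.symm

/-- The ramification of order `n` along a generic curve desingularizes. -/
theorem good_curveMap (h : IsAdaptedTree F id S False False (m + 1)) (h0 : .origin ∈ S)
    (hR : RamificationsGood F B m) (hn : 2 ≤ n) (hn2 : Even n) (hdvd : B.factorial ^ m ∣ n)
    (hS : sub S (OnePoint.some d) = ∅)
    (hH : IsPullback (blowUpChart (OnePoint.some d) ∘ shear e) F H) (hA : Adapted True True H) :
    Good F id (curveMap d e n 0 Prod.snd) S := by
  have hW : ∀ c, AnalyticAt ℂ (fun q : ℂ × ℂ => q.2 + c) 0 := fun c =>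
    analyticAt_snd.add analyticAt_const
  have hV : ∀ c, AnalyticAt ℂ
      (fun q : ℂ × ℂ => d * (q.2 + c) + 1 + e * (q.1 ^ n * (q.2 + c) ^ 2)) 0 := fun c =>
    ((analyticAt_const.mul (hW c)).add analyticAt_const).add
      (analyticAt_const.mul ((analyticAt_fst.pow n).mul ((hW c).pow 2)))
  -- This is the parametrization of `E₁` by the last divisor; only finitely many of its points go to
  -- directions with centres.
  have hinj : Function.Injective fun c : ℂ => d + c⁻¹ := fun a b hab => by simpa using hab
  have key : ∀ k j : ℕ, n = k + j → Good F id (curveMap d e n k (fun q => q.2 + 0)) S := by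
    intro k j
    induction j generalizing k with
    | zero =>
      intro hk
      obtain rfl : n = k := hk
      have hV0 : d * ((0 : ℂ × ℂ).2 + 0) + 1 + e * ((0 : ℂ × ℂ).1 ^ n * ((0 : ℂ × ℂ).2 + 0) ^ 2) ≠ 0 := by
        simp
      have hΔ := powDelta_curveMap d e (n := n) (by omega) 0
      rw [curveMap_eq_powMap]
      -- The point `c = 0` of the last divisor goes to the direction `∞` of `E₁`, where the second
      -- axis is the divisor; hence the swapped half of `hR`.
      have ee := powMap_eq_chart_infty (a := 0) (b := n) (U := fun q => q.2 + 0) (hV 0) hV0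
      rw [zero_add] at ee
      have hX := analyticAt_mul_inv (hV 0) (hW 0) hV0
      have hX0 : ((0 : ℂ × ℂ).2 + 0) * (d * ((0 : ℂ × ℂ).2 + 0) + 1 +
          e * ((0 : ℂ × ℂ).1 ^ n * ((0 : ℂ × ℂ).2 + 0) ^ 2))⁻¹ = 0 := by simp
      refine Good.of_chart h0
        (isHolMapGerm_powMap (hW 0) (hV 0) (fun h => by omega) (fun h => by omega))
        (dominant_powMap (hW 0) (hV 0) (fun h => by omega) (fun h => by omega) hΔ)
        (isHolMapGerm_powMap hX (hV 0) (fun _ => hX0) (fun h => by omega)) ee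
        ((hR (h.infty h0) (n := n) (k := 0) (by omega) (by omega) (fun h => by omega) hdvd (hV 0) hX
          hV0 hX0 ?_).2 trivial)
      rw [powDelta_swap, powDelta_mul_inv_fst (hW 0) (hV 0) hV0, zero_add]
      exact neg_ne_zero.mpr (div_ne_zero hΔ hV0)
    | succ j ih =>
      intro hk
      have hkn : k < n := by omega
      -- The intermediate divisors are mapped to the single point `d`, where the lift ends because
      -- there is no centre.
      have hgen : k + 1 < n → ∀ c : ℂ, c ≠ 0 →
          LiftsS (curveMap d e n (k + 1) (fun q => q.2 + c)) S ∧
          SimpleAfter F (curveMap d e n (k + 1) (fun q => q.2 + c)) := by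
        intro hk1 c hc
        have hc0 : (0 : ℂ × ℂ).2 + c ≠ 0 := by simpa using hc
        have hI : AnalyticAt ℂ (fun q : ℂ × ℂ => (q.2 + c)⁻¹) 0 := (hW c).inv hc0
        have hΔ : powDelta (k + 1) (n - (k + 1)) (fun q => q.2 + c) (fun q => (q.2 + c)⁻¹) ≠ 0 := by
          have e1 : pd2 (fun q : ℂ × ℂ => q.2 + c) 0 = 1 := by
            have := pd2_eq_deriv (f := fun q : ℂ × ℂ => q.2 + c) (q := 0) (by fun_prop)
            exact this.unique ((hasDerivAt_id (0 : ℂ)).add_const c)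
          simp only [powDelta, pd2_inv (hW c).differentiableAt hc0, e1, Prod.snd_zero, zero_add]
          rw [Nat.cast_sub hk1.le]
          field_simp
          push_cast
          ring_nf
          simpa using ⟨by omega, hc⟩
        have h1 := isHolMapGerm_powMap (a := k + 1) (b := n - (k + 1)) (hW c) hI
          (fun h => by omega) (fun h => by omega)
        exact good_of_generic_direction h0 hS hH h1
          (dominant_powMap (hW c) hI (fun h => by omega) (fun h => by omega) hΔ)
          (curveMap_eq_chart (hW c) hc0 d e hk1.le)
          (hA.simpleAfter_powMap (hW c) hI (by omega) (by omega) hc0 (inv_ne_zero hc0) hΔ)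
      -- On the last divisor the point `c` goes to `d + 1/c`, and the lift is ramified to order `n`
      -- over `E₁`.
      have hspec : k + 1 = n → ∀ c : ℂ, c ≠ 0 →
          Good F id (curveMap d e n (k + 1) (fun q => q.2 + c)) S ∧
          (sub S (OnePoint.some (d + c⁻¹)) = ∅ →
            LiftsS (curveMap d e n (k + 1) (fun q => q.2 + c)) S) := by
        intro hk1 c hc
        have hc0 : (0 : ℂ × ℂ).2 + c ≠ 0 := by simpa using hc
        rw [hk1, curveMap_eq_powMap]
        have hΔ := powDelta_curveMap d e (n := n) (by omega) c
        have ee := powMap_eq_chart_some (a := n) (V := fun q : ℂ × ℂ =>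
          d * (q.2 + c) + 1 + e * (q.1 ^ n * (q.2 + c) ^ 2)) (hW c) hc0 (d + c⁻¹)
        have hX : AnalyticAt ℂ (fun q : ℂ × ℂ => (d * (q.2 + c) + 1 +
            e * (q.1 ^ n * (q.2 + c) ^ 2)) * (q.2 + c)⁻¹ + -(d + c⁻¹)) 0 :=
          (analyticAt_mul_inv (hW c) (hV c) hc0).add analyticAt_const
        have hX0 : (d * ((0 : ℂ × ℂ).2 + c) + 1 +
            e * ((0 : ℂ × ℂ).1 ^ n * ((0 : ℂ × ℂ).2 + c) ^ 2)) * ((0 : ℂ × ℂ).2 + c)⁻¹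
              + -(d + c⁻¹) = 0 := by
          simp only [Prod.fst_zero, Prod.snd_zero, zero_add, zero_pow (by omega : n ≠ 0)]
          field_simp
          ring
        have h1 := isHolMapGerm_powMap (a := n) (b := 0) (hW c) hX (fun h => by omega)
          (fun _ => hX0)
        refine ⟨Good.of_chart h0
          (isHolMapGerm_powMap (hW c) (hV c) (fun h => by omega) (fun h => by omega))
          (dominant_powMap (hW c) (hV c) (fun h => by omega) (fun h => by omega) hΔ) h1 ee
          ((hR (h.some h0 _) (n := n) (k := 0) (by omega) (by omega) (fun h => by omega) hdvd (hW c)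
            hX hc0 hX0 ?_).1 trivial), fun hemp =>
          LiftsS.of_chart h0 (liftsS_of_origin_notMem (by rw [hemp]; simp) h1) ee⟩
        rw [powDelta_mul_inv_add_const (hW c) (hV c) hc0]
        exact div_ne_zero hΔ hc0
      have hinf : LiftsS (curveMap d e n k Prod.snd ∘ blowUpChart OnePoint.infty) S ∧
          SimpleAfter F (curveMap d e n k Prod.snd ∘ blowUpChart OnePoint.infty) := by
        have hdet : k * (n - (k + 1)) ≠ (k + 1) * (n - k) := by
          obtain ⟨i, rfl⟩ := Nat.exists_eq_add_of_lt hkn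
          have e1 : k + i + 1 - k = i + 1 := by omega
          have e2 : k + i + 1 - (k + 1) = i := by omega
          rw [e1, e2]
          intro h
          have : (k + 1) * (i + 1) = k * i + i + k + 1 := by ring
          omega
        -- Here `n` must be even: for `n = 2 k + 1` the two monomials would not be comparable.
        have hsep : (k ≤ n - k ∧ k + 1 ≤ n - (k + 1)) ∨ (n - k ≤ k ∧ n - (k + 1) ≤ k + 1) := by
          obtain ⟨i, rfl⟩ := hn2
          omega
        exact good_of_generic_direction h0 hS hH
          (isHolMapGerm_monMap analyticAt_const analyticAt_const hdet)
          (dominant_monMap analyticAt_const analyticAt_const one_ne_zero one_ne_zero hdet)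
          (curveMap_chart_infty d e hkn)
          (hA.simpleAfter_monMap analyticAt_const analyticAt_const one_ne_zero one_ne_zero hdet hsep)
      simp only [add_zero] at ih ⊢
      refine Good.of_blowUp (not_liftsS_curveMap h0 d e hkn) ?_ ?_ (nonLift_eq_empty hinf.1)
      · intro δ
        rcases δ with _ | c
        · exact Good.of_lifts hinf.1 hinf.2
        · show Good F id (_ ∘ blowUpChart (OnePoint.some c)) S
          rw [curveMap_chart_some]
          by_cases hc : c = 0
          · rw [hc]
            simpa using ih (k + 1) (by omega)
          · rcases lt_or_eq_of_le (Nat.succ_le_of_lt hkn) with hk1 | hk1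
            · exact Good.of_lifts (hgen hk1 c hc).1 (hgen hk1 c hc).2
            · exact (hspec hk1 c hc).1
      · have hf : {c : ℂ | (sub S (OnePoint.some (d + c⁻¹))).Nonempty}.Finite :=
          Set.Finite.preimage (f := fun c : ℂ => OnePoint.some (d + c⁻¹))
            (OnePoint.coe_injective.comp hinj).injOn (finite_directions h.finite h.closed)
        refine ((Set.finite_singleton 0).union hf).subset fun c hc => ?_
        by_contra hcon
        simp only [Set.mem_union, Set.mem_singleton_iff, not_or] at hcon
        obtain ⟨hc0, hc1⟩ := hcon
        have hc' : (NonLift (curveMap d e n (k + 1) (fun q => q.2 + c)) S).Nonempty := by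
          rw [← curveMap_chart_some]; exact hc
        have hl : LiftsS (curveMap d e n (k + 1) (fun q => q.2 + c)) S := by
          rcases lt_or_eq_of_le (Nat.succ_le_of_lt hkn) with hk1 | hk1
          · exact (hgen hk1 c hc0).1
          · exact (hspec hk1 c hc0).2 (Set.not_nonempty_iff_eq_empty.mp hc1)
        rw [nonLift_eq_empty hl] at hc'
        exact Set.not_nonempty_empty hc'
  simpa using key 0 n (by omega)

end

/-! ### Sequences of blowing-ups and trees of centres -/

lemma pointsOverOrigin_eq (L : List InfNearPoint) : pointsOverOrigin L = ptsS {p | p ∈ L} := rfl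

lemma liftsTo_iff {φ : ℂ × ℂ → ℂ × ℂ} {L : List InfNearPoint} :
    LiftsTo φ L ↔ LiftsS φ {p | p ∈ L} := Iff.rfl

lemma IsBlowUpSequence.treeClosed {L : List InfNearPoint} (h : IsBlowUpSequence L) :
    TreeClosed {p | p ∈ L} := by
  induction L with
  | nil => intro p d hp; simp at hp
  | cons a L ih =>
    intro p d hp
    rcases List.mem_cons.mp hp with rfl | hp
    · exact List.mem_cons_of_mem _ h.2.2
    · exact List.mem_cons_of_mem _ (ih h.1 p d hp)

/-- A point of maximal depth lies under no other point of `N`, so it can be blown up last. -/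
lemma TreeClosed.exists_blowUpSequence {N : Set InfNearPoint} (hN : N.Finite) (h : TreeClosed N) :
    ∃ M, IsBlowUpSequence M ∧ {p | p ∈ M} = N := by
  induction hk : N.ncard generalizing N with
  | zero =>
    rw [Set.ncard_eq_zero hN] at hk
    exact ⟨[], trivial, by simp [hk]⟩
  | succ k ih =>
    have hne : N.Nonempty := by
      rw [← Set.ncard_pos hN]; omega
    obtain ⟨p, hp, hmax⟩ := Set.exists_max_image N InfNearPoint.depth hN hne
    have hcl : TreeClosed (N \ {p}) := by
      intro q d hq
      refine ⟨h q d hq.1, fun hqp => ?_⟩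
      rw [Set.mem_singleton_iff] at hqp
      have := hmax _ hq.1
      simp [InfNearPoint.depth, hqp] at this
    obtain ⟨M, hM, hMN⟩ := ih (hN.subset Set.sdiff_subset) hcl (by
      rw [Set.ncard_sdiff_singleton_of_mem hp, hk]; rfl)
    refine ⟨p :: M, ⟨hM, ?_⟩, ?_⟩
    · rw [pointsOverOrigin_eq, hMN]
      cases p with
      | origin => exact ⟨fun h => h.2 rfl, trivial⟩
      | above q d =>
        refine ⟨fun h => h.2 rfl, h q d hp, fun hqp => ?_⟩
        have := congrArg InfNearPoint.depth (Set.mem_singleton_iff.mp hqp)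
        simp [InfNearPoint.depth] at this
    · have : {q | q ∈ p :: M} = insert p {q | q ∈ M} := by ext; simp
      rw [this, hMN, Set.insert_sdiff_singleton, Set.insert_eq_of_mem hp]

/-- If `p` lies directly over an element of `N`, it is itself a point of the blown-up surface;
otherwise its projection factors through that of its parent, which is not in `N` either. -/
lemma liftsS_proj_of_notMem {N : Set InfNearPoint} {p : InfNearPoint} (hp : p ∉ N) :
    LiftsS p.proj N := by
  induction p with
  | origin => exact ⟨.origin, ⟨hp, trivial⟩, id, isHolMapGerm_id, EventuallyEq.rfl⟩
  | above p d ih =>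
    by_cases h : p ∈ N
    · exact ⟨.above p d, ⟨hp, h⟩, id, isHolMapGerm_id, EventuallyEq.rfl⟩
    · exact (ih h).comp (isHolMapGerm_blowUpChart d)

/-- The points at which a map does not lift are the centres of the elimination of its
indeterminations. -/
lemma isEliminationOfIndet_of_nonLift {L M : List InfNearPoint} {ρ : ℂ × ℂ → ℂ × ℂ}
    (hM : IsBlowUpSequence M) (h : {p | p ∈ M} = NonLift ρ {p | p ∈ L}) :
    IsEliminationOfIndet L ρ M := by
  refine ⟨hM, fun p hp => ?_, fun M' _ hM' p hp => ?_⟩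
  · rw [pointsOverOrigin_eq, h] at hp
    exact liftsTo_iff.mpr (not_not.mp hp.1)
  -- Minimality: a point of a surface on which the map is holomorphic is not in `NonLift`, hence
  -- maps to the blowing-up of that set.
  · rw [liftsTo_iff, h]
    exact liftsS_proj_of_notMem (not_not.mpr (liftsTo_iff.mp (hM' p hp)))

lemma excFst_and_excSnd_of_flags (p : InfNearPoint) :
    ((flags False False p).1 → p.ExcFst) ∧ ((flags False False p).2 → p.ExcSnd) := by
  have h0 : ∀ p : InfNearPoint, p.proj (0, 0) = 0 := fun p => p.isHolMapGerm_proj.2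
  induction p with
  | origin => exact ⟨False.elim, False.elim⟩
  | above p d ih =>
    rcases d with _ | c
    · refine ⟨fun h v => ?_, fun _ u => ?_⟩
      · simpa [InfNearPoint.proj, blowUpChart] using ih.1 h v
      · simpa [InfNearPoint.proj, blowUpChart] using h0 p
    · refine ⟨fun _ v => ?_, fun h u => ?_⟩
      · simpa [InfNearPoint.proj, blowUpChart] using h0 p
      · simpa [InfNearPoint.proj, blowUpChart, h.1] using ih.2 h.2 u

lemma FoliationGerm.IsReductionOfSingularities.exists_isAdaptedTree {F : FoliationGerm}
    {L : List InfNearPoint} (h : F.IsReductionOfSingularities L) :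
    ∃ m, IsAdaptedTree F id {p | p ∈ L} False False (m + 1) := by
  have hfin : {p | p ∈ L}.Finite := L.finite_toSet
  obtain ⟨m, hm⟩ := (hfin.image InfNearPoint.depth).bddAbove
  refine ⟨m, h.1.treeClosed, hfin, fun p hp => Nat.lt_succ_of_le (hm ⟨p, hp, rfl⟩), analyticAt_id,
    fun p hp => ?_⟩
  obtain ⟨G, hG, hG'⟩ := h.2 p hp
  obtain ⟨f1, f2⟩ := excFst_and_excSnd_of_flags p
  exact ⟨G, hG, hG'.imp (fun h => ⟨h.1, h.2.1 ∘ f1, h.2.2.1 ∘ f2⟩)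
    (fun h => ⟨h.1, h.2.1 ∘ f1, h.2.2 ∘ f2⟩)⟩

/-! ### Pullback by a ramification -/

/-- The pullback of a foliation by a change of coordinates. -/
lemma IsBiholGerm.exists_pullback {f : ℂ × ℂ → ℂ × ℂ} (hf : IsBiholGerm f) (F : FoliationGerm) :
    ∃ G : FoliationGerm, ∀ q, (F.ω (f q)).comp (fderiv ℂ f q) = G.ω q := by
  obtain ⟨hf, g, hg, hgf, hfg⟩ := hf
  have ha : AnalyticAt ℂ (fun q => (F.ω (f q)).comp (fderiv ℂ f q)) 0 := by
    have h1 : AnalyticAt ℂ (fun q => F.ω (f q)) 0 :=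
      AnalyticAt.comp (g := F.ω) (f := f) (by rw [hf.2]; exact F.analytic) hf.1
    exact ((ContinuousLinearMap.compL ℂ (ℂ × ℂ) (ℂ × ℂ) ℂ).analyticAt_bilinear _).comp₂ h1
      hf.1.fderiv
  refine ⟨⟨_, ha, ?_⟩, fun _ => rfl⟩
  rw [eventually_nhdsWithin_iff]
  filter_upwards [hgf, hf.tendsto.eventually (eventually_nhdsWithin_iff.mp F.isolated),
    hf.tendsto.eventually (eventually_eventually_nhds.mpr hfg), hf.1.eventually_analyticAt,
    hf.tendsto.eventually hg.1.eventually_analyticAt] with q h1 h2 h3 h4 h5 hq h6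
  have hq' : f q ≠ 0 := by
    intro h0
    rw [Function.comp_apply, h0, hg.2] at h1
    exact hq h1.symm
  refine h2 hq' ?_
  have h7 : (fderiv ℂ f q).comp (fderiv ℂ g (f q)) = ContinuousLinearMap.id ℂ _ := by
    have h8 : f ∘ g =ᶠ[𝓝 (f q)] id := h3
    have h9 : g (f q) = q := h1
    have := h8.fderiv_eq (𝕜 := ℂ)
    rw [fderiv_id, fderiv_comp _ (by rw [h9]; exact h4.differentiableAt) h5.differentiableAt,
      h9] at this
    exact this
  calc F.ω (f q) = (F.ω (f q)).comp ((fderiv ℂ f q).comp (fderiv ℂ g (f q))) := by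
        rw [h7, ContinuousLinearMap.comp_id]
    _ = 0 := by rw [← ContinuousLinearMap.comp_assoc, h6, ContinuousLinearMap.zero_comp]

/-- The pullback of a foliation by the standard ramification. -/
lemma exists_pullback_pow (F : FoliationGerm) {n : ℕ} (hn : 1 ≤ n) :
    ∃ (G : FoliationGerm) (j : ℕ), ∀ᶠ q : ℂ × ℂ in 𝓝 0, (F.ω (q.1 ^ n, q.2)).comp
      (fderiv ℂ (fun q : ℂ × ℂ => (q.1 ^ n, q.2)) q) = q.1 ^ j • G.ω q := by
  obtain ⟨n, rfl⟩ := Nat.exists_eq_add_of_le' hn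
  set σ : ℂ × ℂ → ℂ × ℂ := fun q => (q.1 ^ (n + 1), q.2) with hσ
  have hσh : IsHolMapGerm σ := isHolMapGerm_mk (analyticAt_fst.pow _) analyticAt_snd (by simp) rfl
  have e1 : ∀ q : ℂ × ℂ, pd1 (fun z : ℂ × ℂ => z.1 ^ (n + 1)) q = (n + 1) * q.1 ^ n := fun q => by
    have := pd1_eq_deriv (f := fun z : ℂ × ℂ => z.1 ^ (n + 1)) (q := q) (by fun_prop)
    simpa using this.unique (hasDerivAt_pow (n + 1) q.1)
  have p1 : ∀ q, F.pull1 σ q = (n + 1) * q.1 ^ n * F.coeff1 (σ q) := fun q => by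
    simp only [pull1, hσ, e1, pd1_snd]; ring
  have p2 : ∀ q, F.pull2 σ q = F.coeff2 (σ q) := fun q => by
    simp only [pull2, hσ, pd2_fst_pow, pd2_snd]; ring
  have hd : ∀ q, DifferentiableAt ℂ σ q := fun q => by fun_prop
  have hn0 : (n : ℂ) + 1 ≠ 0 := by exact_mod_cast n.succ_ne_zero
  have hσ0 : ∀ q, q ≠ 0 → σ q ≠ 0 := fun q hq h => by
    refine hq ?_
    simp only [hσ, Prod.mk_eq_zero] at h
    exact Prod.ext (pow_eq_zero_iff (by omega) |>.mp h.1) h.2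
  have hiso : ∀ᶠ q in 𝓝 0, q ≠ 0 → F.coeff1 (σ q) ≠ 0 ∨ F.coeff2 (σ q) ≠ 0 := by
    filter_upwards [hσh.tendsto.eventually F.isolated_coeff] with q hq h0 using hq (hσ0 q h0)
  have hc1 := hσh.comp_analyticAt F.analyticAt_coeff1
  have hc2 := hσh.comp_analyticAt F.analyticAt_coeff2
  have hline : AnalyticAt ℂ (fun y : ℂ => F.coeff2 (0, y)) 0 :=
    AnalyticAt.comp (g := F.coeff2) (f := fun y : ℂ => ((0 : ℂ), y)) F.analyticAt_coeff2
      (analyticAt_const.prod analyticAt_id)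
  -- The only possible common factor is a power of `t`. If `x = 0` is invariant, `t ^ n` splits off;
  -- otherwise the second coefficient is not identically zero on `t = 0` and the pullback is already
  -- saturated.
  rcases hline.eventually_eq_zero_or_eventually_ne_zero with hz | hz
  · obtain ⟨B, hB, hBe⟩ := exists_eq_fst_mul F.analyticAt_coeff2 hz
    have hBe' := hσh.tendsto.eventually hBe
    have hB' := hσh.comp_analyticAt hB
    have iso : ∀ᶠ q in 𝓝 0, q ≠ 0 → (n + 1) * F.coeff1 (σ q) ≠ 0 ∨ q.1 * B (σ q) ≠ 0 := by
      filter_upwards [hiso, hBe'] with q h1 h2 h0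
      rcases h1 h0 with h | h
      · exact Or.inl (mul_ne_zero hn0 h)
      · right
        rw [h2] at h
        refine mul_ne_zero (fun h3 => ?_) (right_ne_zero_of_mul h)
        simp [hσ, h3] at h
    refine ⟨ofCoeff (fun q => (n + 1) * F.coeff1 (σ q)) (fun q => q.1 * B (σ q))
      (analyticAt_const.mul hc1) (analyticAt_fst.mul hB') iso, n, ?_⟩
    · filter_upwards [hBe'] with q h2
      refine ContinuousLinearMap.ext fun v => ?_
      rw [show ((q.1 ^ (n + 1), q.2) : ℂ × ℂ) = σ q from rfl, comp_fderiv_apply F (hd q), p1, p2, h2,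
        _root_.smul_apply, ω_apply, coeff1_ofCoeff, coeff2_ofCoeff]
      simp only [smul_eq_mul, hσ, pow_succ]
      ring
  · have iso : ∀ᶠ q in 𝓝 0, q ≠ 0 → F.pull1 σ q ≠ 0 ∨ F.pull2 σ q ≠ 0 := by
      filter_upwards [hiso, tendsto_snd_zero.eventually (eventually_nhdsWithin_iff.mp hz)]
        with q h1 h2 h0
      rw [p1, p2]
      by_cases hq : q.1 = 0
      · right
        have hq2 : q.2 ≠ 0 := fun h => h0 (Prod.ext hq h)
        simpa [hσ, hq] using h2 hq2
      · exact (h1 h0).imp (mul_ne_zero (mul_ne_zero hn0 (pow_ne_zero _ hq))) id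
    refine ⟨ofCoeff (F.pull1 σ) (F.pull2 σ) (F.analyticAt_pull1 hσh) (F.analyticAt_pull2 hσh) iso,
      0, ?_⟩
    · refine Eventually.of_forall fun q => ContinuousLinearMap.ext fun v => ?_
      rw [show ((q.1 ^ (n + 1), q.2) : ℂ × ℂ) = σ q from rfl, comp_fderiv_apply F (hd q), pow_zero,
        one_smul, ω_apply, coeff1_ofCoeff, coeff2_ofCoeff]

/-- The pullback of a foliation by a ramification whose axis is `t = 0`. -/
lemma exists_pullback_ramification (F : FoliationGerm) {f : ℂ × ℂ → ℂ × ℂ} (hf : IsBiholGerm f)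
    {n : ℕ} (hn : 1 ≤ n) : ∃ (G : FoliationGerm) (j : ℕ), ∀ᶠ q : ℂ × ℂ in 𝓝 0,
      (F.ω (f (q.1 ^ n, q.2))).comp (fderiv ℂ (fun q : ℂ × ℂ => f (q.1 ^ n, q.2)) q)
        = q.1 ^ j • G.ω q := by
  obtain ⟨F', hF'⟩ := hf.exists_pullback F
  obtain ⟨G, j, h⟩ := exists_pullback_pow F' hn
  have hσh : IsHolMapGerm fun q : ℂ × ℂ => (q.1 ^ n, q.2) :=
    isHolMapGerm_mk (analyticAt_fst.pow _) analyticAt_snd (by simp; omega) rfl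
  refine ⟨G, j, ?_⟩
  filter_upwards [h, hσh.tendsto.eventually hf.1.1.eventually_analyticAt] with q h1 h2
  have : fderiv ℂ (fun q : ℂ × ℂ => f (q.1 ^ n, q.2)) q
      = (fderiv ℂ f (q.1 ^ n, q.2)).comp (fderiv ℂ (fun q : ℂ × ℂ => (q.1 ^ n, q.2)) q) :=
    fderiv_comp (g := f) (f := fun q : ℂ × ℂ => (q.1 ^ n, q.2)) q h2.differentiableAt (by fun_prop)
  rw [this, ← ContinuousLinearMap.comp_assoc, hF', h1]

/-! ### Cancelling factors of a pullback -/

/-- Off the origin of the axis `x = 0` the coefficients of `G` have no common zero, so `h` vanishes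
on that axis and is divisible by `x`. -/
lemma exists_cancel_coordinate {x A₁ A₂ h : ℂ × ℂ → ℂ} (hx : x = Prod.fst ∨ x = Prod.snd)
    {G : FoliationGerm} (hA₁ : AnalyticAt ℂ A₁ 0) (hA₂ : AnalyticAt ℂ A₂ 0) (hh : AnalyticAt ℂ h 0)
    (h0 : ∃ᶠ q in 𝓝 0, h q ≠ 0) (h1 : ∀ᶠ q in 𝓝 0, x q * A₁ q = h q * G.coeff1 q)
    (h2 : ∀ᶠ q in 𝓝 0, x q * A₂ q = h q * G.coeff2 q) :
    ∃ k, AnalyticAt ℂ k 0 ∧ (∃ᶠ q in 𝓝 0, k q ≠ 0) ∧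
      (∀ᶠ q in 𝓝 0, A₁ q = k q * G.coeff1 q) ∧ (∀ᶠ q in 𝓝 0, A₂ q = k q * G.coeff2 q) := by
  have hv : ∀ᶠ q in 𝓝 0, q ≠ 0 → x q = 0 → h q = 0 := by
    filter_upwards [h1, h2, G.isolated_coeff] with q e1 e2 e3 hq hxq
    rw [hxq, zero_mul] at e1 e2
    rcases e3 hq with e | e
    · exact (mul_eq_zero.mp e1.symm).resolve_right e
    · exact (mul_eq_zero.mp e2.symm).resolve_right e
  have hclose : ∀ {f : ℂ → ℂ}, ContinuousAt f 0 → (∀ᶠ z in 𝓝 (0 : ℂ), z ≠ 0 → f z = 0) →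
      ∀ᶠ z in 𝓝 (0 : ℂ), f z = 0 := by
    intro f hf h
    have e1 : f 0 = 0 := by
      refine tendsto_nhds_unique (hf.tendsto.mono_left (nhdsWithin_le_nhds (s := {0}ᶜ))) ?_
      exact tendsto_const_nhds.congr' ((eventually_nhdsWithin_iff.mpr h).mono fun z h => h.symm)
    filter_upwards [h] with z hz
    by_cases h0 : z = 0
    · rw [h0, e1]
    · exact hz h0
  have hdiv : ∃ k, AnalyticAt ℂ k 0 ∧ ∀ᶠ q in 𝓝 0, h q = x q * k q := by
    rcases hx with rfl | rfl
    · refine exists_eq_fst_mul hh (hclose ?_ ?_)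
      · exact ContinuousAt.comp (f := fun y : ℂ => ((0 : ℂ), y)) (g := h) hh.continuousAt
          (by fun_prop)
      · filter_upwards [tendsto_inr_zero.eventually hv] with y hy h0
        exact hy (fun h => h0 (congrArg Prod.snd h)) rfl
    · refine exists_eq_snd_mul hh (hclose ?_ ?_)
      · exact ContinuousAt.comp (f := fun y : ℂ => (y, (0 : ℂ))) (g := h) hh.continuousAt
          (by fun_prop)
      · filter_upwards [tendsto_inl_zero.eventually hv] with y hy h0
        exact hy (fun h => h0 (congrArg Prod.fst h)) rfl
  have hext : ∀ {f g : ℂ × ℂ → ℂ}, AnalyticAt ℂ f 0 → AnalyticAt ℂ g 0 →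
      (∀ᶠ q in 𝓝 0, x q ≠ 0 → f q = g q) → ∀ᶠ q in 𝓝 0, f q = g q := by
    intro f g hf hg h
    refine eventually_eq_of_axes_ne hf hg (h.mono fun q hq a1 a2 => hq ?_)
    rcases hx with rfl | rfl
    · exact a1
    · exact a2
  obtain ⟨k, hk, hke⟩ := hdiv
  refine ⟨k, hk, fun hk0 => h0 ?_, hext hA₁ (hk.mul G.analyticAt_coeff1) ?_,
    hext hA₂ (hk.mul G.analyticAt_coeff2) ?_⟩
  · filter_upwards [hk0, hke] with q a1 a2
    rw [a2, not_not.mp a1]; simp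
  · filter_upwards [h1, hke] with q a1 a2 a3
    refine mul_left_cancel₀ a3 ?_
    rw [a1, a2]; ring
  · filter_upwards [h2, hke] with q a1 a2 a3
    refine mul_left_cancel₀ a3 ?_
    rw [a1, a2]; ring

lemma exists_cancel_monomial {A₁ A₂ h : ℂ × ℂ → ℂ} {G : FoliationGerm} (hA₁ : AnalyticAt ℂ A₁ 0)
    (hA₂ : AnalyticAt ℂ A₂ 0) (i j : ℕ) (hh : AnalyticAt ℂ h 0) (h0 : ∃ᶠ q in 𝓝 0, h q ≠ 0)
    (h1 : ∀ᶠ q : ℂ × ℂ in 𝓝 0, q.1 ^ i * q.2 ^ j * A₁ q = h q * G.coeff1 q)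
    (h2 : ∀ᶠ q : ℂ × ℂ in 𝓝 0, q.1 ^ i * q.2 ^ j * A₂ q = h q * G.coeff2 q) :
    ∃ k, AnalyticAt ℂ k 0 ∧ (∃ᶠ q in 𝓝 0, k q ≠ 0) ∧
      (∀ᶠ q in 𝓝 0, A₁ q = k q * G.coeff1 q) ∧ (∀ᶠ q in 𝓝 0, A₂ q = k q * G.coeff2 q) := by
  have hm : ∀ i j : ℕ, ∀ {A : ℂ × ℂ → ℂ}, AnalyticAt ℂ A 0 →
      AnalyticAt ℂ (fun q : ℂ × ℂ => q.1 ^ i * q.2 ^ j * A q) 0 := fun i j A hA =>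
    ((analyticAt_fst.pow i).mul (analyticAt_snd.pow j)).mul hA
  induction i generalizing h with
  | succ i ih =>
    obtain ⟨k, hk, hk0, e1, e2⟩ := exists_cancel_coordinate (G := G) (Or.inl rfl) (hm i j hA₁)
      (hm i j hA₂) hh h0 (h1.mono fun q hq => by rw [← hq]; ring)
      (h2.mono fun q hq => by rw [← hq]; ring)
    exact ih hk hk0 e1 e2
  | zero =>
    induction j generalizing h with
    | succ j ih =>
      obtain ⟨k, hk, hk0, e1, e2⟩ := exists_cancel_coordinate (G := G) (Or.inr rfl) (hm 0 j hA₁)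
        (hm 0 j hA₂) hh h0 (h1.mono fun q hq => by rw [← hq]; ring)
        (h2.mono fun q hq => by rw [← hq]; ring)
      exact ih hk hk0 e1 e2
    | zero => exact ⟨h, hh, h0, by simpa using h1, by simpa using h2⟩

/-- A pullback by `ρ ∘ p` is a pullback by `p` of the pullback by `ρ`. -/
lemma FoliationGerm.IsPullback.of_comp_monomial {F G H : FoliationGerm} {ρ p : ℂ × ℂ → ℂ × ℂ}
    (hρ : IsHolMapGerm ρ) (hp : IsHolMapGerm p) {j : ℕ}
    (hG : ∀ᶠ q in 𝓝 0, (F.ω (ρ q)).comp (fderiv ℂ ρ q) = q.1 ^ j • G.ω q)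
    (h : IsPullback (ρ ∘ p) F H) {a b : ℕ} (hp1 : ∀ q, (p q).1 = q.1 ^ a * q.2 ^ b) :
    IsPullback p G H := by
  obtain ⟨k, hk, hk0, h1, h2⟩ := h.coeff (hρ.comp hp).1
  have key : ∀ᶠ q in 𝓝 0, ∀ v : ℂ × ℂ, v.1 * F.pull1 (ρ ∘ p) q + v.2 * F.pull2 (ρ ∘ p) q
      = q.1 ^ (a * j) * q.2 ^ (b * j) * (v.1 * G.pull1 p q + v.2 * G.pull2 p q) := by
    filter_upwards [hp.tendsto.eventually hG, hp.1.eventually_analyticAt,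
      hp.tendsto.eventually hρ.1.eventually_analyticAt] with q e1 e2 e3 v
    rw [← comp_fderiv_apply F (e3.differentiableAt.comp q e2.differentiableAt),
      ← comp_fderiv_apply G e2.differentiableAt,
      fderiv_comp q e3.differentiableAt e2.differentiableAt, ← ContinuousLinearMap.comp_assoc,
      Function.comp_apply, e1, hp1, mul_pow, ← pow_mul, ← pow_mul]
    rfl
  obtain ⟨l, hl, hl0, e1, e2⟩ := exists_cancel_monomial (G := H) (G.analyticAt_pull1 hp)
    (G.analyticAt_pull2 hp) (a * j) (b * j) hk hk0
    (by
      filter_upwards [key, h1] with q a1 a2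
      have := a1 (1, 0)
      simp only [one_mul, zero_mul, add_zero] at this
      rw [← this, a2])
    (by
      filter_upwards [key, h2] with q a1 a2
      have := a1 (0, 1)
      simp only [one_mul, zero_mul, zero_add] at this
      rw [← this, a2])
  exact isPullback_of_coeff hp.1 hl hl0 e1 e2

/-! ### The theorem -/

/-- A ramification that desingularizes in the sense of `Good` has the required properties. -/
lemma Good.exists_elimination {F G : FoliationGerm} {L : List InfNearPoint} {ρ : ℂ × ℂ → ℂ × ℂ}
    (hρ : IsHolMapGerm ρ) {j : ℕ}
    (hG : ∀ᶠ q in 𝓝 0, (F.ω (ρ q)).comp (fderiv ℂ ρ q) = q.1 ^ j • G.ω q)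
    (h : Good F id ρ {p | p ∈ L}) :
    ∃ M, IsEliminationOfIndet L ρ M ∧ IsRegularBlowUpSequence M ∧
      ∃ G : FoliationGerm, IsPullback ρ F G ∧ G.HasOnlySimpleSingularitiesAfter M := by
  obtain ⟨M, hM, hMN⟩ := (treeClosed_nonLift ρ {p | p ∈ L}).exists_blowUpSequence h.finite
  have hfd : ∀ p ∈ M, p.FiniteDirections := fun p hp =>
    h.finiteDirections p (by rw [← hMN]; exact hp)
  refine ⟨M, isEliminationOfIndet_of_nonLift hM hMN, ⟨hM, fun p hp => (hfd p hp).not_isCorner⟩, G,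
    ⟨fun q => q.1 ^ j, analyticAt_fst.pow j,
      frequently_fst_ne_zero.mono fun q hq => pow_ne_zero j hq, hG⟩, fun p hp => ?_⟩
  obtain ⟨H, hH, hH'⟩ := h.simple p (by rw [← hMN]; exact hp)
  -- A point that is not a centre lies at most one step beyond finite directions, so the first
  -- coordinate there is `t` or `t y`. Hence the factor `t ^ j` of the pullback by `ρ` becomes a
  -- monomial that can be cancelled.
  obtain ⟨a, b, hab⟩ : ∃ a b : ℕ, ∀ q, (p.proj q).1 = q.1 ^ a * q.2 ^ b := by
    cases p with
    | origin => exact ⟨1, 0, fun q => by simp [InfNearPoint.proj]⟩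
    | above p d =>
      have hpf : p.FiniteDirections := hfd p hp.2
      rcases d with _ | c
      · exact ⟨1, 1, fun q => by simp [InfNearPoint.proj, hpf.proj_fst, blowUpChart]⟩
      · exact ⟨1, 0, fun q => by simp [InfNearPoint.proj, hpf.proj_fst, blowUpChart]⟩
  exact ⟨H, IsPullback.of_comp_monomial hρ p.isHolMapGerm_proj hG hH hab, hH'⟩

lemma isBiholGerm_id : IsBiholGerm id :=
  ⟨isHolMapGerm_id, id, isHolMapGerm_id, EventuallyEq.rfl, EventuallyEq.rfl⟩

/-- This target coordinate change turns `(tⁿ, y)` into the germ `curveMap d e n 0 Prod.snd`. -/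
lemma isBiholGerm_curve (d e : ℂ) :
    IsBiholGerm fun q => (q.2, d * q.2 + e * q.2 ^ 2 + q.1) := by
  refine ⟨isHolMapGerm_mk analyticAt_snd (((analyticAt_const.mul analyticAt_snd).add
      (analyticAt_const.mul (analyticAt_snd.pow 2))).add analyticAt_fst) rfl (by simp),
    fun q => (q.2 - d * q.1 - e * q.1 ^ 2, q.1),
    isHolMapGerm_mk ((analyticAt_snd.sub (analyticAt_const.mul analyticAt_fst)).sub
      (analyticAt_const.mul (analyticAt_fst.pow 2))) analyticAt_fst (by simp) rfl, ?_, ?_⟩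
  · refine Eventually.of_forall fun q => ?_
    ext <;> simp only [Function.comp, id]
    ring
  · refine Eventually.of_forall fun q => ?_
    ext <;> simp only [Function.comp, id]
    ring

theorem mainTheorem2 (F : FoliationGerm) (L : List InfNearPoint)
    (hL : F.IsReductionOfSingularities L) :
    ∃ (ρ : ℂ × ℂ → ℂ × ℂ) (M : List InfNearPoint),
      IsRamification ρ ∧ IsEliminationOfIndet L ρ M ∧ IsRegularBlowUpSequence M ∧
      ∃ G : FoliationGerm, FoliationGerm.IsPullback ρ F G ∧
        G.HasOnlySimpleSingularitiesAfter M := by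
  obtain ⟨m, h⟩ := hL.exists_isAdaptedTree
  suffices ∃ (f : ℂ × ℂ → ℂ × ℂ) (n : ℕ), IsBiholGerm f ∧ 1 ≤ n ∧
      Good F id (fun q => f (q.1 ^ n, q.2)) {p | p ∈ L} by
    obtain ⟨f, n, hf, hn, hgood⟩ := this
    obtain ⟨G, j, hG⟩ := exists_pullback_ramification F hf hn
    have hρ : IsHolMapGerm fun q : ℂ × ℂ => f (q.1 ^ n, q.2) :=
      hf.1.comp (isHolMapGerm_mk (analyticAt_fst.pow n) analyticAt_snd (by simp; omega) rfl)
    obtain ⟨M, h1, h2, h3⟩ := hgood.exists_elimination hρ hG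
    exact ⟨_, M, ⟨n, hn, f, id, hf, isBiholGerm_id, EventuallyEq.rfl⟩, h1, h2, h3⟩
  by_cases h0 : .origin ∈ L
  · obtain ⟨d, e, H, hS, hH, hA⟩ := h.exists_generic_direction h0
    obtain ⟨hR, -⟩ := ramificationsGood_and_powersGood F (B := 2 ^ (m + 1)) m le_rfl
    have hpos : 0 < (2 ^ (m + 1)).factorial ^ m := pow_pos (Nat.factorial_pos _) _
    -- The power of the factorial serves the trees of height `m` over the points of `E₁`; the factor
    -- `2` makes the order even.
    refine ⟨_, 2 * (2 ^ (m + 1)).factorial ^ m, isBiholGerm_curve d e, by omega, ?_⟩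
    refine (good_curveMap h h0 hR (by omega) (even_two_mul _) (Dvd.intro_left 2 rfl) hS hH hA).congr ?_
    refine Eventually.of_forall fun q => ?_
    simp [curveMap]
  · refine ⟨id, 1, isBiholGerm_id, le_rfl, ?_⟩
    obtain ⟨G, hG, hG'⟩ := hL.2 .origin ⟨h0, trivial⟩
    have e : id = fun q : ℂ × ℂ => id (q.1 ^ 1, q.2) := by funext q; simp
    rw [← e]
    exact Good.of_lifts (liftsS_of_origin_notMem h0 isHolMapGerm_id)
      ⟨G, hG, hG'.imp And.left And.left⟩
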